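/- Let $M$ be a smooth manifold and let $(\mathcal P,A,\pi,\mu)$ be a $\mathrm U(1)$ bundle gerbe with connective structure on $M$: a surjective submersion $\pi\colon Y\to M$, a $\mathrm U(1)$-bundle $\mathcal P\to Y^{[2]}=Y\times_M Y$ with connection $A$, and an associative connection-preserving isomorphism $\mu\colon \pi_{12}^*\mathcal P\otimes\pi_{23}^*\mathcal P\to\pi_{13}^*\mathcal P$ over $Y^{[3]}$. A curving is a form $b\in\Omega^2(Y)$ with $\pi_2^*b-\pi_1^*b=F_A$; its curvature is the unique $H_b\in\Omega^3(M)$ with $\pi^*H_b=\mathrm db$. Let $\mathcal C$ be the set of curvings; it is an affine space modelled on $\Omega^2(M)$, with $\phi\in\Omega^2(M)$ acting by $b\mapsto b+\pi^*\phi$ (any two curvings differ by $\pi^*\phi$ for a unique $\phi$). (1) Let $f\colon M\to M$ be a diffeomorphism, let $(\mathcal P^f,A^f,\pi^f)$ with $\widehat f\colon Y^f\to Y$ be the pullback of the gerbe along $f$, and let $(\mathcal Q,\Theta,\xi,\Psi)\colon(\mathcal P,A,\pi,\mu)\to(\mathcal P^f,A^f,\pi^f)$ be a stable isomorphism: a surjective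 submersion $\xi\colon Z\to Y\times_M Y^f$, a $\mathrm U(1)$-bundle $\mathcal Q\to Z$ with connection $\Theta$, and a connection-preserving isomorphism $\Psi$ over $Z\times_M Z$, with fibres $\mathcal P\otimes\mathcal Q_{z_2}\to\mathcal Q_{z_1}\otimes\mathcal P^f$, compatible with the gerbe multiplications. Put $\zeta=p_Y\circ\xi\colon Z\to Y$, and let $F_\Theta\in\Omega^2(Z)$ be the curvature of $\Theta$. Then for every curving $b$: - $(p_{Y^f}\circ\xi)^*\widehat f^*b-F_\Theta$ is annihilated by the Čech differential of $\zeta$ (its two pullbacks to $Z\times_Y Z$ agree); - there is a unique $b'\in\Omega^2(Y)$ with $(p_{Y^f}\circ\xi)^*\widehat f^*b=\zeta^*b'+F_\Theta$; - $b'$ is a curving of $(\mathcal P,A,\pi,\mu)$, and $H_{b'}=f^*H_b$. (2) Let $\mathrm{Aut}=\mathrm{Aut}(\mathcal P,A,\pi,\mu)$ be the 2-group whose objects are the automorphisms $\alpha=(\mathcal Q,\Theta,\xi,\Psi,f)$ as in (1) with $f$ isotopic to the identity, whose morphisms are the 2-isomorphisms between automorphisms covering the same diffeomorphism, and whose product is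 the composition $\alpha'\circ\alpha$ of $\alpha\colon\mathcal P\to\mathcal P^f$ with $f^*\alpha'\colon\mathcal P^f\to\mathcal P^{f'\circ f}$. Write $b\cdot\alpha$ for the curving $b'$ of (1). Then $(b,\alpha)\mapsto b\cdot\alpha$ is a right action of $\mathrm{Aut}$ on the affine space $\mathcal C$: $$b\cdot\mathrm{id}=b,\qquad b\cdot(\alpha'\circ\alpha)=(b\cdot\alpha')\cdot\alpha,\qquad b\cdot\alpha=b\cdot\beta\ \text{ whenever }\alpha\cong\beta,\qquad (b+\pi^*\phi)\cdot\alpha=b\cdot\alpha+\pi^*f^*\phi .$$ The isomorphism classes of automorphisms form a group $\pi_0\mathrm{Aut}$ under composition, and the action factors through a right action of the group $\pi_0\mathrm{Aut}$ on $\mathcal C$. -/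

import Mathlib

open scoped Manifold ContDiff

universe u

noncomputable section

namespace GerbeAction

/-! ### Smooth manifolds and differential forms -/

/-- A smooth manifold: finite-dimensional, without boundary, Hausdorff and second countable. -/
structure Mfd where
  carrier : Type u
  /-- The model vector space. -/
  E : Type
  [normE : NormedAddCommGroup E]
  [spaceE : NormedSpace ℝ E]
  [finE : FiniteDimensional ℝ E]
  [top : TopologicalSpace carrier]
  [t2 : T2Space carrier]
  [sc : SecondCountableTopology carrier]
  [charted : ChartedSpace E carrier]
  [mfd : IsManifold 𝓘(ℝ, E) ∞ carrier]

instance : CoeSort Mfd.{u} (Type u) := ⟨Mfd.carrier⟩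

attribute [instance] Mfd.normE Mfd.spaceE Mfd.finE Mfd.top Mfd.t2 Mfd.sc Mfd.charted Mfd.mfd

/-- The model with corners of a manifold (the identity: there is no boundary). -/
abbrev Mfd.I (X : Mfd.{u}) : ModelWithCorners ℝ X.E X.E := 𝓘(ℝ, X.E)

/-- Smooth maps of manifolds. -/
def Smooth {X Y : Mfd.{u}} (f : X → Y) : Prop := ContMDiff X.I Y.I ∞ f

/-- Diffeomorphisms of a manifold. -/
abbrev Diff (X : Mfd.{u}) : Type u := Diffeomorph X.I X.I X X ∞

/-- The differential of a map, `T_x X → T_{f x} Y`. -/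
abbrev D {X Y : Mfd.{u}} (f : X → Y) (x : X) : TangentSpace X.I x →L[ℝ] TangentSpace Y.I (f x) :=
  mfderiv X.I Y.I f x

/-- A (not necessarily smooth) differential form of degree `k`; smoothness is the predicate
`DForm.IsSmooth`. -/
abbrev DForm (X : Mfd.{u}) (k : ℕ) : Type u := ∀ x : X, (TangentSpace X.I x) [⋀^Fin k]→L[ℝ] ℝ

/-- The pullback `f^* ϕ`. -/
def DForm.pullback {X Y : Mfd.{u}} {k : ℕ} (f : X → Y) (ϕ : DForm Y k) : DForm X k :=
  fun x => (ϕ (f x)).compContinuousLinearMap (D f x)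

/-- The expression of a form in the chart at `x₀`: its pullback along the inverse chart, a form on
the open subset `(extChartAt X.I x₀).target` of the model space. -/
def DForm.inChart {X : Mfd.{u}} {k : ℕ} (ϕ : DForm X k) (x₀ : X) : X.E → X.E [⋀^Fin k]→L[ℝ] ℝ :=
  fun e => (ϕ ((extChartAt X.I x₀).symm e)).compContinuousLinearMap
    (mfderiv 𝓘(ℝ, X.E) X.I (extChartAt X.I x₀).symm e)

/-- A form is smooth if it is smooth in charts. -/
def DForm.IsSmooth {X : Mfd.{u}} {k : ℕ} (ϕ : DForm X k) : Prop :=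
  ∀ x₀ : X, ContDiffOn ℝ ∞ (ϕ.inChart x₀) (extChartAt X.I x₀).target

/-- The exterior derivative, computed in the chart at each point. -/
def DForm.d {X : Mfd.{u}} {k : ℕ} (ϕ : DForm X k) : DForm X (k + 1) :=
  fun x => (extDeriv (ϕ.inChart x) (extChartAt X.I x x)).compContinuousLinearMap
    (mfderiv X.I 𝓘(ℝ, X.E) (extChartAt X.I x) x)

/-! ### Surjective submersions -/

/-- `f : X → B` is a surjective submersion. -/
structure IsSurjSubmersion {X B : Mfd.{u}} (f : X → B) : Prop where
  smooth : Smooth f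
  surj : Function.Surjective f
  subm : ∀ x, Function.Surjective (D f x)

/-- For surjective submersions `f : X → B` and `g : Y → B`, the map `(p, q) : N → X × Y` is a
surjective submersion onto the fibre product `X ×_B Y`. Here
`X ×_B Y = {(x, y) | f x = g y}` is a submanifold of `X × Y` with tangent spaces
`T_(x, y) (X ×_B Y) = {(v, w) | df v = dg w}`. -/
structure IsSurjSubmersionOnto {X Y B N : Mfd.{u}} (f : X → B) (g : Y → B) (p : N → X) (q : N → Y) :
    Prop where
  smooth_left : Smooth p
  smooth_right : Smooth q
  comm : ∀ n, f (p n) = g (q n)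
  surj : ∀ x y, f x = g y → ∃ n, p n = x ∧ q n = y
  subm : ∀ n (v : TangentSpace X.I (p n)) (w : TangentSpace Y.I (q n)),
    (D f (p n) v : B.E) = (D g (q n) w : B.E) → ∃ ν : TangentSpace N.I n, D p n ν = v ∧ D q n ν = w

/-! ### Principal `U(1)`-bundles with connection -/

/-- The total space of a principal `U(1)`-bundle with connection: a manifold with a smooth action of
`U(1)` and a connection form `A`, normalized to be real valued: `A` is an invariant one-form which
takes the value `1` on the velocity at `θ = 0` of `θ ↦ exp (i θ) • p`. -/
structure U1Conn where
  tot : Mfd.{u}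
  [act : MulAction Circle tot]
  smooth_act : ContMDiff ((𝓡 1).prod tot.I) tot.I ∞ (fun x : Circle × tot => x.1 • x.2)
  A : DForm tot 1
  smooth_A : A.IsSmooth
  inv_A : ∀ c : Circle, A.pullback (fun p : tot => c • p) = A
  vert_A : ∀ p : tot, A (Circle.exp 0 • p)
    (fun _ => mfderiv 𝓘(ℝ, ℝ) tot.I (fun θ : ℝ => Circle.exp θ • p) 0 (1 : ℝ)) = 1

instance : CoeSort U1Conn.{u} (Type u) := ⟨fun P => P.tot.carrier⟩

attribute [instance] U1Conn.act

/-- The action of `U(1)` on `P` is principal for the equivalence relation `r` ("lying over the same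
base point"): it is free, its orbits are the classes of `r`, and division is smooth, that is, the
bijection `P × U(1) → P ×_base P` has a smooth inverse. As everywhere below, a map out of a fibre
product is smooth if its composites with all smooth maps from manifolds into the fibre product
are. -/
structure IsPrincipal (P : U1Conn.{u}) (r : P → P → Prop) : Prop where
  free : ∀ (c : Circle) (p : P), c • p = p → c = 1
  orbit : ∀ p p' : P, r p p' ↔ ∃ c : Circle, c • p = p'
  smooth_div : ∀ (T : Mfd.{u}) (a b : T → P.tot) (c : T → Circle), Smooth a → Smooth b →
    (∀ τ, c τ • a τ = b τ) → ContMDiff T.I (𝓡 1) ∞ c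

/-! ### Bundle gerbes -/

/-- A bundle gerbe on `M` with connective structure: a surjective submersion `π : Y → M`, a
`U(1)`-bundle `P` with connection over `Y ×_M Y`, whose projection is `(s, t) : P → Y ×_M Y`, and
an associative, connection-preserving isomorphism `μ` whose value at `(y₁, y₂, y₃)` is
`P_(y₁, y₂) ⊗ P_(y₂, y₃) → P_(y₁, y₃)`.

An isomorphism `L₁ ⊗ L₂ → L₃` of `U(1)`-bundles is given by the smooth map `L₁ × L₂ → L₃` over the
base, `U(1)`-equivariant in each variable; it preserves connections if the pullback of the
connection form of `L₃` to the fibre product of `L₁` and `L₂` is the sum of the connection forms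
of `L₁` and `L₂`. -/
structure BundleGerbe (M : Mfd.{u}) where
  Y : Mfd.{u}
  π : Y → M
  π_subm : IsSurjSubmersion π
  P : U1Conn.{u}
  s : P → Y
  t : P → Y
  proj : IsSurjSubmersionOnto (N := P.tot) π π s t
  principal : IsPrincipal P (fun p p' => s p = s p' ∧ t p = t p')
  μ : ∀ p p' : P, t p = s p' → P
  s_μ : ∀ p p' h, s (μ p p' h) = s p
  t_μ : ∀ p p' h, t (μ p p' h) = t p'
  μ_smul : ∀ (c c' : Circle) (p p' : P) (h : t p = s p') (h' : t (c • p) = s (c' • p')),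
    μ (c • p) (c' • p') h' = (c * c') • μ p p' h
  μ_assoc : ∀ (p p' p'' : P) (h : t p = s p') (h' : t p' = s p''),
    μ (μ p p' h) p'' ((t_μ p p' h).trans h') = μ p (μ p' p'' h') (h.trans (s_μ p' p'' h').symm)
  μ_smooth : ∀ (T : Mfd.{u}) (a a' : T → P.tot) (h : ∀ τ, t (a τ) = s (a' τ)),
    Smooth a → Smooth a' → Smooth (fun τ => (μ (a τ) (a' τ) (h τ) : P.tot))
  μ_conn : ∀ (T : Mfd.{u}) (a a' : T → P.tot) (h : ∀ τ, t (a τ) = s (a' τ)),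
    Smooth a → Smooth a' →
    P.A.pullback (fun τ => (μ (a τ) (a' τ) (h τ) : P.tot)) = P.A.pullback a + P.A.pullback a'

/-- `b ∈ Ω²(Y)` is a curving: `π₂^* b - π₁^* b = F_A`. The curvature `F_A ∈ Ω²(Y ×_M Y)` is the form
with pullback `dA` to `P`; pullback along the surjective submersion `P → Y ×_M Y` is injective on
forms, and the equation is written on `P`. -/
structure BundleGerbe.IsCurving {M : Mfd.{u}} (G : BundleGerbe M) (b : DForm G.Y 2) : Prop where
  smooth : b.IsSmooth
  eq : (b.pullback G.t : DForm G.P.tot 2) - b.pullback G.s = G.P.A.d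

/-- The set of curvings. -/
abbrev BundleGerbe.Curving {M : Mfd.{u}} (G : BundleGerbe M) : Type u :=
  {b : DForm G.Y 2 // G.IsCurving b}

/-- `H ∈ Ω³(M)` is the curvature of `b ∈ Ω²(Y)`: `π^* H = db`. -/
structure BundleGerbe.IsCurvature {M : Mfd.{u}} (G : BundleGerbe M) (b : DForm G.Y 2)
    (H : DForm M 3) : Prop where
  smooth : H.IsSmooth
  eq : H.pullback G.π = b.d

/-! ### Pullback along diffeomorphisms of the base -/

lemma Diff.D_comp {M X : Mfd.{u}} (f : Diff M) {g : X → M} (hg : Smooth g) (x : X)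
    (v : TangentSpace X.I x) :
    D (fun x => f (g x)) x v = D (Y := M) f (g x) (D g x v) := by
  have h := mfderiv_comp (I := X.I) (I' := M.I) (I'' := M.I) x
    ((f.contMDiff.mdifferentiable (by simp)) (g x)) ((hg.mdifferentiable (by simp)) x)
  exact congrArg (fun L => L v) h

lemma Diff.D_bijective {M : Mfd.{u}} (f : Diff M) (x : M) : Function.Bijective (D (Y := M) f x) :=
  (f.mfderivToContinuousLinearEquiv (by simp) x).bijective

lemma IsSurjSubmersion.postcomp {M X : Mfd.{u}} {g : X → M} (hg : IsSurjSubmersion g)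
    (f : Diff M) : IsSurjSubmersion (fun x => f (g x)) where
  smooth := f.contMDiff.comp hg.smooth
  surj := f.surjective.comp hg.surj
  subm x w := by
    obtain ⟨v, hv⟩ := (f.D_bijective (g x)).2 w
    obtain ⟨v', hv'⟩ := hg.subm x v
    exact ⟨v', by rw [f.D_comp hg.smooth, hv', hv]⟩

lemma IsSurjSubmersionOnto.postcomp {M X Y N : Mfd.{u}} {g : X → M} {g' : Y → M} {p : N → X}
    {q : N → Y} (h : IsSurjSubmersionOnto g g' p q) (hg : Smooth g) (hg' : Smooth g')
    (f : Diff M) : IsSurjSubmersionOnto (fun x => f (g x)) (fun y => f (g' y)) p q where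
  smooth_left := h.smooth_left
  smooth_right := h.smooth_right
  comm n := congrArg f (h.comm n)
  surj x y hxy := h.surj x y (f.injective hxy)
  subm n v w hvw := by
    apply h.subm n v w
    rw [f.D_comp hg, f.D_comp hg'] at hvw
    have key : ∀ (m m' : M) (a : TangentSpace M.I m) (a' : TangentSpace M.I m'), m = m' →
        (D (Y := M) f m a : M.E) = (D (Y := M) f m' a' : M.E) → (a : M.E) = (a' : M.E) := by
      rintro m _ a a' rfl haa
      exact (f.D_bijective m).1 haa
    exact key _ _ _ _ (h.comm n) hvw

/-- The pullback of a bundle gerbe along a diffeomorphism `f` of the base. The pullback of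
`π : Y → M` is represented by `Y^f = Y` with the projection `f⁻¹ ∘ π` (the map
`Y^f → Y` covering `f` is the identity), so that `Y^f ×_M Y^f = Y ×_M Y`. -/
def BundleGerbe.pullback {M : Mfd.{u}} (G : BundleGerbe M) (f : Diff M) : BundleGerbe M :=
  { G with
    π := fun y => f.symm (G.π y)
    π_subm := G.π_subm.postcomp f.symm
    proj := G.proj.postcomp G.π_subm.smooth G.π_subm.smooth f.symm }

/-! ### Isomorphisms of bundle gerbes -/

/-- A (stable) isomorphism `(Q, Θ, ξ, Ψ) : G₁ → G₂`: a surjective submersion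
`ξ = (ζ, η) : Z → Y₁ ×_M Y₂`, a `U(1)`-bundle `pr : Q → Z` with connection `Θ = Q.A`, and a
connection-preserving isomorphism, over `(z₁, z₂) ∈ Z ×_M Z`,
`Ψ : P₁_(ζ z₁, ζ z₂) ⊗ Q_(z₂) → Q_(z₁) ⊗ P₂_(η z₁, η z₂)`,
compatible with the multiplications of `G₁` and `G₂`.

The isomorphism is given by the map `(q₁, p, q₂) ↦ Ψ q₁ p q₂ ∈ P₂` for which it sends
`p ⊗ q₂` to `q₁ ⊗ Ψ q₁ p q₂`. -/
structure BundleGerbe.Iso {M : Mfd.{u}} (G₁ G₂ : BundleGerbe M) where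
  Z : Mfd.{u}
  ζ : Z → G₁.Y
  η : Z → G₂.Y
  ξ_subm : IsSurjSubmersionOnto G₁.π G₂.π ζ η
  Q : U1Conn.{u}
  pr : Q → Z
  pr_subm : IsSurjSubmersion (X := Q.tot) pr
  principal : IsPrincipal Q (fun q q' => pr q = pr q')
  Ψ : ∀ (q₁ : Q) (p : G₁.P) (q₂ : Q), ζ (pr q₁) = G₁.s p → ζ (pr q₂) = G₁.t p → G₂.P
  s_Ψ : ∀ q₁ p q₂ h h', G₂.s (Ψ q₁ p q₂ h h') = η (pr q₁)
  t_Ψ : ∀ q₁ p q₂ h h', G₂.t (Ψ q₁ p q₂ h h') = η (pr q₂)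
  Ψ_smul : ∀ (c₁ c c₂ : Circle) (q₁ : Q) (p : G₁.P) (q₂ : Q) h h' h₁ h₁',
    Ψ (c₁ • q₁) (c • p) (c₂ • q₂) h₁ h₁' = (c₁⁻¹ * c * c₂) • Ψ q₁ p q₂ h h'
  Ψ_smooth : ∀ (T : Mfd.{u}) (a₁ : T → Q.tot) (a : T → G₁.P.tot) (a₂ : T → Q.tot)
    (h : ∀ τ, ζ (pr (a₁ τ)) = G₁.s (a τ)) (h' : ∀ τ, ζ (pr (a₂ τ)) = G₁.t (a τ)),
    Smooth a₁ → Smooth a → Smooth a₂ →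
    Smooth (fun τ => (Ψ (a₁ τ) (a τ) (a₂ τ) (h τ) (h' τ) : G₂.P.tot))
  Ψ_conn : ∀ (T : Mfd.{u}) (a₁ : T → Q.tot) (a : T → G₁.P.tot) (a₂ : T → Q.tot)
    (h : ∀ τ, ζ (pr (a₁ τ)) = G₁.s (a τ)) (h' : ∀ τ, ζ (pr (a₂ τ)) = G₁.t (a τ)),
    Smooth a₁ → Smooth a → Smooth a₂ →
    G₁.P.A.pullback a + Q.A.pullback a₂ =
      Q.A.pullback a₁ +
        G₂.P.A.pullback (fun τ => (Ψ (a₁ τ) (a τ) (a₂ τ) (h τ) (h' τ) : G₂.P.tot))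
  /-- For `p₁₂ ⊗ p₂₃ ⊗ q₃`, multiplying first and applying `Ψ` agrees with applying `Ψ` twice and
  multiplying afterwards. -/
  Ψ_μ : ∀ (q₁ : Q) (p₁₂ : G₁.P) (q₂ : Q) (p₂₃ : G₁.P) (q₃ : Q)
    (h₁ : ζ (pr q₁) = G₁.s p₁₂) (h₂ : ζ (pr q₂) = G₁.t p₁₂)
    (h₂' : ζ (pr q₂) = G₁.s p₂₃) (h₃ : ζ (pr q₃) = G₁.t p₂₃),
    Ψ q₁ (G₁.μ p₁₂ p₂₃ (h₂.symm.trans h₂')) q₃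
        (h₁.trans (G₁.s_μ _ _ _).symm) (h₃.trans (G₁.t_μ _ _ _).symm) =
      G₂.μ (Ψ q₁ p₁₂ q₂ h₁ h₂) (Ψ q₂ p₂₃ q₃ h₂' h₃)
        ((t_Ψ _ _ _ _ _).trans (s_Ψ _ _ _ _ _).symm)

namespace BundleGerbe.Iso

variable {M : Mfd.{u}} {G₁ G₂ G₃ : BundleGerbe M}

/-- `F ∈ Ω²(Z)` is the curvature `F_Θ` of `Θ`: its pullback to `Q` is `dΘ`. -/
structure IsCurvature (S : Iso G₁ G₂) (F : DForm S.Z 2) : Prop where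
  smooth : F.IsSmooth
  eq : F.pullback (X := S.Q.tot) S.pr = S.Q.A.d

/-- The isomorphism relates `b₁` to `b₂`: `η^* b₂ = ζ^* b₁ + F_Θ`. -/
def Relates (S : Iso G₁ G₂) (b₁ : DForm G₁.Y 2) (b₂ : DForm G₂.Y 2) : Prop :=
  ∃ F : DForm S.Z 2, S.IsCurvature F ∧ b₂.pullback S.η = b₁.pullback S.ζ + F

/-- The pullback `f^* S : f^* G₁ → f^* G₂` along a diffeomorphism of the base. -/
def pullback (S : Iso G₁ G₂) (f : Diff M) : Iso (G₁.pullback f) (G₂.pullback f) where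
  Z := S.Z
  ζ := S.ζ
  η := S.η
  ξ_subm := S.ξ_subm.postcomp G₁.π_subm.smooth G₂.π_subm.smooth f.symm
  Q := S.Q
  pr := S.pr
  pr_subm := S.pr_subm
  principal := S.principal
  Ψ := S.Ψ
  s_Ψ := S.s_Ψ
  t_Ψ := S.t_Ψ
  Ψ_smul := S.Ψ_smul
  Ψ_smooth := S.Ψ_smooth
  Ψ_conn := S.Ψ_conn
  Ψ_μ := S.Ψ_μ

/-- (A representative of) a 2-isomorphism `S → S'`: a surjective submersion
`(w, w') : W → Z ×_{Y₁ ×_M Y₂} Z'` and a connection-preserving isomorphism over `W`,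
`β : Q_(w x) → Q'_(w' x)`, compatible with `Ψ` and `Ψ'` over `W ×_M W`. -/
structure TwoIso (S S' : Iso G₁ G₂) where
  W : Mfd.{u}
  w : W → S.Z
  w' : W → S'.Z
  smooth_w : Smooth w
  smooth_w' : Smooth w'
  comm₁ : ∀ x, S.ζ (w x) = S'.ζ (w' x)
  comm₂ : ∀ x, S.η (w x) = S'.η (w' x)
  surj : ∀ z z', S.ζ z = S'.ζ z' → S.η z = S'.η z' → ∃ x, w x = z ∧ w' x = z'
  subm : ∀ x (v : TangentSpace S.Z.I (w x)) (v' : TangentSpace S'.Z.I (w' x)),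
    (D S.ζ (w x) v : G₁.Y.E) = (D S'.ζ (w' x) v' : G₁.Y.E) →
    (D S.η (w x) v : G₂.Y.E) = (D S'.η (w' x) v' : G₂.Y.E) →
    ∃ ν : TangentSpace W.I x, D w x ν = v ∧ D w' x ν = v'
  β : ∀ (x : W) (q : S.Q), S.pr q = w x → S'.Q
  pr_β : ∀ x q h, S'.pr (β x q h) = w' x
  β_smul : ∀ (c : Circle) (x : W) (q : S.Q) h h', β x (c • q) h' = c • β x q h
  β_smooth : ∀ (T : Mfd.{u}) (x : T → W) (a : T → S.Q.tot) (h : ∀ τ, S.pr (a τ) = w (x τ)),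
    Smooth x → Smooth a → Smooth (fun τ => (β (x τ) (a τ) (h τ) : S'.Q.tot))
  β_conn : ∀ (T : Mfd.{u}) (x : T → W) (a : T → S.Q.tot) (h : ∀ τ, S.pr (a τ) = w (x τ)),
    Smooth x → Smooth a →
    S'.Q.A.pullback (fun τ => (β (x τ) (a τ) (h τ) : S'.Q.tot)) = S.Q.A.pullback a
  β_Ψ : ∀ (x₁ x₂ : W) (q₁ : S.Q) (p : G₁.P) (q₂ : S.Q)
    (h₁ : S.pr q₁ = w x₁) (h₂ : S.pr q₂ = w x₂)
    (k₁ : S.ζ (S.pr q₁) = G₁.s p) (k₂ : S.ζ (S.pr q₂) = G₁.t p)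
    (k₁' : S'.ζ (S'.pr (β x₁ q₁ h₁)) = G₁.s p) (k₂' : S'.ζ (S'.pr (β x₂ q₂ h₂)) = G₁.t p),
    S'.Ψ (β x₁ q₁ h₁) p (β x₂ q₂ h₂) k₁' k₂' = S.Ψ q₁ p q₂ k₁ k₂

/-- (A representative of) a 2-isomorphism `S' ∘ S → S''`. The composite `S' ∘ S` has
`Z ×_{Y₂} Z' → Y₁ ×_M Y₃` as surjective submersion, the bundle `Q ⊗ Q'`, and the isomorphism
`P₁ ⊗ Q ⊗ Q' → Q ⊗ P₂ ⊗ Q' → Q ⊗ Q' ⊗ P₃` induced by `Ψ` and `Ψ'`; in terms of the maps to `P₂`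
and `P₃` it is `Ψ' q₁' (Ψ q₁ p q₂) q₂'`. Thus we are given a surjective submersion
`(w, w', w'') : W → (Z ×_{Y₂} Z') ×_{Y₁ ×_M Y₃} Z''` and an isomorphism over `W`,
`β : Q_(w x) ⊗ Q'_(w' x) → Q''_(w'' x)`. -/
structure CompIso (S : Iso G₁ G₂) (S' : Iso G₂ G₃) (S'' : Iso G₁ G₃) where
  W : Mfd.{u}
  w : W → S.Z
  w' : W → S'.Z
  w'' : W → S''.Z
  smooth_w : Smooth w
  smooth_w' : Smooth w'
  smooth_w'' : Smooth w''
  comm₁ : ∀ x, S.ζ (w x) = S''.ζ (w'' x)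
  comm₂ : ∀ x, S.η (w x) = S'.ζ (w' x)
  comm₃ : ∀ x, S'.η (w' x) = S''.η (w'' x)
  surj : ∀ z z' z'', S.ζ z = S''.ζ z'' → S.η z = S'.ζ z' → S'.η z' = S''.η z'' →
    ∃ x, w x = z ∧ w' x = z' ∧ w'' x = z''
  subm : ∀ x (v : TangentSpace S.Z.I (w x)) (v' : TangentSpace S'.Z.I (w' x))
    (v'' : TangentSpace S''.Z.I (w'' x)),
    (D S.ζ (w x) v : G₁.Y.E) = (D S''.ζ (w'' x) v'' : G₁.Y.E) →
    (D S.η (w x) v : G₂.Y.E) = (D S'.ζ (w' x) v' : G₂.Y.E) →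
    (D S'.η (w' x) v' : G₃.Y.E) = (D S''.η (w'' x) v'' : G₃.Y.E) →
    ∃ ν : TangentSpace W.I x, D w x ν = v ∧ D w' x ν = v' ∧ D w'' x ν = v''
  β : ∀ (x : W) (q : S.Q) (q' : S'.Q), S.pr q = w x → S'.pr q' = w' x → S''.Q
  pr_β : ∀ x q q' h h', S''.pr (β x q q' h h') = w'' x
  β_smul : ∀ (c c' : Circle) (x : W) (q : S.Q) (q' : S'.Q) h h' k k',
    β x (c • q) (c' • q') k k' = (c * c') • β x q q' h h'
  β_smooth : ∀ (T : Mfd.{u}) (x : T → W) (a : T → S.Q.tot) (a' : T → S'.Q.tot)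
    (h : ∀ τ, S.pr (a τ) = w (x τ)) (h' : ∀ τ, S'.pr (a' τ) = w' (x τ)),
    Smooth x → Smooth a → Smooth a' →
    Smooth (fun τ => (β (x τ) (a τ) (a' τ) (h τ) (h' τ) : S''.Q.tot))
  β_conn : ∀ (T : Mfd.{u}) (x : T → W) (a : T → S.Q.tot) (a' : T → S'.Q.tot)
    (h : ∀ τ, S.pr (a τ) = w (x τ)) (h' : ∀ τ, S'.pr (a' τ) = w' (x τ)),
    Smooth x → Smooth a → Smooth a' →
    S''.Q.A.pullback (fun τ => (β (x τ) (a τ) (a' τ) (h τ) (h' τ) : S''.Q.tot)) =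
      S.Q.A.pullback a + S'.Q.A.pullback a'
  β_Ψ : ∀ (x₁ x₂ : W) (q₁ : S.Q) (q₁' : S'.Q) (p : G₁.P) (q₂ : S.Q) (q₂' : S'.Q)
    (h₁ : S.pr q₁ = w x₁) (h₁' : S'.pr q₁' = w' x₁)
    (h₂ : S.pr q₂ = w x₂) (h₂' : S'.pr q₂' = w' x₂)
    (k₁ : S.ζ (S.pr q₁) = G₁.s p) (k₂ : S.ζ (S.pr q₂) = G₁.t p)
    (l₁ : S'.ζ (S'.pr q₁') = G₂.s (S.Ψ q₁ p q₂ k₁ k₂))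
    (l₂ : S'.ζ (S'.pr q₂') = G₂.t (S.Ψ q₁ p q₂ k₁ k₂))
    (m₁ : S''.ζ (S''.pr (β x₁ q₁ q₁' h₁ h₁')) = G₁.s p)
    (m₂ : S''.ζ (S''.pr (β x₂ q₂ q₂' h₂ h₂')) = G₁.t p),
    S''.Ψ (β x₁ q₁ q₁' h₁ h₁') p (β x₂ q₂ q₂' h₂ h₂') m₁ m₂ =
      S'.Ψ q₁' (S.Ψ q₁ p q₂ k₁ k₂) q₂' l₁ l₂

/-- (A representative of) a 2-isomorphism `id_G → S`. The identity isomorphism of `G` has the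
identity of `Y ×_M Y` as surjective submersion, the bundle `P`, and the isomorphism
`P_(y₁, y₂) ⊗ P_(y₂, y₂') → P_(y₁, y₂') → P_(y₁, y₁') ⊗ P_(y₁', y₂')` given by `μ` and its inverse.
Thus we are given a surjective submersion `w : W → (Y ×_M Y) ×_{Y ×_M Y} Z = Z` and an isomorphism
over `W`, `β : P_(ζ (w x), η (w x)) → Q_(w x)`. Here `S` is an isomorphism from `G` to the pullback
of `G` along the identity of `M`. -/
structure IdIso {G : BundleGerbe M} (S : Iso G (G.pullback (Diffeomorph.refl M.I M ∞))) where
  W : Mfd.{u}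
  w : W → S.Z
  w_subm : IsSurjSubmersion w
  β : ∀ (x : W) (r : G.P), G.s r = S.ζ (w x) → G.t r = S.η (w x) → S.Q
  pr_β : ∀ x r h h', S.pr (β x r h h') = w x
  β_smul : ∀ (c : Circle) (x : W) (r : G.P) h h' k k', β x (c • r) k k' = c • β x r h h'
  β_smooth : ∀ (T : Mfd.{u}) (x : T → W) (a : T → G.P.tot)
    (h : ∀ τ, G.s (a τ) = S.ζ (w (x τ))) (h' : ∀ τ, G.t (a τ) = S.η (w (x τ))),
    Smooth x → Smooth a → Smooth (fun τ => (β (x τ) (a τ) (h τ) (h' τ) : S.Q.tot))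
  β_conn : ∀ (T : Mfd.{u}) (x : T → W) (a : T → G.P.tot)
    (h : ∀ τ, G.s (a τ) = S.ζ (w (x τ))) (h' : ∀ τ, G.t (a τ) = S.η (w (x τ))),
    Smooth x → Smooth a →
    S.Q.A.pullback (fun τ => (β (x τ) (a τ) (h τ) (h' τ) : S.Q.tot)) = G.P.A.pullback a
  β_Ψ : ∀ (x₁ x₂ : W) (r₁ p r₂ : G.P)
    (h₁ : G.s r₁ = S.ζ (w x₁)) (h₁' : G.t r₁ = S.η (w x₁))
    (h₂ : G.s r₂ = S.ζ (w x₂)) (h₂' : G.t r₂ = S.η (w x₂))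
    (k₁ : S.ζ (S.pr (β x₁ r₁ h₁ h₁')) = G.s p) (k₂ : S.ζ (S.pr (β x₂ r₂ h₂ h₂')) = G.t p)
    (l : G.t r₁ = G.s (S.Ψ (β x₁ r₁ h₁ h₁') p (β x₂ r₂ h₂ h₂') k₁ k₂))
    (m : G.t p = G.s r₂),
    G.μ r₁ (S.Ψ (β x₁ r₁ h₁ h₁') p (β x₂ r₂ h₂ h₂') k₁ k₂) l = G.μ p r₂ m

end BundleGerbe.Iso

/-! ### The automorphism 2-group -/

/-- `f` is smoothly isotopic to the identity: there is a smooth family `Φ_t` of diffeomorphisms,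
given as a level-preserving diffeomorphism of `ℝ × M`, with `Φ_0 = id` and `Φ_1 = f`. -/
def Diff.IsIsotopicToId {M : Mfd.{u}} (f : Diff M) : Prop :=
  ∃ Φ : Diffeomorph (𝓘(ℝ, ℝ).prod M.I) (𝓘(ℝ, ℝ).prod M.I) (ℝ × M) (ℝ × M) ∞,
    (∀ t x, (Φ (t, x)).1 = t) ∧ (∀ x, (Φ (0, x)).2 = x) ∧ ∀ x, (Φ (1, x)).2 = f x

/-- The objects of the automorphism 2-group: a diffeomorphism `f` isotopic to the identity together
with an isomorphism `G → f^* G`. -/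
structure BundleGerbe.Aut {M : Mfd.{u}} (G : BundleGerbe M) where
  f : Diff M
  isotopic : f.IsIsotopicToId
  iso : Iso G (G.pullback f)

namespace BundleGerbe.Aut

variable {M : Mfd.{u}} {G : BundleGerbe M}

/-- Two automorphisms are isomorphic: they cover the same diffeomorphism and there is a
2-isomorphism between them. -/
inductive IsIsomorphic : Aut G → Aut G → Prop
  | mk (f : Diff M) (hf : f.IsIsotopicToId) (S S' : Iso G (G.pullback f)) (e : Iso.TwoIso S S') :
      IsIsomorphic ⟨f, hf, S⟩ ⟨f, hf, S'⟩

/-- `IsComp α' α γ`: the automorphism `γ` is (isomorphic to) the composite `α' ∘ α`, the product of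
`α'` and `α` in the 2-group. For `α = (f, S)` and `α' = (f', S')` this composite is
`G → f^* G → f^* (f'^* G) = (f' ∘ f)^* G`, given by `S` and `f^* S'`. -/
inductive IsComp : Aut G → Aut G → Aut G → Prop
  | mk (f f' : Diff M) (hf : f.IsIsotopicToId) (hf' : f'.IsIsotopicToId)
      (hff' : Diff.IsIsotopicToId (f.trans f'))
      (S : Iso G (G.pullback f)) (S' : Iso G (G.pullback f'))
      (S'' : Iso G (G.pullback (f.trans f')))
      (e : Iso.CompIso (G₃ := G.pullback (f.trans f')) S (S'.pullback f) S'') :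
      IsComp ⟨f', hf', S'⟩ ⟨f, hf, S⟩ ⟨f.trans f', hff', S''⟩

/-- `IsId ε`: the automorphism `ε` is (isomorphic to) the identity, the unit of the 2-group. -/
inductive IsId : Aut G → Prop
  | mk (h : Diff.IsIsotopicToId (Diffeomorph.refl M.I M ∞))
      (S : Iso G (G.pullback (Diffeomorph.refl M.I M ∞))) (e : Iso.IdIso S) :
      IsId ⟨Diffeomorph.refl M.I M ∞, h, S⟩

end BundleGerbe.Aut

/-- `π₀ Aut(G)`: the set of isomorphism classes of automorphisms. -/
def BundleGerbe.Pi0 {M : Mfd.{u}} (G : BundleGerbe M) : Type (u + 1) :=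
  Quot (Aut.IsIsomorphic (G := G))

/-- The isomorphism class of an automorphism. -/
def BundleGerbe.Aut.cls {M : Mfd.{u}} {G : BundleGerbe M} (α : Aut G) : G.Pi0 := Quot.mk _ α

end GerbeAction

end

open GerbeAction

/-! Everything about curvings comes from differentiating connection-preserving isomorphisms. For
$q_1, q_2 \in \mathcal Q$ and $p \in \mathcal P$ with matching base points, the derivative of the
compatibility of $\Psi$ with connections reads $dA(p) + d\Theta(q_2) = d\Theta(q_1) + \eta^*b(q_2) -
\eta^*b(q_1)$ (`d_Ψ`), because a curving $b$ of the target turns the curvature of the target bundle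
into a difference of two pullbacks of $b$. If $p$ is the unit of the gerbe, on which $A$ vanishes,
this says that $\eta^*b - F_\Theta$ depends only on $\zeta$, so it descends to $b'$
(`IsCurvature.cech`). For general $p$ it says that $b'$ is a curving (`IsCurvature.isCurving`), and
$dF_\Theta = 0$ together with $\pi\eta = f\pi\zeta$ gives $H_{b'} = f^*H_b$. The form $F_\Theta$
exists because the curvature of a circle connection is basic (`U1Conn.d_pullback_eq_of_smul`).

The action laws are the same computation applied to 2-isomorphisms, which preserve connection forms:
isomorphic automorphisms have equal curvature on a common cover, composites have the sum of the
curvatures, and the identity has curvature $t^*b - s^*b$ (the three lemmas `eq_of_relates`).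

The analytic basis is descent. A form on the source of a surjective submersion comes from the base
once its pullbacks along any two maps with equal composite agree (`exists_descent_of_pullback`). The
universal such pair lives on the fibre product, which is made into a manifold by straightening
submersions with the inverse function theorem (`exists_straightening`, `Mfd.fibProd`). Equations of
forms and smoothness of maps can therefore be tested on covers, where compatible maps to base
manifolds lift to the bundles.

For the group structure, a 2-isomorphism is replaced by its graph, a relation between points of
total spaces (`IsTwoRel`, `IsIdRel`, `IsCompRel`) that has smooth local solutions, respects
connections and is compatible with $\Psi$. Compatibility with $\Psi$ alone forces uniqueness and
equivariance of the solution, so such a relation always comes from a 2-isomorphism. Associativity,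
units and inverses become compositions of relations, checked by cancelling factors in the
multiplication of the gerbe.

Composites are built without forming the quotient $\mathcal Q \otimes \mathcal Q'$. Over $Z
\times_{Y_2} \mathcal Q'$ the bundle $\mathcal Q'$ has a tautological section, so the tensor product
is modelled by $\mathcal Q \times_{Y_2} \mathcal Q'$, with the circle acting on the first factor and
with the sum of the connection forms. Inverses use the conjugate bundle and the inverse of $\Psi$ in
its middle variable. -/

noncomputable section
namespace GerbeAction

open Set Filter Topology

/-! ### Smoothness of pulled back alternating forms -/

section Alternating

variable {E F G H : Type*} [NormedAddCommGroup E] [NormedSpace ℝ E] [NormedAddCommGroup F]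
  [NormedSpace ℝ F] [NormedAddCommGroup G] [NormedSpace ℝ G] [NormedAddCommGroup H]
  [NormedSpace ℝ H] {k : ℕ}

/-- Antisymmetrization, as a continuous left inverse of the inclusion of alternating maps into
multilinear maps. -/
def antisymm (E G : Type*) [NormedAddCommGroup E] [NormedSpace ℝ E] [NormedAddCommGroup G]
    [NormedSpace ℝ G] (k : ℕ) :
    ContinuousMultilinearMap ℝ (fun _ : Fin k => E) G →L[ℝ] E [⋀^Fin k]→L[ℝ] G :=
  LinearMap.mkContinuous
    { toFun := fun f => ((k.factorial : ℝ)⁻¹) • f.alternatization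
      map_add' := fun f g => by simp
      map_smul' := fun c f => by
        ext v
        simp only [ContinuousAlternatingMap.smul_apply,
          ContinuousMultilinearMap.alternatization_apply_apply,
          smul_apply, RingHom.id_apply]
        rw [smul_comm]
        congr 1
        rw [Finset.smul_sum]
        exact Finset.sum_congr rfl fun σ _ => smul_comm _ _ _ } 1 (by
    intro f
    refine ContinuousAlternatingMap.opNorm_le_bound _ (by positivity) fun m => ?_
    simp only [LinearMap.coe_mk, AddHom.coe_mk, ContinuousAlternatingMap.smul_apply,
      ContinuousMultilinearMap.alternatization_apply_apply, norm_smul, norm_inv]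
    have h : ‖∑ σ : Equiv.Perm (Fin k), Equiv.Perm.sign σ • f (m ∘ σ)‖
        ≤ k.factorial * (‖f‖ * ∏ i, ‖m i‖) := by
      refine (norm_sum_le _ _).trans ?_
      refine (Finset.sum_le_card_nsmul _ _ (‖f‖ * ∏ i, ‖m i‖) fun σ _ => ?_).trans ?_
      · have h1 : ‖Equiv.Perm.sign σ • f (m ∘ σ)‖ = ‖f (m ∘ σ)‖ := by
          rcases Int.units_eq_one_or (Equiv.Perm.sign σ) with h | h <;> simp [h]
        rw [h1]
        refine (f.le_opNorm _).trans_eq ?_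
        congr 1
        exact Equiv.prod_comp σ fun i => ‖m i‖
      · simp [Fintype.card_perm]
    have hk : (0 : ℝ) < k.factorial := by exact_mod_cast k.factorial_pos
    rw [Real.norm_of_nonneg hk.le, inv_mul_le_iff₀ hk]
    linarith)

/-- Each of the $k!$ signed terms of the average equals `f v` when `f` is already alternating. -/
lemma antisymm_apply_coe (f : E [⋀^Fin k]→L[ℝ] G) : antisymm E G k f.1 = f := by
  ext v
  have hk : (k.factorial : ℝ) ≠ 0 := by exact_mod_cast k.factorial_ne_zero
  change (k.factorial : ℝ)⁻¹ • f.1.alternatization v = f v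
  rw [ContinuousMultilinearMap.alternatization_apply_apply]
  have : ∀ σ : Equiv.Perm (Fin k), Equiv.Perm.sign σ • f.1 (v ∘ σ) = f v := by
    intro σ
    have := f.toAlternatingMap.map_perm v σ
    change Equiv.Perm.sign σ • f.toAlternatingMap (v ∘ σ) = f.toAlternatingMap v
    rw [this, smul_smul]
    simp
  rw [Finset.sum_congr rfl fun σ _ => this σ]
  simp [Fintype.card_perm, ← Nat.cast_smul_eq_nsmul ℝ, hk]

/-- A pulled back form depends smoothly on a parameter if the form and the linear map do. -/
lemma _root_.ContDiffAt.compContinuousLinearMap_alternating {n : ℕ∞ω} {α : H → F [⋀^Fin k]→L[ℝ] G}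
    {L : H → E →L[ℝ] F} {x : H} (hω : ContDiffAt ℝ n α x) (hL : ContDiffAt ℝ n L x) :
    ContDiffAt ℝ n (fun y => (α y).compContinuousLinearMap (L y)) x := by
  -- Pull back the underlying multilinear maps, where the operation is continuous multilinear in the
  -- linear maps, and return by `antisymm`, which changes nothing because the result is alternating.
  have h1 : ContDiffAt ℝ n (fun y => (α y).1) x :=
    (ContinuousAlternatingMap.toContinuousMultilinearMapLI (𝕜 := ℝ) (E := F) (F := G)
      (ι := Fin k)).contDiff.contDiffAt.comp x hω
  have h2 : ContDiffAt ℝ n (fun y => ContinuousMultilinearMap.compContinuousLinearMapContinuousMultilinear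
      ℝ (fun _ : Fin k => E) (fun _ => F) G (fun _ => L y)) x :=
    (ContinuousMultilinearMap.contDiff _).contDiffAt.comp x (contDiffAt_pi.2 fun _ => hL)
  have h3 := (antisymm E G k).contDiff.contDiffAt.comp x (h2.clm_apply h1)
  refine h3.congr_of_eventuallyEq (Eventually.of_forall fun y => ?_)
  exact (antisymm_apply_coe ((α y).compContinuousLinearMap (L y))).symm

lemma _root_.ContDiffAt.extDeriv {α : E → E [⋀^Fin k]→L[ℝ] G} {x : E} (h : ContDiffAt ℝ ∞ α x) :
    ContDiffAt ℝ ∞ (_root_.extDeriv α) x := by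
  refine ((ContinuousAlternatingMap.alternatizeUncurryFinCLM ℝ E G
    (n := k)).contDiff.contDiffAt.comp x (h.fderiv_right (m := ∞) (by simp))).congr_of_eventuallyEq
    (Eventually.of_forall fun y => ?_)
  rfl

end Alternating

/-! ### Derivatives and pullbacks of forms on general manifolds -/

/-- Records the model vector space `E` of the manifold `X`. -/
class ModelOf (X : Type*) (E : outParam Type*) : Prop

instance (X : Mfd.{u}) : ModelOf X X.E where

instance (E : Type*) [NormedAddCommGroup E] : ModelOf E E where

section General

variable {E F G : Type*} [NormedAddCommGroup E] [NormedSpace ℝ E] [NormedAddCommGroup F]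
  [NormedSpace ℝ F] [NormedAddCommGroup G] [NormedSpace ℝ G]
  {X Y Z : Type*} [TopologicalSpace X] [ChartedSpace E X] [TopologicalSpace Y] [ChartedSpace F Y]
  [TopologicalSpace Z] [ChartedSpace G Z] {k : ℕ}

/-- The differential of a map, as a linear map of model vector spaces. -/
def dm [ModelOf X E] [ModelOf Y F] (f : X → Y) (x : X) : E →L[ℝ] F := mfderiv 𝓘(ℝ, E) 𝓘(ℝ, F) f x

/-- Smoothness at a point. -/
abbrev SmAt [ModelOf X E] [ModelOf Y F] (f : X → Y) (x : X) : Prop := ContMDiffAt 𝓘(ℝ, E) 𝓘(ℝ, F) ∞ f x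

/-- The pullback of a form. -/
def pb [ModelOf X E] [ModelOf Y F] (f : X → Y) (α : Y → F [⋀^Fin k]→L[ℝ] ℝ) : X → E [⋀^Fin k]→L[ℝ] ℝ :=
  fun x => (α (f x)).compContinuousLinearMap (dm f x)

variable [ModelOf X E] [ModelOf Y F] [ModelOf Z G]

lemma SmAt.md {f : X → Y} {x : X} (h : SmAt f x) : MDifferentiableAt 𝓘(ℝ, E) 𝓘(ℝ, F) f x :=
  h.mdifferentiableAt (by simp)

lemma dm_comp {g : Y → Z} {f : X → Y} {x : X} (hg : SmAt g (f x)) (hf : SmAt f x) :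
    dm (fun x => g (f x)) x = (dm g (f x)).comp (dm f x) :=
  mfderiv_comp x hg.md hf.md

lemma dm_comp_apply {g : Y → Z} {f : X → Y} {x : X} (hg : SmAt g (f x)) (hf : SmAt f x) (v : E) :
    dm (fun x => g (f x)) x v = dm g (f x) (dm f x v) := by
  rw [dm_comp hg hf]; rfl

lemma dm_congr {f g : X → Y} {x : X} (h : f =ᶠ[𝓝 x] g) : dm f x = dm g x :=
  h.mfderiv_eq

lemma dm_id (x : X) : dm (fun x : X => x) x = ContinuousLinearMap.id ℝ E := mfderiv_id

lemma dm_eq_fderiv (f : E → F) (x : E) : dm f x = fderiv ℝ f x := mfderiv_eq_fderiv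

lemma dm_const (y : Y) (x : X) : dm (fun _ : X => y) x = 0 := mfderiv_const

lemma smAt_iff_contDiffAt {f : E → F} {x : E} : SmAt f x ↔ ContDiffAt ℝ ∞ f x :=
  contMDiffAt_iff_contDiffAt

/-- Being of class $C^n$ at a point spreads to a neighbourhood for finite $n$, but for $n = \infty$
the neighbourhoods may shrink; hence the passage through order one, which gives only
differentiability nearby. -/
lemma SmAt.eventually [IsManifold 𝓘(ℝ, E) ∞ X] [IsManifold 𝓘(ℝ, F) ∞ Y] {f : X → Y} {x : X}
    (h : SmAt f x) : ∀ᶠ y in 𝓝 x, MDifferentiableAt 𝓘(ℝ, E) 𝓘(ℝ, F) f y := by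
  have : IsManifold 𝓘(ℝ, E) 1 X := .of_le (n := ∞) (by simp)
  have : IsManifold 𝓘(ℝ, F) 1 Y := .of_le (n := ∞) (by simp)
  have h1 : ContMDiffAt 𝓘(ℝ, E) 𝓘(ℝ, F) 1 f x := h.of_le (by simp)
  filter_upwards [(contMDiffAt_iff_contMDiffAt_nhds (by simp)).1 h1] with y hy
    using hy.mdifferentiableAt (by simp)

/-- The hypotheses ask only for differentiability because that is what `SmAt.eventually` supplies at
neighbouring points. -/
lemma pb_comp_of_md {g : Y → Z} {f : X → Y} {x : X} (α : Z → G [⋀^Fin k]→L[ℝ] ℝ)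
    (hg : MDifferentiableAt 𝓘(ℝ, F) 𝓘(ℝ, G) g (f x))
    (hf : MDifferentiableAt 𝓘(ℝ, E) 𝓘(ℝ, F) f x) :
    pb (fun x => g (f x)) α x = pb f (pb g α) x := by
  have : dm (fun x => g (f x)) x = (dm g (f x)).comp (dm f x) := mfderiv_comp x hg hf
  simp only [pb, this]
  rfl

lemma pb_congr {f g : X → Y} {x : X} (h : f =ᶠ[𝓝 x] g) (α : Y → F [⋀^Fin k]→L[ℝ] ℝ) :
    pb f α x = pb g α x := by
  simp only [pb, dm_congr h, h.eq_of_nhds]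

end General

end GerbeAction
end

noncomputable section
namespace GerbeAction

open Set Filter Topology

/-- This is the regularity under which second derivatives are symmetric, as needed for $d \circ d =
0$ and for the naturality of $d$; over $\mathbb R$ it is just $C^2$. -/
lemma minSmoothness_two_le_infty : minSmoothness ℝ 2 ≤ (∞ : ℕ∞ω) := by
  rw [minSmoothness_of_isRCLikeNormedField]
  exact WithTop.coe_le_coe.2 le_top

/-! ### Charts -/

section Charts

variable {X : Mfd.{u}} (x₀ : X)

lemma ext_source_mem {x : X} (hx : x ∈ (extChartAt X.I x₀).source) :
    (extChartAt X.I x₀).source ∈ 𝓝 x := (isOpen_extChartAt_source x₀).mem_nhds hx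

lemma ext_target_mem {e : X.E} (he : e ∈ (extChartAt X.I x₀).target) :
    (extChartAt X.I x₀).target ∈ 𝓝 e := (isOpen_extChartAt_target x₀).mem_nhds he

lemma smAt_ext {x : X} (hx : x ∈ (extChartAt X.I x₀).source) :
    SmAt (E := X.E) (extChartAt X.I x₀ : X → X.E) x :=
  contMDiffAt_extChartAt' (by simpa using hx)

lemma smAt_ext_symm {e : X.E} (he : e ∈ (extChartAt X.I x₀).target) :
    SmAt (F := X.E) ((extChartAt X.I x₀).symm : X.E → X) e :=
  (contMDiffOn_extChartAt_symm x₀).contMDiffAt (ext_target_mem x₀ he)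

lemma dm_ext_symm_comp {e : X.E} (he : e ∈ (extChartAt X.I x₀).target) :
    (dm (extChartAt X.I x₀ : X → X.E) ((extChartAt X.I x₀).symm e)).comp
      (dm ((extChartAt X.I x₀).symm : X.E → X) e) = ContinuousLinearMap.id ℝ X.E := by
  have h1 := dm_comp (smAt_ext x₀ ((extChartAt X.I x₀).map_target he)) (smAt_ext_symm x₀ he)
  rw [← h1, ← dm_id e]
  apply dm_congr
  filter_upwards [ext_target_mem x₀ he] with y hy using (extChartAt X.I x₀).right_inv hy

lemma dm_ext_comp_symm {x : X} (hx : x ∈ (extChartAt X.I x₀).source) :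
    (dm ((extChartAt X.I x₀).symm : X.E → X) (extChartAt X.I x₀ x)).comp
      (dm (extChartAt X.I x₀ : X → X.E) x) = ContinuousLinearMap.id ℝ X.E := by
  have h1 := dm_comp (smAt_ext_symm x₀ ((extChartAt X.I x₀).map_source hx)) (smAt_ext x₀ hx)
  rw [← h1, ← dm_id x]
  apply dm_congr
  filter_upwards [ext_source_mem x₀ hx] with y hy using (extChartAt X.I x₀).left_inv hy

lemma Smooth.smAt {X Y : Mfd.{u}} {f : X → Y} (h : Smooth f) (x : X) : SmAt f x := h x

lemma Smooth.comp {X Y Z : Mfd.{u}} {g : Y → Z} {f : X → Y} (hg : Smooth g) (hf : Smooth f) :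
    Smooth (fun x => g (f x)) := ContMDiff.comp hg hf

lemma Smooth.id (X : Mfd.{u}) : Smooth (fun x : X => x) := contMDiff_id

end Charts

/-! ### Smoothness and exterior derivatives of pullbacks -/

section Pullback

variable {X Y : Mfd.{u}} {k : ℕ} {V : Type*} [NormedAddCommGroup V] [NormedSpace ℝ V]

/-- Near `e` the map `h` factors as the inverse chart after `h` in coordinates. This reduces
pullbacks from manifolds to pullbacks between vector spaces. -/
lemma pb_eventuallyEq_inChart (ϕ : DForm X k) {h : V → X} {e : V} (hh : SmAt h e) {x₀ : X}
    (hx : h e ∈ (extChartAt X.I x₀).source) :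
    pb h ϕ =ᶠ[𝓝 e] pb (fun v => extChartAt X.I x₀ (h v)) (ϕ.inChart x₀) := by
  have h1 : ∀ᶠ v in 𝓝 e, h v ∈ (extChartAt X.I x₀).source :=
    hh.continuousAt (ext_source_mem x₀ hx)
  filter_upwards [h1.eventually_nhds, hh.eventually] with v hv hmd
  have h2 : h =ᶠ[𝓝 v] fun v => (extChartAt X.I x₀).symm (extChartAt X.I x₀ (h v)) := by
    filter_upwards [hv] with w hw using ((extChartAt X.I x₀).left_inv hw).symm
  rw [pb_congr h2 ϕ]
  have hs := hv.self_of_nhds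
  exact pb_comp_of_md (f := fun v => extChartAt X.I x₀ (h v)) ϕ
    (smAt_ext_symm x₀ ((extChartAt X.I x₀).map_source hs)).md
    ((smAt_ext x₀ hs).md.comp v hmd)

lemma DForm.IsSmooth.contDiffAt_inChart {ϕ : DForm X k} (hϕ : ϕ.IsSmooth) {x₀ : X} {e : X.E}
    (he : e ∈ (extChartAt X.I x₀).target) : ContDiffAt ℝ ∞ (ϕ.inChart x₀) e :=
  (hϕ x₀).contDiffAt (ext_target_mem x₀ he)

lemma contDiffAt_pb_of {V W : Type*} [NormedAddCommGroup V] [NormedSpace ℝ V]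
    [NormedAddCommGroup W] [NormedSpace ℝ W] {α : W → W [⋀^Fin k]→L[ℝ] ℝ} {g : V → W} {e : V}
    (hα : ContDiffAt ℝ ∞ α (g e)) (hg : ContDiffAt ℝ ∞ g e) : ContDiffAt ℝ ∞ (pb g α) e := by
  have : pb g α = fun v => (α (g v)).compContinuousLinearMap (fderiv ℝ g v) := by
    ext1 v
    simp only [pb, dm_eq_fderiv]
  rw [this]
  exact (hα.comp e hg).compContinuousLinearMap_alternating (hg.fderiv_right (m := ∞) (by simp))

/-- The naturality of $d$ between vector spaces, to which the case of manifolds is reduced by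
charts. -/
lemma extDeriv_pb_of {V W : Type*} [NormedAddCommGroup V] [NormedSpace ℝ V]
    [NormedAddCommGroup W] [NormedSpace ℝ W] {α : W → W [⋀^Fin k]→L[ℝ] ℝ} {g : V → W} {e : V}
    (hα : ContDiffAt ℝ ∞ α (g e)) (hg : ContDiffAt ℝ ∞ g e) :
    extDeriv (pb g α) e = pb g (extDeriv α) e := by
  have : pb g α = fun v => (α (g v)).compContinuousLinearMap (fderiv ℝ g v) := by
    ext1 v
    simp only [pb, dm_eq_fderiv]
  rw [this, extDeriv_pullback (hα.differentiableAt (by simp)) hg minSmoothness_two_le_infty]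
  simp only [pb, dm_eq_fderiv]

lemma smAt_ext_comp {h : V → X} {e : V} (hh : SmAt h e) (x₀ : X)
    (hx : h e ∈ (extChartAt X.I x₀).source) :
    ContDiffAt ℝ ∞ (fun v => extChartAt X.I x₀ (h v)) e :=
  smAt_iff_contDiffAt.1 (ContMDiffAt.comp e (smAt_ext x₀ hx) hh)

/-- Pullbacks of smooth forms to vector spaces are smooth. -/
lemma DForm.IsSmooth.contDiffAt_pb {ϕ : DForm X k} (hϕ : ϕ.IsSmooth) {h : V → X} {e : V}
    (hh : SmAt h e) : ContDiffAt ℝ ∞ (pb h ϕ) e := by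
  have hx := mem_extChartAt_source (I := X.I) (h e)
  refine ContDiffAt.congr_of_eventuallyEq ?_ (pb_eventuallyEq_inChart ϕ hh hx)
  exact contDiffAt_pb_of (hϕ.contDiffAt_inChart ((extChartAt X.I (h e)).map_source hx))
    (smAt_ext_comp hh _ hx)

/-- The exterior derivative of the pullback of a smooth form to a vector space. -/
lemma DForm.IsSmooth.extDeriv_pb {ϕ : DForm X k} (hϕ : ϕ.IsSmooth) {h : V → X} {e : V}
    (hh : SmAt h e) : extDeriv (pb h ϕ) e = pb h ϕ.d e := by
  have hx := mem_extChartAt_source (I := X.I) (h e)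
  rw [(pb_eventuallyEq_inChart ϕ hh hx).extDeriv_eq,
    extDeriv_pb_of (g := fun v => extChartAt X.I (h e) (h v))
      (hϕ.contDiffAt_inChart ((extChartAt X.I (h e)).map_source hx)) (smAt_ext_comp hh _ hx)]
  exact pb_comp_of_md (f := h) (g := (extChartAt X.I (h e) : X → X.E))
    (extDeriv (ϕ.inChart (h e))) (smAt_ext _ hx).md hh.md

lemma DForm.isSmooth_of_contDiffAt {ϕ : DForm X k}
    (h : ∀ (x₀ : X) (e : X.E), e ∈ (extChartAt X.I x₀).target →
      ContDiffAt ℝ ∞ (pb ((extChartAt X.I x₀).symm : X.E → X) ϕ) e) : ϕ.IsSmooth :=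
  fun x₀ e he => (h x₀ e he).contDiffWithinAt

lemma DForm.IsSmooth.pullback {ϕ : DForm Y k} (hϕ : ϕ.IsSmooth) {f : X → Y} (hf : Smooth f) :
    (ϕ.pullback f).IsSmooth := by
  refine DForm.isSmooth_of_contDiffAt fun x₀ e he => ?_
  have h1 := smAt_ext_symm x₀ he
  refine (hϕ.contDiffAt_pb (h := fun e => f ((extChartAt X.I x₀).symm e))
    (ContMDiffAt.comp e (hf _) h1)).congr_of_eventuallyEq ?_
  filter_upwards [ext_target_mem x₀ he] with v hv
  exact (pb_comp_of_md ϕ (hf.smAt _).md (smAt_ext_symm x₀ hv).md).symm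

/-- Independence of the chart: `DForm.d` uses a different chart at each point, yet a single chart
computes it on its whole domain. -/
lemma DForm.inChart_d {ϕ : DForm X k} (hϕ : ϕ.IsSmooth) (x₀ : X) {e : X.E}
    (he : e ∈ (extChartAt X.I x₀).target) :
    pb ((extChartAt X.I x₀).symm : X.E → X) ϕ.d e =
      extDeriv (pb ((extChartAt X.I x₀).symm : X.E → X) ϕ) e :=
  (hϕ.extDeriv_pb (smAt_ext_symm x₀ he)).symm

lemma DForm.IsSmooth.d {ϕ : DForm X k} (hϕ : ϕ.IsSmooth) : ϕ.d.IsSmooth := by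
  refine DForm.isSmooth_of_contDiffAt fun x₀ e he => ?_
  refine (hϕ.contDiffAt_pb (smAt_ext_symm x₀ he)).extDeriv.congr_of_eventuallyEq ?_
  filter_upwards [ext_target_mem x₀ he] with v hv using DForm.inChart_d hϕ x₀ hv

/-- Naturality of the exterior derivative. -/
lemma DForm.IsSmooth.d_pullback {ϕ : DForm Y k} (hϕ : ϕ.IsSmooth) {f : X → Y} (hf : Smooth f) :
    (ϕ.pullback f).d = ϕ.d.pullback f := by
  funext x
  have hx := mem_extChartAt_source (I := X.I) x
  have he := (extChartAt X.I x).map_source hx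
  have h1 := smAt_ext_symm x he
  have h2 : pb ((extChartAt X.I x).symm : X.E → X) (ϕ.pullback f) =ᶠ[𝓝 (extChartAt X.I x x)]
      pb (fun e => f ((extChartAt X.I x).symm e)) ϕ := by
    filter_upwards [ext_target_mem x he] with v hv
    exact (pb_comp_of_md ϕ (hf.smAt _).md (smAt_ext_symm x hv).md).symm
  have hfx : SmAt (fun e => f ((extChartAt X.I x).symm e)) (extChartAt X.I x x) :=
    ContMDiffAt.comp _ (hf _) h1
  have h3 : extDeriv ((ϕ.pullback f).inChart x) (extChartAt X.I x x) =
      pb (fun e => f ((extChartAt X.I x).symm e)) ϕ.d (extChartAt X.I x x) := by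
    rw [← hϕ.extDeriv_pb hfx]
    exact h2.extDeriv_eq
  have h4 : (ϕ.pullback f).d x = pb (extChartAt X.I x : X → X.E)
      (extDeriv ((ϕ.pullback f).inChart x)) x := rfl
  rw [h4]
  have h5 : pb (extChartAt X.I x : X → X.E) (extDeriv ((ϕ.pullback f).inChart x)) x =
    pb (extChartAt X.I x : X → X.E) (pb (fun e => f ((extChartAt X.I x).symm e)) ϕ.d) x := by
    simp only [pb]
    rw [h3]
    rfl
  rw [h5, ← pb_comp_of_md (f := (extChartAt X.I x : X → X.E)) ϕ.d hfx.md (smAt_ext x hx).md]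
  refine pb_congr ?_ ϕ.d
  filter_upwards [ext_source_mem x hx] with v hv
  rw [(extChartAt X.I x).left_inv hv]

/-- By `DForm.inChart_d` the chart expression of `ϕ.d` is an exterior derivative on a neighbourhood,
not only at the centre, so the vector space identity can be applied to it. -/
lemma DForm.IsSmooth.d_d {ϕ : DForm X k} (hϕ : ϕ.IsSmooth) : ϕ.d.d = 0 := by
  funext x
  have hx := mem_extChartAt_source (I := X.I) x
  have he := (extChartAt X.I x).map_source hx
  have h2 : ϕ.d.inChart x =ᶠ[𝓝 (extChartAt X.I x x)] extDeriv (ϕ.inChart x) := by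
    filter_upwards [ext_target_mem x he] with v hv using DForm.inChart_d hϕ x hv
  change (extDeriv (ϕ.d.inChart x) (extChartAt X.I x x)).compContinuousLinearMap _ = 0
  rw [h2.extDeriv_eq, extDeriv_extDeriv_apply (hϕ.contDiffAt_inChart he) minSmoothness_two_le_infty]
  rfl

lemma DForm.pullback_add (f : X → Y) (ϕ ψ : DForm Y k) :
    (ϕ + ψ).pullback f = ϕ.pullback f + ψ.pullback f := rfl

lemma DForm.pullback_sub (f : X → Y) (ϕ ψ : DForm Y k) :
    (ϕ - ψ).pullback f = ϕ.pullback f - ψ.pullback f := rfl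

lemma DForm.pullback_comp {Z : Mfd.{u}} {g : Y → Z} {f : X → Y} (hg : Smooth g) (hf : Smooth f)
    (ϕ : DForm Z k) : (ϕ.pullback g).pullback f = ϕ.pullback (fun x => g (f x)) := by
  funext x
  exact (pb_comp_of_md ϕ (hg.smAt _).md (hf.smAt _).md).symm

lemma DForm.IsSmooth.add {ϕ ψ : DForm X k} (hϕ : ϕ.IsSmooth) (hψ : ψ.IsSmooth) :
    (ϕ + ψ).IsSmooth := fun x₀ => (hϕ x₀).add (hψ x₀)

lemma DForm.IsSmooth.neg {ϕ : DForm X k} (hϕ : ϕ.IsSmooth) : (-ϕ).IsSmooth :=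
  fun x₀ => (hϕ x₀).neg

lemma DForm.IsSmooth.sub {ϕ ψ : DForm X k} (hϕ : ϕ.IsSmooth) (hψ : ψ.IsSmooth) :
    (ϕ - ψ).IsSmooth := fun x₀ => (hϕ x₀).sub (hψ x₀)

lemma DForm.IsSmooth.d_add {ϕ ψ : DForm X k} (hϕ : ϕ.IsSmooth) (hψ : ψ.IsSmooth) :
    (ϕ + ψ).d = ϕ.d + ψ.d := by
  funext x
  have he := (extChartAt X.I x).map_source (mem_extChartAt_source (I := X.I) x)
  change (extDeriv (ϕ.inChart x + ψ.inChart x) (extChartAt X.I x x)).compContinuousLinearMap _ = _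
  rw [extDeriv_add ((hϕ.contDiffAt_inChart he).differentiableAt (by simp))
    ((hψ.contDiffAt_inChart he).differentiableAt (by simp))]
  rfl

lemma DForm.d_neg (ϕ : DForm X k) : (-ϕ).d = -ϕ.d := by
  funext x
  have : (-ϕ).inChart x = (-1 : ℝ) • ϕ.inChart x := by
    funext e
    refine Eq.trans ?_ (neg_one_smul ℝ (ϕ.inChart x e)).symm
    rfl
  change (extDeriv ((-ϕ).inChart x) (extChartAt X.I x x)).compContinuousLinearMap _ = _
  rw [this, extDeriv_smul, neg_one_smul]
  rfl

lemma DForm.IsSmooth.d_sub {ϕ ψ : DForm X k} (hϕ : ϕ.IsSmooth) (hψ : ψ.IsSmooth) :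
    (ϕ - ψ).d = ϕ.d - ψ.d := by
  rw [sub_eq_add_neg, hϕ.d_add hψ.neg, DForm.d_neg, ← sub_eq_add_neg]

end Pullback

end GerbeAction
end

noncomputable section
namespace GerbeAction

open Set Filter Topology

/-! ### Submersions -/

/-- `L` is completed by a retraction onto its kernel followed by an isomorphism of the kernel with
`K`, which exists by rank-nullity. -/
lemma exists_equiv_prod_of_surjective {E F K : Type*} [NormedAddCommGroup E] [NormedSpace ℝ E]
    [FiniteDimensional ℝ E] [NormedAddCommGroup F] [NormedSpace ℝ F] [FiniteDimensional ℝ F]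
    [NormedAddCommGroup K] [NormedSpace ℝ K] [FiniteDimensional ℝ K] (L : E →L[ℝ] F)
    (hL : Function.Surjective L)
    (hK : Module.finrank ℝ F + Module.finrank ℝ K = Module.finrank ℝ E) :
    ∃ (Φ : E ≃L[ℝ] F × K) (κ : E →L[ℝ] K), (Φ : E →L[ℝ] F × K) = L.prod κ := by
  have h1 : Module.finrank ℝ L.toLinearMap.ker = Module.finrank ℝ K := by
    have h := L.toLinearMap.finrank_range_add_finrank_ker
    rw [LinearMap.range_eq_top.2 hL, finrank_top] at h
    omega
  let e : L.toLinearMap.ker ≃ₗ[ℝ] K := LinearEquiv.ofFinrankEq _ _ h1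
  obtain ⟨r, hr⟩ := LinearMap.exists_leftInverse_of_injective L.toLinearMap.ker.subtype
    (Submodule.ker_subtype _)
  let κ : E →ₗ[ℝ] K := e.toLinearMap ∘ₗ r
  have hinj : Function.Injective (L.toLinearMap.prod κ) := by
    rw [← LinearMap.ker_eq_bot, LinearMap.ker_eq_bot']
    intro v hv
    have hv1 : L v = 0 := congrArg Prod.fst hv
    have hv2 : e (r v) = 0 := congrArg Prod.snd hv
    have hv3 : r v = ⟨v, hv1⟩ := LinearMap.congr_fun hr (⟨v, hv1⟩ : L.toLinearMap.ker)
    rw [hv3, e.map_eq_zero_iff] at hv2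
    exact congrArg Subtype.val hv2
  have hdim : Module.finrank ℝ E = Module.finrank ℝ (F × K) := by
    rw [Module.finrank_prod, hK]
  let Φ := (LinearEquiv.ofInjectiveOfFinrankEq (L.toLinearMap.prod κ) hinj hdim)
  refine ⟨Φ.toContinuousLinearEquiv, LinearMap.toContinuousLinearMap κ, ?_⟩
  ext v <;> rfl

variable {X B : Mfd.{u}}

/-- Near a point where its differential is surjective, a smooth map is a projection in suitable
coordinates. -/
theorem exists_straightening {f : X → B} (hf : Smooth f) (x₀ : X)
    (hs : Function.Surjective (dm f x₀)) (K : Type*) [NormedAddCommGroup K] [NormedSpace ℝ K]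
    [FiniteDimensional ℝ K]
    (hK : Module.finrank ℝ B.E + Module.finrank ℝ K = Module.finrank ℝ X.E) :
    ∃ ψ : OpenPartialHomeomorph X (B.E × K), x₀ ∈ ψ.source ∧
      (∀ x ∈ ψ.source, f x ∈ (extChartAt B.I (f x₀)).source ∧
        (ψ x).1 = extChartAt B.I (f x₀) (f x)) ∧
      (∀ x ∈ ψ.source, SmAt (ψ : X → B.E × K) x) ∧
      ∀ e ∈ ψ.target, SmAt (ψ.symm : B.E × K → X) e := by
  set cX := extChartAt X.I x₀ with hcX
  set cB := extChartAt B.I (f x₀) with hcB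
  have hx₀ : x₀ ∈ cX.source := mem_extChartAt_source x₀
  have hy₀ : f x₀ ∈ cB.source := mem_extChartAt_source (f x₀)
  set e₀ := cX x₀ with he₀
  have he₀t : e₀ ∈ cX.target := cX.map_source hx₀
  have hse₀ : cX.symm e₀ = x₀ := cX.left_inv hx₀
  let g : X.E → B.E := fun v => cB (f (cX.symm v))
  let U : Set X.E := cX.target ∩ {v | f (cX.symm v) ∈ cB.source}
  have hfs : ∀ v ∈ cX.target, SmAt (fun v => f (cX.symm v)) v := fun v hv =>
    ContMDiffAt.comp v (hf _) (smAt_ext_symm x₀ hv)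
  have hU : IsOpen U := by
    rw [isOpen_iff_mem_nhds]
    rintro v ⟨hv, hv'⟩
    exact inter_mem (ext_target_mem x₀ hv)
      ((hfs v hv).continuousAt ((isOpen_extChartAt_source (f x₀)).mem_nhds hv'))
  have he₀U : e₀ ∈ U := ⟨he₀t, by change f (cX.symm e₀) ∈ cB.source; rw [hse₀]; exact hy₀⟩
  have hg : ∀ v ∈ U, ContDiffAt ℝ ∞ g v := fun v hv =>
    smAt_ext_comp (hfs v hv.1) (f x₀) hv.2
  have hgsurj : Function.Surjective (fderiv ℝ g e₀) := by
    rw [← dm_eq_fderiv]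
    have h1 : dm g e₀ = (dm (cB : B → B.E) (f x₀)).comp ((dm f x₀).comp
        (dm (cX.symm : X.E → X) e₀)) := by
      have h2 := dm_comp (g := (cB : B → B.E)) (f := fun v => f (cX.symm v)) (x := e₀)
        (smAt_ext _ (by rw [hse₀]; exact hy₀)) (hfs _ he₀t)
      rw [dm_comp (hf.smAt _) (smAt_ext_symm x₀ he₀t)] at h2
      simp only [← hcX, hse₀] at h2
      exact h2
    rw [h1]
    intro w
    obtain ⟨v, hv⟩ := hs (dm (cB.symm : B.E → B) (cB (f x₀)) w)
    refine ⟨dm (cX : X → X.E) x₀ v, ?_⟩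
    have h3 := congrArg (fun T => T v) (dm_ext_comp_symm x₀ hx₀)
    have h4 := congrArg (fun T => T w) (dm_ext_symm_comp (f x₀) (cB.map_source hy₀))
    rw [← hcB, cB.left_inv hy₀] at h4
    simp only [ContinuousLinearMap.comp_apply, ContinuousLinearMap.id_apply] at h3 h4 ⊢
    rw [← he₀] at h3
    rw [h3, hv, h4]
  obtain ⟨Φ, κ, hΦ⟩ := exists_equiv_prod_of_surjective (K := K) (fderiv ℝ g e₀) hgsurj hK
  -- Adding the linear coordinate `κ` makes the derivative at `e₀` invertible while the first
  -- component remains `f` in charts.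
  let Γ : X.E → B.E × K := fun v => (g v, κ v)
  have hΓ : ∀ v ∈ U, ContDiffAt ℝ ∞ Γ v := fun v hv => (hg v hv).prodMk κ.contDiff.contDiffAt
  have hΓ' : HasFDerivAt Γ (Φ : X.E →L[ℝ] B.E × K) e₀ := by
    rw [hΦ]
    exact ((hg e₀ he₀U).differentiableAt (by simp)).hasFDerivAt.prodMk κ.hasFDerivAt
  let θ := (hΓ e₀ he₀U).toOpenPartialHomeomorph Γ hΓ' (by simp)
  -- The inverse function theorem controls the derivative at `e₀` only. Restricting to the open set
  -- where the derivative is invertible makes the inverse smooth on the whole target.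
  let U₂ : Set X.E := U ∩ (fderiv ℝ Γ) ⁻¹'
    (Set.range ((↑) : (X.E ≃L[ℝ] B.E × K) → X.E →L[ℝ] B.E × K))
  have hU₂ : IsOpen U₂ := by
    refine ContinuousOn.isOpen_inter_preimage (fun v hv => ?_) hU ContinuousLinearEquiv.isOpen
    exact ((hΓ v hv).fderiv_right (m := ∞) (by simp)).continuousAt.continuousWithinAt
  let θ₂ := θ.restrOpen U₂ hU₂
  have hθ₂ : ∀ v, θ₂ v = Γ v := fun v => rfl
  have hθ₂s : ∀ v ∈ θ₂.source, v ∈ U₂ := fun v hv => by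
    rw [OpenPartialHomeomorph.restrOpen_source] at hv
    exact hv.2
  let ψ : OpenPartialHomeomorph X (B.E × K) := (chartAt X.E x₀).trans θ₂
  have hψs : ∀ x ∈ ψ.source, x ∈ cX.source ∧ cX x ∈ θ₂.source := fun x hx => by
    rw [OpenPartialHomeomorph.trans_source] at hx
    exact ⟨by rw [hcX, extChartAt_source]; exact hx.1, hx.2⟩
  refine ⟨ψ, ?_, ?_, ?_, ?_⟩
  · rw [OpenPartialHomeomorph.trans_source]
    refine ⟨mem_chart_source _ _, ?_⟩
    change e₀ ∈ θ₂.source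
    rw [OpenPartialHomeomorph.restrOpen_source]
    refine ⟨ContDiffAt.mem_toOpenPartialHomeomorph_source (hΓ e₀ he₀U) hΓ' (by simp), he₀U, ?_⟩
    exact ⟨Φ, hΓ'.fderiv.symm⟩
  · intro x hx
    obtain ⟨h1, h2⟩ := hψs x hx
    have h3 := (hθ₂s _ h2).1.2
    change f (cX.symm (cX x)) ∈ cB.source at h3
    refine ⟨by rwa [cX.left_inv h1] at h3, ?_⟩
    change cB (f (cX.symm (cX x))) = _
    rw [cX.left_inv h1]
  · intro x hx
    obtain ⟨h1, h2⟩ := hψs x hx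
    exact ContMDiffAt.comp x (g := Γ) (f := (cX : X → X.E))
      (smAt_iff_contDiffAt.2 (hΓ _ (hθ₂s _ h2).1)) (smAt_ext x₀ h1)
  · intro e he
    have h1 : e ∈ θ₂.target ∧ θ₂.symm e ∈ (chartAt X.E x₀).target := by
      rw [OpenPartialHomeomorph.trans_target] at he
      exact ⟨he.1, he.2⟩
    have h2 : θ₂.symm e ∈ U₂ := hθ₂s _ (θ₂.map_target h1.1)
    obtain ⟨Φ', hΦ'⟩ := h2.2
    have h3 : ContDiffAt ℝ ∞ θ₂.symm e := by
      refine θ₂.contDiffAt_symm (f₀' := Φ') h1.1 ?_ (hΓ _ h2.1)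
      rw [hΦ']
      exact ((hΓ _ h2.1).differentiableAt (by simp)).hasFDerivAt
    exact ContMDiffAt.comp e (g := (cX.symm : X.E → X)) (f := θ₂.symm)
      (smAt_ext_symm x₀ h2.1.1) (smAt_iff_contDiffAt.2 h3)

/-- The truncated subtraction is a true one, since a surjective differential forces $\dim B \le \dim
X$. -/
lemma finrank_add_of_surjective {f : X → B} {x₀ : X} (hs : Function.Surjective (dm f x₀)) :
    Module.finrank ℝ B.E + Module.finrank ℝ (EuclideanSpace ℝ
      (Fin (Module.finrank ℝ X.E - Module.finrank ℝ B.E))) = Module.finrank ℝ X.E := by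
  have := (dm f x₀).toLinearMap.finrank_le_finrank_of_surjective hs
  rw [finrank_euclideanSpace_fin]
  omega

/-- Local sections of submersions. -/
theorem exists_local_section {f : X → B} (hf : Smooth f) (x₀ : X)
    (hs : Function.Surjective (dm f x₀)) :
    ∃ σ : B → X, SmAt σ (f x₀) ∧ σ (f x₀) = x₀ ∧ ∀ᶠ y in 𝓝 (f x₀), f (σ y) = y := by
  obtain ⟨ψ, h0, h1, h2, h3⟩ := exists_straightening hf x₀ hs
    (EuclideanSpace ℝ (Fin (Module.finrank ℝ X.E - Module.finrank ℝ B.E)))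
    (finrank_add_of_surjective hs)
  have hy₀ := mem_extChartAt_source (I := B.I) (f x₀)
  have hσ0 : (extChartAt B.I (f x₀) (f x₀), (ψ x₀).2) = ψ x₀ := by
    rw [← (h1 x₀ h0).2]
  have hι : SmAt (fun y : B => (extChartAt B.I (f x₀) y, (ψ x₀).2)) (f x₀) := by
    have := (smAt_ext (f x₀) hy₀).prodMk_space (contMDiffAt_const (c := (ψ x₀).2))
    exact this
  have hψ0 : ψ.symm (extChartAt B.I (f x₀) (f x₀), (ψ x₀).2) = x₀ := by
    rw [hσ0, ψ.left_inv h0]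
  -- In straightened coordinates the section keeps the fibre coordinate of `x₀` fixed.
  refine ⟨fun y => ψ.symm (extChartAt B.I (f x₀) y, (ψ x₀).2), ?_, hψ0, ?_⟩
  · refine ContMDiffAt.comp (f x₀) (g := (ψ.symm : _ → X)) (h3 _ ?_) hι
    rw [hσ0]
    exact ψ.map_source h0
  · have ht : ∀ᶠ y in 𝓝 (f x₀), (extChartAt B.I (f x₀) y, (ψ x₀).2) ∈ ψ.target := by
      refine hι.continuousAt (ψ.open_target.mem_nhds ?_)
      rw [hσ0]
      exact ψ.map_source h0
    filter_upwards [ht, ext_source_mem (f x₀) hy₀] with y hy hy'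
    have h4 := h1 _ (ψ.map_target hy)
    have h5 := h4.2
    rw [ψ.right_inv hy] at h5
    exact ((extChartAt B.I (f x₀)).injOn hy' h4.1 h5).symm

/-! ### Descent along surjective submersions -/

lemma IsSurjSubmersion.comp {Y : Mfd.{u}} {g : Y → B} {f : X → Y} (hg : IsSurjSubmersion g)
    (hf : IsSurjSubmersion f) : IsSurjSubmersion (fun x => g (f x)) where
  smooth := hg.smooth.comp hf.smooth
  surj := hg.surj.comp hf.surj
  subm x w := by
    obtain ⟨v, hv⟩ := hg.subm (f x) w
    obtain ⟨v', hv'⟩ := hf.subm x v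
    refine ⟨v', ?_⟩
    rw [← hv, ← hv']
    exact dm_comp_apply (hg.smooth.smAt _) (hf.smooth.smAt _) v'

lemma IsSurjSubmersion.id (X : Mfd.{u}) : IsSurjSubmersion (fun x : X => x) where
  smooth := Smooth.id X
  surj := Function.surjective_id
  subm x w := ⟨w, by change dm (fun x : X => x) x w = w; rw [dm_id]; rfl⟩

/-- A map is smooth if its composite with a surjective submersion is. -/
lemma IsSurjSubmersion.smooth_of_comp {Y : Mfd.{u}} {f : X → B} (hf : IsSurjSubmersion f)
    {h : B → Y} (hh : Smooth (fun x => h (f x))) : Smooth h := by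
  intro b
  obtain ⟨x, rfl⟩ := hf.surj b
  obtain ⟨σ, h1, h2, h3⟩ := exists_local_section hf.smooth x (hf.subm x)
  have h4 : SmAt (fun y => h (f (σ y))) (f x) := 
    ContMDiffAt.comp (f x) (f := σ) (g := fun x => h (f x)) (hh _) h1
  refine h4.congr_of_eventuallyEq ?_
  filter_upwards [h3] with y hy
  rw [hy]

variable {k : ℕ}

/-- Every point and every tuple of tangent vectors of `B` lifts to `X`. This is what allows
equations of forms to be checked on covers. -/
lemma IsSurjSubmersion.pullback_injective {f : X → B} (hf : IsSurjSubmersion f)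
    {ϕ ψ : DForm B k} (h : ϕ.pullback f = ψ.pullback f) : ϕ = ψ := by
  funext b
  obtain ⟨x, rfl⟩ := hf.surj b
  ext w
  choose v hv using fun i => hf.subm x (w i)
  have h1 := congrArg (fun T => T v) (congrFun h x)
  have h2 : (fun i => dm f x (v i)) = w := funext hv
  change ϕ (f x) (fun i => dm f x (v i)) = ψ (f x) (fun i => dm f x (v i)) at h1
  rwa [h2] at h1

/-- Locally `ϕ` is recovered from its pullback by pulling back again along a smooth section. -/
lemma IsSurjSubmersion.isSmooth_of_pullback {f : X → B} (hf : IsSurjSubmersion f)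
    {ϕ : DForm B k} (h : (ϕ.pullback f).IsSmooth) : ϕ.IsSmooth := by
  refine DForm.isSmooth_of_contDiffAt fun x₀ e he => ?_
  have hc := smAt_ext_symm x₀ he
  generalize ((extChartAt B.I x₀).symm : B.E → B) = c at hc
  obtain ⟨x, hx⟩ := hf.surj (c e)
  obtain ⟨σ, h1, h2, h3⟩ := exists_local_section hf.smooth x (hf.subm x)
  rw [hx] at h1 h2 h3
  have h4 : SmAt (fun v => σ (c v)) e := ContMDiffAt.comp e h1 hc
  refine (h.contDiffAt_pb h4).congr_of_eventuallyEq ?_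
  filter_upwards [(hc.continuousAt.eventually h3).eventually_nhds, h4.eventually] with v hv hmd
  have h5 : c =ᶠ[𝓝 v] fun v => f (σ (c v)) := hv.mono fun w hw => hw.symm
  rw [pb_congr h5 ϕ]
  exact pb_comp_of_md (f := fun v => σ (c v)) ϕ (hf.smooth.smAt _).md hmd

/-- Descent of forms along surjective submersions. -/
lemma IsSurjSubmersion.exists_descent {f : X → B} (hf : IsSurjSubmersion f) {ω' : DForm X k}
    (hω : ω'.IsSmooth) (h : ∀ (x x' : X) (v v' : Fin k → X.E), f x = f x' →
      (∀ i, dm f x (v i) = dm f x' (v' i)) → ω' x v = ω' x' v') :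
    ∃ ϕ : DForm B k, ϕ.IsSmooth ∧ ϕ.pullback f = ω' := by
  choose x hx using hf.surj
  have hr : ∀ b, ∃ r : B.E →L[ℝ] X.E, ∀ w, dm f (x b) (r w) = w := fun b => by
    obtain ⟨r, hr⟩ := LinearMap.exists_rightInverse_of_surjective (M := X.E) (P := B.E)
      (dm f (x b)).toLinearMap (LinearMap.range_eq_top.2 (hf.subm (x b)))
    exact ⟨LinearMap.toContinuousLinearMap r, LinearMap.congr_fun hr⟩
  choose r hr using hr
  -- The preimages and the right inverses of the differentials are chosen with no regularity; by
  -- hypothesis the value does not depend on them, and smoothness follows from that of the pullback.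
  let ϕ : DForm B k := fun b =>
    (ω' (x b)).compContinuousLinearMap (r b)
  have h1 : ϕ.pullback f = ω' := by
    funext y
    ext v
    refine h _ _ _ _ (hx (f y)) fun i => ?_
    exact hr (f y) (dm f y (v i))
  exact ⟨ϕ, hf.isSmooth_of_pullback (h1 ▸ hω), h1⟩

end GerbeAction
end

noncomputable section
namespace GerbeAction

open Set Filter Topology

/-! ### Fibre products -/

/-- A smooth map with surjective differentials. -/
structure IsSubm {X B : Mfd.{u}} (f : X → B) : Prop where
  smooth : Smooth f
  subm : ∀ x, Function.Surjective (dm f x)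

lemma IsSurjSubmersion.isSubm {X B : Mfd.{u}} {f : X → B} (h : IsSurjSubmersion f) : IsSubm f :=
  ⟨h.smooth, h.subm⟩

namespace FibProd

variable {X Y B : Mfd.{u}} {f : X → B} {g : Y → B}

/-- The points of the fibre product of `f` and `g`. -/
abbrev Carrier (f : X → B) (g : Y → B) : Type u := {z : X × Y // f z.1 = g z.2}

/-- The model of the fibres of a submersion `X → B`. -/
abbrev Fib (X B : Mfd.{u}) : Type :=
  EuclideanSpace ℝ (Fin (Module.finrank ℝ X.E - Module.finrank ℝ B.E))

/-- Coordinates on `X` near `x` in which `f` is a projection. -/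
def straight (hf : IsSubm f) (x : X) : OpenPartialHomeomorph X (B.E × Fib X B) :=
  (exists_straightening hf.smooth x (hf.subm x) (Fib X B)
    (finrank_add_of_surjective (hf.subm x))).choose

lemma straight_spec (hf : IsSubm f) (x : X) : x ∈ (straight hf x).source ∧
    (∀ x' ∈ (straight hf x).source, f x' ∈ (extChartAt B.I (f x)).source ∧
      (straight hf x x').1 = extChartAt B.I (f x) (f x')) ∧
    (∀ x' ∈ (straight hf x).source, SmAt (straight hf x : X → B.E × Fib X B) x') ∧
    ∀ e ∈ (straight hf x).target, SmAt ((straight hf x).symm : B.E × Fib X B → X) e :=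
  (exists_straightening hf.smooth x (hf.subm x) (Fib X B)
    (finrank_add_of_surjective (hf.subm x))).choose_spec

/-- The point of `Y` with given coordinates in the chart of the fibre product at `n`. -/
def right (n : Carrier f g) (e : Fib X B × Y.E) : Y := (extChartAt Y.I n.1.2).symm e.2

/-- The coordinates of the point of `X` with given coordinates in the chart of the fibre product
at `n`. -/
def coord (n : Carrier f g) (e : Fib X B × Y.E) : B.E × Fib X B :=
  (extChartAt B.I (f n.1.1) (g (right n e)), e.1)

/-- The point of `X` with given coordinates in the chart of the fibre product at `n`. -/
def left (hf : IsSubm f) (n : Carrier f g) (e : Fib X B × Y.E) : X :=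
  (straight hf n.1.1).symm (coord n e)

/-- The domain of coordinates of the chart of the fibre product at `n`. -/
def target (hf : IsSubm f) (n : Carrier f g) : Set (Fib X B × Y.E) :=
  {e | e.2 ∈ (extChartAt Y.I n.1.2).target ∧ g (right n e) ∈ (extChartAt B.I (f n.1.1)).source ∧
    coord n e ∈ (straight hf n.1.1).target}

/-- The chart of the fibre product at `n`, as a map on `X × Y`. -/
def chartFun (hf : IsSubm f) (n : Carrier f g) (z : X × Y) : Fib X B × Y.E :=
  ((straight hf n.1.1 z.1).2, extChartAt Y.I n.1.2 z.2)

lemma smAt_right (n : Carrier f g) {e : Fib X B × Y.E} (he : e.2 ∈ (extChartAt Y.I n.1.2).target) :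
    SmAt (right n) e :=
  ContMDiffAt.comp e (g := ((extChartAt Y.I n.1.2).symm : Y.E → Y)) (smAt_ext_symm _ he)
    (smAt_iff_contDiffAt.2 contDiffAt_snd)

lemma smAt_coord (hg : Smooth g) (n : Carrier f g) {e : Fib X B × Y.E}
    (he : e.2 ∈ (extChartAt Y.I n.1.2).target)
    (he' : g (right n e) ∈ (extChartAt B.I (f n.1.1)).source) : SmAt (coord n) e := by
  have h1 : SmAt (fun e => g (right n e)) e := ContMDiffAt.comp e (hg _) (smAt_right n he)
  exact smAt_iff_contDiffAt.2 ((smAt_ext_comp h1 _ he').prodMk contDiffAt_fst)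

lemma smAt_left (hf : IsSubm f) (hg : Smooth g) (n : Carrier f g) {e : Fib X B × Y.E}
    (he : e ∈ target hf n) : SmAt (left hf n) e :=
  ContMDiffAt.comp e (g := ((straight hf n.1.1).symm : _ → X))
    ((straight_spec hf n.1.1).2.2.2 _ he.2.2) (smAt_coord hg n he.1 he.2.1)

/-- In straightened coordinates the base component of a point of `X` is its image under `f`, and
`coord` sets that component to the image under `g`; the chart of `B` is injective. -/
lemma left_comm (hf : IsSubm f) (n : Carrier f g) {e : Fib X B × Y.E}
    (he : e ∈ target hf n) : f (left hf n e) = g (right n e) := by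
  have h1 := (straight_spec hf n.1.1).2.1 _ ((straight hf n.1.1).map_target he.2.2)
  have h2 := h1.2
  rw [(straight hf n.1.1).right_inv he.2.2] at h2
  exact ((extChartAt B.I (f n.1.1)).injOn he.2.1 h1.1 h2).symm

lemma isOpen_target (hf : IsSubm f) (hg : Smooth g) (n : Carrier f g) : IsOpen (target hf n) := by
  rw [isOpen_iff_mem_nhds]
  rintro e ⟨h1, h2, h3⟩
  have k1 : ∀ᶠ e' in 𝓝 e, e'.2 ∈ (extChartAt Y.I n.1.2).target :=
    continuous_snd.continuousAt.eventually (ext_target_mem n.1.2 h1)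
  have k2 : ∀ᶠ e' in 𝓝 e, g (right n e') ∈ (extChartAt B.I (f n.1.1)).source :=
    (ContMDiffAt.comp e (hg _) (smAt_right n h1)).continuousAt.eventually (ext_source_mem _ h2)
  have k3 : ∀ᶠ e' in 𝓝 e, coord n e' ∈ (straight hf n.1.1).target :=
    (smAt_coord hg n h1 h2).continuousAt.eventually
      ((straight hf n.1.1).open_target.mem_nhds h3)
  filter_upwards [k1, k2, k3] with e' a b c using ⟨a, b, c⟩

/-- The domain of the chart of the fibre product at `n`. -/
def source (hf : IsSubm f) (n : Carrier f g) : Set (X × Y) :=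
  {z | z.1 ∈ (straight hf n.1.1).source ∧ z.2 ∈ (extChartAt Y.I n.1.2).source}

lemma isOpen_source (hf : IsSubm f) (n : Carrier f g) : IsOpen (source hf n) :=
  (straight hf n.1.1).open_source.prod (isOpen_extChartAt_source _)

lemma right_chartFun (hf : IsSubm f) (n : Carrier f g) {z : X × Y} (hz : z ∈ source hf n) :
    right n (chartFun hf n z) = z.2 := (extChartAt Y.I n.1.2).left_inv hz.2

lemma coord_chartFun (hf : IsSubm f) (n z : Carrier f g) (hz : z.1 ∈ source hf n) :
    coord n (chartFun hf n z.1) = straight hf n.1.1 z.1.1 := by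
  have h1 := ((straight_spec hf n.1.1).2.1 _ hz.1).2
  rw [coord, right_chartFun hf n hz, ← z.2, ← h1]
  rfl

lemma left_chartFun (hf : IsSubm f) (n z : Carrier f g) (hz : z.1 ∈ source hf n) :
    left hf n (chartFun hf n z.1) = z.1.1 := by
  rw [left, coord_chartFun hf n z hz, (straight hf n.1.1).left_inv hz.1]

lemma chartFun_mem (hf : IsSubm f) (n z : Carrier f g) (hz : z.1 ∈ source hf n) :
    chartFun hf n z.1 ∈ target hf n := by
  refine ⟨(extChartAt Y.I n.1.2).map_source hz.2, ?_, ?_⟩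
  · rw [right_chartFun hf n hz, ← z.2]
    exact ((straight_spec hf n.1.1).2.1 _ hz.1).1
  · rw [coord_chartFun hf n z hz]
    exact (straight hf n.1.1).map_source hz.1

lemma mem_source_of_target (hf : IsSubm f) (n : Carrier f g) {e : Fib X B × Y.E}
    (he : e ∈ target hf n) : (left hf n e, right n e) ∈ source hf n :=
  ⟨(straight hf n.1.1).map_target he.2.2, (extChartAt Y.I n.1.2).map_target he.1⟩

lemma chartFun_left_right (hf : IsSubm f) (n : Carrier f g) {e : Fib X B × Y.E}
    (he : e ∈ target hf n) : chartFun hf n (left hf n e, right n e) = e := by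
  have h1 : straight hf n.1.1 (left hf n e) = coord n e := (straight hf n.1.1).right_inv he.2.2
  have h2 : extChartAt Y.I n.1.2 (right n e) = e.2 := (extChartAt Y.I n.1.2).right_inv he.1
  simp only [chartFun, h1, h2]
  rfl

lemma continuousAt_chartFun (hf : IsSubm f) (n : Carrier f g) {z : X × Y} (hz : z ∈ source hf n) :
    ContinuousAt (chartFun hf n) z := by
  have h1 : ContinuousAt (fun z : X × Y => (straight hf n.1.1 z.1).2) z :=
    continuous_snd.continuousAt.comp
      (((straight hf n.1.1).continuousAt hz.1).comp continuous_fst.continuousAt)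
  have h2 : ContinuousAt (fun z : X × Y => extChartAt Y.I n.1.2 z.2) z :=
    ((smAt_ext n.1.2 hz.2).continuousAt).comp continuous_snd.continuousAt
  exact h1.prodMk h2

open Classical in
/-- The chart of the fibre product at `n`. -/
def chart (hf : IsSubm f) (hg : Smooth g) (n : Carrier f g) :
    OpenPartialHomeomorph (Carrier f g) (Fib X B × Y.E) where
  toFun z := chartFun hf n z.1
  -- Off the target the pair need not lie in the fibre product, and `n` is a default value.
  invFun e := if h : f (left hf n e) = g (right n e) then ⟨(left hf n e, right n e), h⟩ else n
  source := {z | z.1 ∈ source hf n}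
  target := target hf n
  map_source' z hz := chartFun_mem hf n z hz
  map_target' e he := by
    rw [dif_pos (left_comm hf n he)]
    exact mem_source_of_target hf n he
  left_inv' z hz := by
    have h1 := left_chartFun hf n z hz
    have h2 := right_chartFun hf n hz
    have h3 : f (left hf n (chartFun hf n z.1)) = g (right n (chartFun hf n z.1)) := by
      rw [h1, h2, z.2]
    rw [dif_pos h3]
    exact Subtype.ext (Prod.ext h1 h2)
  right_inv' e he := by
    rw [dif_pos (left_comm hf n he)]
    exact chartFun_left_right hf n he
  open_source := (isOpen_source hf n).preimage continuous_subtype_val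
  open_target := isOpen_target hf hg n
  continuousOn_toFun z hz :=
    ((continuousAt_chartFun hf n hz).comp continuous_subtype_val.continuousAt).continuousWithinAt
  continuousOn_invFun := by
    refine Topology.IsInducing.subtypeVal.continuousOn_iff.2 ?_
    refine ContinuousOn.congr (f := fun e => (left hf n e, right n e)) (fun e he => ?_)
      fun e he => ?_
    · exact ((smAt_left hf hg n he).continuousAt.prodMk
        (smAt_right n he.1).continuousAt).continuousWithinAt
    · rw [Function.comp_apply, dif_pos (left_comm hf n he)]

lemma chart_symm_val (hf : IsSubm f) (hg : Smooth g) (n : Carrier f g) {e : Fib X B × Y.E}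
    (he : e ∈ target hf n) : ((chart hf hg n).symm e).1 = (left hf n e, right n e) := by
  classical
  change (if h : f (left hf n e) = g (right n e) then
    (⟨(left hf n e, right n e), h⟩ : Carrier f g) else n).1 = _
  rw [dif_pos (left_comm hf n he)]

lemma smAt_chartFun_comp {V : Type*} [NormedAddCommGroup V] [NormedSpace ℝ V]
    {T : Type*} [TopologicalSpace T] [ChartedSpace V T] [ModelOf T V]
    (hf : IsSubm f) (n : Carrier f g) {a : T → X} {b : T → Y} {t : T}
    (ha : SmAt a t) (hb : SmAt b t) (h : (a t, b t) ∈ source hf n) :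
    SmAt (fun t => chartFun hf n (a t, b t)) t := by
  have h1 : SmAt (fun t => straight hf n.1.1 (a t)) t :=
    ContMDiffAt.comp t ((straight_spec hf n.1.1).2.2.1 _ h.1) ha
  have h2 : SmAt (fun t => (straight hf n.1.1 (a t)).2) t :=
    ContMDiffAt.comp t (g := fun e : B.E × Fib X B => e.2)
      (smAt_iff_contDiffAt.2 contDiffAt_snd) h1
  have h3 : SmAt (fun t => extChartAt Y.I n.1.2 (b t)) t := ContMDiffAt.comp t (smAt_ext _ h.2) hb
  exact h2.prodMk_space h3

lemma mem_source_self (hf : IsSubm f) (n : Carrier f g) : n.1 ∈ source hf n :=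
  ⟨(straight_spec hf n.1.1).1, mem_extChartAt_source _⟩

/-- The charts depend on proofs about `f` and `g`, which reach instance search as `Fact`s. -/
instance instChartedSpace [hf : Fact (IsSubm f)] [hg : Fact (Smooth g)] :
    ChartedSpace (Fib X B × Y.E) (Carrier f g) where
  atlas := Set.range (chart hf.out hg.out)
  chartAt := chart hf.out hg.out
  mem_chart_source n := mem_source_self hf.out n
  chart_mem_atlas n := ⟨n, rfl⟩

/-- A transition map is `chartFun` evaluated on the pair of smooth maps `left` and `right`, hence
smooth. -/
instance instIsManifold [hf : Fact (IsSubm f)] [hg : Fact (Smooth g)] :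
    IsManifold 𝓘(ℝ, Fib X B × Y.E) ∞ (Carrier f g) := by
  refine isManifold_of_contDiffOn _ _ _ ?_
  rintro _ _ ⟨n, rfl⟩ ⟨n', rfl⟩
  rintro e ⟨he, -⟩
  have he' : e ∈ ((chart hf.out hg.out n).symm.trans (chart hf.out hg.out n')).source := he
  rw [OpenPartialHomeomorph.trans_source] at he'
  have h1 : e ∈ target hf.out n := he'.1
  have h2 : ((chart hf.out hg.out n).symm e).1 ∈ source hf.out n' := he'.2
  rw [chart_symm_val hf.out hg.out n h1] at h2
  have h3 := smAt_chartFun_comp hf.out n' (smAt_left hf.out hg.out n h1) (smAt_right n h1.1) h2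
  refine (ContDiffAt.congr_of_eventuallyEq (smAt_iff_contDiffAt.1 h3) ?_).contDiffWithinAt
  filter_upwards [(isOpen_target hf.out hg.out n).mem_nhds h1] with e' he'
  change chartFun hf.out n' ((chart hf.out hg.out n).symm e').1 = _
  rw [chart_symm_val hf.out hg.out n he']

end FibProd

/-- The fibre product of a submersion and a smooth map. -/
def Mfd.fibProd {X Y B : Mfd.{u}} (f : X → B) (g : Y → B) (hf : IsSubm f) (hg : Smooth g) :
    Mfd.{u} :=
  haveI : Fact (IsSubm f) := ⟨hf⟩
  haveI : Fact (Smooth g) := ⟨hg⟩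
  { carrier := FibProd.Carrier f g
    sc := TopologicalSpace.Subtype.secondCountableTopology {z : X × Y | f z.1 = g z.2}
    E := FibProd.Fib X B × Y.E }

/-! ### Projections, smooth maps and tangent vectors of the fibre product -/

namespace FibProd

variable {X Y B : Mfd.{u}} {f : X → B} {g : Y → B} (hf : IsSubm f) (hg : Smooth g)

/-- The point `(x, y)` of the fibre product. -/
def mk (x : X) (y : Y) (h : f x = g y) : Mfd.fibProd f g hf hg := (⟨(x, y), h⟩ : Carrier f g)

/-- The first projection of the fibre product. -/
def fst (n : Mfd.fibProd f g hf hg) : X := Subtype.val (p := fun z : X × Y => f z.1 = g z.2) n |>.1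

/-- The second projection of the fibre product. -/
def snd (n : Mfd.fibProd f g hf hg) : Y := Subtype.val (p := fun z : X × Y => f z.1 = g z.2) n |>.2

lemma comm (n : Mfd.fibProd f g hf hg) : f (fst hf hg n) = g (snd hf hg n) :=
  Subtype.property (p := fun z : X × Y => f z.1 = g z.2) n

lemma ext {n n' : Mfd.fibProd f g hf hg} (h : fst hf hg n = fst hf hg n')
    (h' : snd hf hg n = snd hf hg n') : n = n' := Subtype.ext (Prod.ext h h')

variable {n : Mfd.fibProd f g hf hg}

lemma continuous_val : Continuous fun n : Mfd.fibProd f g hf hg => (fst hf hg n, snd hf hg n) :=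
  continuous_subtype_val (p := fun z : X × Y => f z.1 = g z.2)

/-- The coordinates of the fibre product near `n`. -/
def toCoord (n z : Mfd.fibProd f g hf hg) : Fib X B × Y.E :=
  chartFun hf n (fst hf hg z, snd hf hg z)

/-- The inverse of the coordinates of the fibre product near `n`. -/
def ofCoord (n : Mfd.fibProd f g hf hg) (e : Fib X B × Y.E) : Mfd.fibProd f g hf hg :=
  (chart hf hg n).symm e

lemma toCoord_mem (n : Mfd.fibProd f g hf hg) : toCoord hf hg n n ∈ target hf n :=
  chartFun_mem hf n n (mem_source_self hf n)

lemma isOpen_ext_source (n : Mfd.fibProd f g hf hg) :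
    IsOpen {z : Mfd.fibProd f g hf hg | (fst hf hg z, snd hf hg z) ∈ source hf n} :=
  (isOpen_source hf n).preimage (continuous_val hf hg)

lemma source_mem_nhds (n : Mfd.fibProd f g hf hg) :
    {z : Mfd.fibProd f g hf hg | (fst hf hg z, snd hf hg z) ∈ source hf n} ∈ 𝓝 n :=
  (isOpen_ext_source hf hg n).mem_nhds (mem_source_self hf n)

lemma smAt_toCoord (n : Mfd.fibProd f g hf hg) : SmAt (toCoord hf hg n) n :=
  smAt_ext (X := Mfd.fibProd f g hf hg) n (mem_extChartAt_source n)

lemma smAt_ofCoord (n : Mfd.fibProd f g hf hg) :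
    SmAt (ofCoord hf hg n) (toCoord hf hg n n) :=
  smAt_ext_symm (X := Mfd.fibProd f g hf hg) n
    ((extChartAt (Mfd.fibProd f g hf hg).I n).map_source (mem_extChartAt_source n))

lemma ofCoord_toCoord (n : Mfd.fibProd f g hf hg) {z : Mfd.fibProd f g hf hg}
    (hz : (fst hf hg z, snd hf hg z) ∈ source hf n) : ofCoord hf hg n (toCoord hf hg n z) = z :=
  (chart hf hg n).left_inv hz

lemma fst_ofCoord (n : Mfd.fibProd f g hf hg) {e : Fib X B × Y.E} (he : e ∈ target hf n) :
    fst hf hg (ofCoord hf hg n e) = left hf n e :=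
  congrArg Prod.fst (chart_symm_val hf hg n he)

lemma snd_ofCoord (n : Mfd.fibProd f g hf hg) {e : Fib X B × Y.E} (he : e ∈ target hf n) :
    snd hf hg (ofCoord hf hg n e) = right n e :=
  congrArg Prod.snd (chart_symm_val hf hg n he)

lemma smooth_fst : Smooth (fst hf hg) := by
  intro n
  have h1 : SmAt (fun z => left hf n (toCoord hf hg n z)) n :=
    ContMDiffAt.comp n (f := toCoord hf hg n) (g := left hf n)
      (smAt_left hf hg n (toCoord_mem hf hg n)) (smAt_toCoord hf hg n)
  refine h1.congr_of_eventuallyEq ?_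
  filter_upwards [source_mem_nhds hf hg n] with z hz using (left_chartFun hf n z hz).symm

lemma smooth_snd : Smooth (snd hf hg) := by
  intro n
  have h1 : SmAt (fun z => right n (toCoord hf hg n z)) n :=
    ContMDiffAt.comp n (f := toCoord hf hg n) (g := right (f := f) (g := g) n)
      (smAt_right n (toCoord_mem hf hg n).1) (smAt_toCoord hf hg n)
  refine h1.congr_of_eventuallyEq ?_
  filter_upwards [source_mem_nhds hf hg n] with z hz using (right_chartFun hf n hz).symm

/-- A map to the fibre product is smooth if its components are. -/
lemma smooth_of_components {T : Mfd.{u}} {h : T → Mfd.fibProd f g hf hg}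
    (h₁ : Smooth fun t => fst hf hg (h t)) (h₂ : Smooth fun t => snd hf hg (h t)) : Smooth h := by
  intro t
  have hc : ContinuousAt h t := by
    refine (Topology.IsInducing.subtypeVal (Y := X × Y)
      (t := {z : X × Y | f z.1 = g z.2})).continuousAt_iff.2 ?_
    exact (h₁ t).continuousAt.prodMk (h₂ t).continuousAt
  have h3 : SmAt (fun s => toCoord hf hg (h t) (h s)) t :=
    smAt_chartFun_comp hf (h t) (h₁ t) (h₂ t) (mem_source_self hf (h t))
  have h4 : SmAt (fun s => ofCoord hf hg (h t) (toCoord hf hg (h t) (h s))) t :=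
    ContMDiffAt.comp t (f := fun s => toCoord hf hg (h t) (h s)) (g := ofCoord hf hg (h t))
      (smAt_ofCoord hf hg (h t)) h3
  refine h4.congr_of_eventuallyEq ?_
  filter_upwards [hc.eventually (source_mem_nhds hf hg (h t))] with s hs
  exact (ofCoord_toCoord hf hg (h t) hs).symm

lemma dm_fst_space {V W : Type*} [NormedAddCommGroup V] [NormedSpace ℝ V] [NormedAddCommGroup W]
    [NormedSpace ℝ W] (e v : V × W) : dm (fun e : V × W => e.1) e v = v.1 := by
  rw [dm_eq_fderiv, fderiv_fst]; rfl

lemma dm_snd_space {V W : Type*} [NormedAddCommGroup V] [NormedSpace ℝ V] [NormedAddCommGroup W]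
    [NormedSpace ℝ W] (e v : V × W) : dm (fun e : V × W => e.2) e v = v.2 := by
  rw [dm_eq_fderiv, fderiv_snd]; rfl

lemma smAt_fst_space {V W : Type*} [NormedAddCommGroup V] [NormedSpace ℝ V] [NormedAddCommGroup W]
    [NormedSpace ℝ W] (e : V × W) : SmAt (fun e : V × W => e.1) e :=
  smAt_iff_contDiffAt.2 contDiffAt_fst

lemma smAt_snd_space {V W : Type*} [NormedAddCommGroup V] [NormedSpace ℝ V] [NormedAddCommGroup W]
    [NormedSpace ℝ W] (e : V × W) : SmAt (fun e : V × W => e.2) e :=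
  smAt_iff_contDiffAt.2 contDiffAt_snd

/-- Tangent vectors of the fibre product are determined by their components. -/
lemma dm_injective (n : Mfd.fibProd f g hf hg) {ν ν' : (Mfd.fibProd f g hf hg).E}
    (h₁ : dm (fst hf hg) n ν = dm (fst hf hg) n ν')
    (h₂ : dm (snd hf hg) n ν = dm (snd hf hg) n ν') : ν = ν' := by
  have hc := smAt_toCoord hf hg n
  have hs := straight_spec hf (fst hf hg n)
  -- The coordinates are functions of the two components, so their differential depends only on the
  -- differentials of the projections; the differential of the coordinates is injective.
  have key : ∀ μ, dm (toCoord hf hg n) n μ =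
      ((dm (straight hf (fst hf hg n) : X → B.E × Fib X B) (fst hf hg n)
        (dm (fst hf hg) n μ)).2, dm (extChartAt Y.I (snd hf hg n) : Y → Y.E) (snd hf hg n)
        (dm (snd hf hg) n μ)) := by
    intro μ
    have a1 := (smooth_fst hf hg).smAt n
    have a2 := (smooth_snd hf hg).smAt n
    have a3 := hs.2.2.1 _ hs.1
    have a4 := smAt_ext (snd hf hg n) (mem_extChartAt_source (I := Y.I) (snd hf hg n))
    have b1 := dm_comp_apply (g := fun e : Fib X B × Y.E => e.1) (smAt_fst_space _) hc μ
    have b2 := dm_comp_apply (g := fun e : Fib X B × Y.E => e.2) (smAt_snd_space _) hc μ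
    rw [dm_fst_space] at b1
    rw [dm_snd_space] at b2
    refine Prod.ext (b1.symm.trans ?_) (b2.symm.trans ?_)
    · have c1 := dm_comp_apply (g := (straight hf (fst hf hg n) : X → B.E × Fib X B)) a3 a1 μ
      have c2 := dm_comp_apply (g := fun e : B.E × Fib X B => e.2)
        (f := fun z => straight hf (fst hf hg n) (fst hf hg z)) (smAt_snd_space _)
        (ContMDiffAt.comp n (g := (straight hf (fst hf hg n) : X → B.E × Fib X B)) a3 a1) μ
      rw [dm_snd_space, c1] at c2
      exact c2
    · exact dm_comp_apply a4 a2 μ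
  have h3 := key ν
  rw [h₁, h₂, ← key ν'] at h3
  have h5 : ∀ μ, dm (ofCoord hf hg n) (toCoord hf hg n n) (dm (toCoord hf hg n) n μ) = μ := by
    intro μ
    rw [← dm_comp_apply (smAt_ofCoord hf hg n) hc]
    have h4 : dm (fun z => ofCoord hf hg n (toCoord hf hg n z)) n =
        dm (fun z : Mfd.fibProd f g hf hg => z) n := by
      refine dm_congr ?_
      filter_upwards [source_mem_nhds hf hg n] with z hz using ofCoord_toCoord hf hg n hz
    rw [h4, dm_id]
    rfl
  rw [← h5 ν, h3, h5]

/-- Compatible tangent vectors define a tangent vector of the fibre product. -/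
lemma exists_tangent (n : Mfd.fibProd f g hf hg) (v : X.E) (w : Y.E)
    (h : dm f (fst hf hg n) v = dm g (snd hf hg n) w) :
    ∃ ν, dm (fst hf hg) n ν = v ∧ dm (snd hf hg) n ν = w := by
  set e₀ := toCoord hf hg n n with he₀
  have ht' : e₀ ∈ target hf n := toCoord_mem hf hg n
  have hcs := smAt_ofCoord hf hg n
  rw [← he₀] at hcs
  have hsn : ofCoord hf hg n e₀ = n := ofCoord_toCoord hf hg n (mem_source_self hf n)
  have hs := straight_spec hf (fst hf hg n)
  have hy := mem_extChartAt_source (I := Y.I) (snd hf hg n)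
  have hb := mem_extChartAt_source (I := B.I) (f (fst hf hg n))
  have hleft : left hf n e₀ = fst hf hg n := left_chartFun hf n n (mem_source_self hf n)
  have hright : right (f := f) (g := g) n e₀ = snd hf hg n :=
    right_chartFun hf n (mem_source_self hf n)
  have hL := smAt_left hf hg n ht'
  have hR := smAt_right (f := f) (g := g) n ht'.1
  set ψ := straight hf (fst hf hg n) with hψ
  have hψs := hs.2.2.1 _ hs.1
  -- The coordinates of the vector sought: the fibre part of `v` and the chart expression of `w`.
  let ε : Fib X B × Y.E := ((dm (ψ : X → B.E × Fib X B) (fst hf hg n) v).2,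
    dm (extChartAt Y.I (snd hf hg n) : Y → Y.E) (snd hf hg n) w)
  have hdR : dm (right (f := f) (g := g) n) e₀ ε = w := by
    have h1 := dm_comp_apply (g := ((extChartAt Y.I (snd hf hg n)).symm : Y.E → Y))
      (f := fun e : Fib X B × Y.E => e.2) (x := e₀) (smAt_ext_symm _ ht'.1) (smAt_snd_space e₀) ε
    rw [dm_snd_space] at h1
    refine h1.trans ?_
    have h2 := congrArg (fun T => T w) (dm_ext_comp_symm (snd hf hg n) hy)
    exact h2
  have hψL : dm (ψ : X → B.E × Fib X B) (fst hf hg n) (dm (left hf n) e₀ ε) =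
      dm (coord (f := f) (g := g) n) e₀ ε := by
    have h1 := dm_comp_apply (g := (ψ : X → B.E × Fib X B)) (f := left hf n) (x := e₀)
      (by rw [hleft]; exact hψs) hL ε
    rw [hleft] at h1
    have h2 : dm (fun e => ψ (left hf n e)) e₀ = dm (coord (f := f) (g := g) n) e₀ := by
      refine dm_congr ?_
      filter_upwards [(isOpen_target hf hg n).mem_nhds ht'] with e he
      exact ψ.right_inv he.2.2
    rw [← h1, h2]
  have hcoord := smAt_coord hg n ht'.1 ht'.2.1
  -- The fibre components agree by the choice of `ε`; the components along `B` agree because `df v =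
  -- dg w`.
  have h1 : dm (coord (f := f) (g := g) n) e₀ ε =
      dm (ψ : X → B.E × Fib X B) (fst hf hg n) v := by
    have b1 := dm_comp_apply (g := fun e : B.E × Fib X B => e.1) (smAt_fst_space _) hcoord ε
    have b2 := dm_comp_apply (g := fun e : B.E × Fib X B => e.2) (smAt_snd_space _) hcoord ε
    have b3 := dm_comp_apply (g := fun e : B.E × Fib X B => e.1) (smAt_fst_space _) hψs v
    rw [dm_fst_space] at b1 b3
    rw [dm_snd_space] at b2
    have hbS : SmAt (extChartAt B.I (f (fst hf hg n)) : B → B.E) (f (fst hf hg n)) :=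
      smAt_ext _ hb
    have c1 := dm_comp_apply (g := g) (f := right (f := f) (g := g) n) (x := e₀)
      (hg.smAt _) hR ε
    have c2 := dm_comp_apply (g := (extChartAt B.I (f (fst hf hg n)) : B → B.E))
      (f := fun e => g (right (f := f) (g := g) n e)) (x := e₀)
      (by rw [hright, ← comm hf hg n]; exact hbS) (ContMDiffAt.comp e₀ (hg _) hR) ε
    rw [c1, hdR, hright, ← h, ← comm hf hg n] at c2
    have c3 := dm_comp_apply (g := (extChartAt B.I (f (fst hf hg n)) : B → B.E)) (f := f)
      (x := fst hf hg n) hbS (hf.smooth.smAt _) v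
    have c4 : dm (fun x => extChartAt B.I (f (fst hf hg n)) (f x)) (fst hf hg n) =
        dm (fun x => (ψ x).1) (fst hf hg n) := by
      refine dm_congr ?_
      filter_upwards [ψ.open_source.mem_nhds hs.1] with x hx
      exact (hs.2.1 x hx).2.symm
    rw [c4] at c3
    refine Prod.ext (b1.symm.trans (c2.trans (c3.symm.trans b3))) (b2.symm.trans ?_)
    exact dm_fst_space e₀ ε
  have hdL : dm (left hf n) e₀ ε = v := by
    have h2 : SmAt (ψ.symm : B.E × Fib X B → X) (ψ (fst hf hg n)) :=
      hs.2.2.2 _ (ψ.map_source hs.1)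
    have h3 : ∀ μ, dm (ψ.symm : B.E × Fib X B → X) (ψ (fst hf hg n))
        (dm (ψ : X → B.E × Fib X B) (fst hf hg n) μ) = μ := by
      intro μ
      rw [← dm_comp_apply h2 hψs]
      have h4 : dm (fun x => ψ.symm (ψ x)) (fst hf hg n) = dm (fun x : X => x) (fst hf hg n) := by
        refine dm_congr ?_
        filter_upwards [ψ.open_source.mem_nhds hs.1] with x hx using ψ.left_inv hx
      rw [h4, dm_id]
      rfl
    rw [← h3 (dm (left hf n) e₀ ε), hψL, h1, h3]
  refine ⟨dm (ofCoord hf hg n) e₀ ε, ?_, ?_⟩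
  · have h1 := dm_comp_apply (x := e₀) ((smooth_fst hf hg).smAt _) hcs ε
    rw [hsn] at h1
    have h2 : dm (fun e => fst hf hg (ofCoord hf hg n e)) e₀ = dm (left hf n) e₀ := by
      refine dm_congr ?_
      filter_upwards [(isOpen_target hf hg n).mem_nhds ht'] with e he
      exact fst_ofCoord hf hg n he
    rw [← h1, h2, hdL]
  · have h1 := dm_comp_apply (x := e₀) ((smooth_snd hf hg).smAt _) hcs ε
    rw [hsn] at h1
    have h2 : dm (fun e => snd hf hg (ofCoord hf hg n e)) e₀ =
        dm (right (f := f) (g := g) n) e₀ := by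
      refine dm_congr ?_
      filter_upwards [(isOpen_target hf hg n).mem_nhds ht'] with e he
      exact snd_ofCoord hf hg n he
    rw [← h1, h2, hdR]

end FibProd

end GerbeAction
end

noncomputable section
namespace GerbeAction

/-! ### Covers and lifts -/

lemma dm_eq_of_comm {X Y B N : Mfd.{u}} {f : X → B} {g : Y → B} {p : N → X} {q : N → Y}
    (hf : Smooth f) (hg : Smooth g) (hp : Smooth p) (hq : Smooth q)
    (h : ∀ n, f (p n) = g (q n)) (n : N) (ν : N.E) :
    dm f (p n) (dm p n ν) = dm g (q n) (dm q n ν) := by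
  rw [← dm_comp_apply (hf.smAt _) (hp.smAt _), ← dm_comp_apply (hg.smAt _) (hq.smAt _), funext h]

namespace FibProd

variable {X Y B T : Mfd.{u}} {f : X → B} {g : Y → B}

/-- Surjective submersions are stable under base change; this produces the covers on which maps
lift. -/
lemma surjSubmersion_snd (hf : IsSurjSubmersion f) (hg : Smooth g) :
    IsSurjSubmersion (snd hf.isSubm hg) where
  smooth := smooth_snd _ _
  surj y := by
    obtain ⟨x, hx⟩ := hf.surj (g y)
    exact ⟨mk _ _ x y hx, rfl⟩
  subm n w := by
    obtain ⟨v, hv⟩ := hf.subm (fst hf.isSubm hg n) (dm g (snd hf.isSubm hg n) w)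
    obtain ⟨ν, -, hν⟩ := exists_tangent hf.isSubm hg n v w hv
    exact ⟨ν, hν⟩

variable (hf : IsSubm f) (hg : Smooth g)

/-- The map to the fibre product with given components. -/
def pair (x : T → X) (y : T → Y) (h : ∀ t, f (x t) = g (y t)) (t : T) : Mfd.fibProd f g hf hg :=
  mk hf hg (x t) (y t) (h t)

variable {x : T → X} {y : T → Y} (h : ∀ t, f (x t) = g (y t))

lemma smooth_pair (hx : Smooth x) (hy : Smooth y) : Smooth (pair hf hg x y h) :=
  smooth_of_components hf hg hx hy

lemma dm_fst_pair (hx : Smooth x) (hy : Smooth y) (t : T) (ν : T.E) :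
    dm (fst hf hg) (pair hf hg x y h t) (dm (pair hf hg x y h) t ν) = dm x t ν :=
  (dm_comp_apply ((smooth_fst hf hg).smAt _) ((smooth_pair hf hg h hx hy).smAt _) ν).symm

lemma dm_snd_pair (hx : Smooth x) (hy : Smooth y) (t : T) (ν : T.E) :
    dm (snd hf hg) (pair hf hg x y h t) (dm (pair hf hg x y h) t ν) = dm y t ν :=
  (dm_comp_apply ((smooth_snd hf hg).smAt _) ((smooth_pair hf hg h hx hy).smAt _) ν).symm

end FibProd

/-- Submersions lift maps locally. -/
lemma IsSurjSubmersion.exists_lift {N X T : Mfd.{u}} {p : N → X} (hp : IsSurjSubmersion p)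
    {x : T → X} (hx : Smooth x) :
    ∃ (T' : Mfd.{u}) (c : T' → T) (n : T' → N), IsSurjSubmersion c ∧ Smooth n ∧
      ∀ t, p (n t) = x (c t) :=
  ⟨_, _, _, FibProd.surjSubmersion_snd hp hx, FibProd.smooth_fst hp.isSubm hx,
    FibProd.comm hp.isSubm hx⟩

namespace IsSurjSubmersionOnto

variable {X Y B N T : Mfd.{u}} {f : X → B} {g : Y → B} {p : N → X} {q : N → Y}

/-- Links the pointwise predicate on `(p, q)` with a genuine surjective submersion to the fibre
product manifold, where tangent vectors are determined by their components. -/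
lemma surjSubmersion_pair (h : IsSurjSubmersionOnto f g p q) (hf : IsSubm f) (hg : Smooth g) :
    IsSurjSubmersion (FibProd.pair hf hg p q h.comm) where
  smooth := FibProd.smooth_pair hf hg _ h.smooth_left h.smooth_right
  surj z := by
    obtain ⟨n, h1, h2⟩ := h.surj _ _ (FibProd.comm hf hg z)
    exact ⟨n, FibProd.ext hf hg h1 h2⟩
  subm n ν := by
    have h1 := dm_eq_of_comm hf.smooth hg (FibProd.smooth_fst hf hg) (FibProd.smooth_snd hf hg)
      (FibProd.comm hf hg) (FibProd.pair hf hg p q h.comm n) ν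
    obtain ⟨μ, h2, h3⟩ := h.subm n _ _ h1
    refine ⟨μ, FibProd.dm_injective hf hg (FibProd.pair hf hg p q h.comm n) ?_ ?_⟩
    · exact (FibProd.dm_fst_pair hf hg h.comm h.smooth_left h.smooth_right n μ).trans h2
    · exact (FibProd.dm_snd_pair hf hg h.comm h.smooth_left h.smooth_right n μ).trans h3

lemma surjSubmersion_left (h : IsSurjSubmersionOnto f g p q)
    (hg : IsSurjSubmersion g) : IsSurjSubmersion p where
  smooth := h.smooth_left
  surj x := by
    obtain ⟨y, hy⟩ := hg.surj (f x)
    obtain ⟨n, hn, -⟩ := h.surj x y hy.symm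
    exact ⟨n, hn⟩
  subm n v := by
    obtain ⟨w, hw⟩ := hg.subm (q n) (dm f (p n) v)
    obtain ⟨ν, hν, -⟩ := h.subm n v w hw.symm
    exact ⟨ν, hν⟩

lemma surjSubmersion_right (h : IsSurjSubmersionOnto f g p q)
    (hf : IsSurjSubmersion f) : IsSurjSubmersion q where
  smooth := h.smooth_right
  surj y := by
    obtain ⟨x, hx⟩ := hf.surj (g y)
    obtain ⟨n, -, hn⟩ := h.surj x y hx
    exact ⟨n, hn⟩
  subm n w := by
    obtain ⟨v, hv⟩ := hf.subm (p n) (dm g (q n) w)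
    obtain ⟨ν, -, hν⟩ := h.subm n v w hv
    exact ⟨ν, hν⟩

/-- Used throughout to choose smooth points of a bundle over prescribed base points, after passing
to a cover. -/
lemma exists_lift (h : IsSurjSubmersionOnto f g p q) (hf : IsSubm f) (hg : Smooth g)
    {x : T → X} {y : T → Y} (hx : Smooth x) (hy : Smooth y) (hxy : ∀ t, f (x t) = g (y t)) :
    ∃ (T' : Mfd.{u}) (c : T' → T) (n : T' → N), IsSurjSubmersion c ∧ Smooth n ∧
      (∀ t, p (n t) = x (c t)) ∧ ∀ t, q (n t) = y (c t) := by
  obtain ⟨T', c, n, hc, hn, hcn⟩ := (h.surjSubmersion_pair hf hg).exists_lift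
    (FibProd.smooth_pair hf hg hxy hx hy)
  exact ⟨T', c, n, hc, hn, fun t => congrArg (FibProd.fst hf hg) (hcn t),
    fun t => congrArg (FibProd.snd hf hg) (hcn t)⟩

end IsSurjSubmersionOnto

/-! ### Forms on covers -/

/-- Descent of forms, where the two pullbacks of the form are compared on all test manifolds. -/
lemma IsSurjSubmersion.exists_descent_of_pullback {X B : Mfd.{u}} {k : ℕ} {f : X → B}
    (hf : IsSurjSubmersion f) {α : DForm X k} (hα : α.IsSmooth)
    (h : ∀ (T : Mfd.{u}) (a b : T → X), Smooth a → Smooth b → (∀ t, f (a t) = f (b t)) →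
      α.pullback a = α.pullback b) :
    ∃ ϕ : DForm B k, ϕ.IsSmooth ∧ ϕ.pullback f = α := by
  refine hf.exists_descent hα fun x x' v v' hx hv => ?_
  -- The universal test pair: the two projections of `X ×_B X`, whose tangent vectors realise every
  -- compatible pair of tangent vectors of `X`.
  have h1 := h _ (FibProd.fst hf.isSubm hf.smooth) (FibProd.snd hf.isSubm hf.smooth)
    (FibProd.smooth_fst _ _) (FibProd.smooth_snd _ _) (FibProd.comm _ _)
  let n := FibProd.mk hf.isSubm hf.smooth x x' hx
  have h2 := fun i => FibProd.exists_tangent hf.isSubm hf.smooth n (v i) (v' i) (hv i)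
  choose ν hν hν' using h2
  have h3 := congrArg (fun T => T ν) (congrFun h1 n)
  have h4 : (fun i => dm (FibProd.fst hf.isSubm hf.smooth) n (ν i)) = v := funext hν
  have h5 : (fun i => dm (FibProd.snd hf.isSubm hf.smooth) n (ν i)) = v' := funext hν'
  change α x (fun i => dm (FibProd.fst hf.isSubm hf.smooth) n (ν i)) =
    α x' (fun i => dm (FibProd.snd hf.isSubm hf.smooth) n (ν i)) at h3
  rwa [h4, h5] at h3

/-! ### Principal bundles with connection -/

lemma U1Conn.smooth_smul (P : U1Conn.{u}) {T : Mfd.{u}} {c : T → Circle} {a : T → P.tot}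
    (hc : ContMDiff T.I (𝓡 1) ∞ c) (ha : Smooth a) : Smooth (fun t => (c t • a t : P.tot)) :=
  P.smooth_act.comp (hc.prodMk ha)

lemma contMDiff_circle_inv {T : Mfd.{u}} {c : T → Circle} (hc : ContMDiff T.I (𝓡 1) ∞ c) :
    ContMDiff T.I (𝓡 1) ∞ (fun t => (c t)⁻¹) :=
  ContMDiff.inv (hc)

lemma contMDiff_circle_mul {T : Mfd.{u}} {c c' : T → Circle} (hc : ContMDiff T.I (𝓡 1) ∞ c)
    (hc' : ContMDiff T.I (𝓡 1) ∞ c') : ContMDiff T.I (𝓡 1) ∞ (fun t => c t * c' t) :=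
  ContMDiff.mul hc hc'

end GerbeAction
end

noncomputable section
namespace GerbeAction

open Set Filter Topology

/-! ### Curvature of connections -/

/-- The argument is the imaginary part of the logarithm, smooth on the slit plane, which contains 1.
It gives a smooth angle for `c` near `t`. -/
lemma smAt_arg {T : Mfd.{u}} {c : T → Circle} (hc : ContMDiff T.I (𝓡 1) ∞ c) {t : T}
    (h : c t = 1) : SmAt (fun s => Complex.arg (c s : ℂ)) t := by
  have : Fact (Module.finrank ℝ ℂ = 1 + 1) := ⟨Complex.finrank_real_complex⟩
  have h1 : ContMDiff T.I 𝓘(ℝ, ℂ) ∞ (fun s => (c s : ℂ)) :=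
    (contMDiff_coe_sphere (E := ℂ) (n := 1) (m := ∞)).comp hc
  have h2 : (c t : ℂ) ∈ Complex.slitPlane := by rw [h]; simp
  have h3 : ContDiffAt ℝ ∞ Complex.log (c t : ℂ) :=
    (Complex.contDiffAt_log h2 : ContDiffAt ℂ ∞ _ _).restrict_scalars ℝ
  have h4 : ContDiffAt ℝ ∞ (fun z : ℂ => (Complex.log z).im) (c t : ℂ) :=
    Complex.imCLM.contDiff.contDiffAt.comp _ h3
  simp only [Complex.log_im] at h4
  exact (contMDiffAt_iff_contDiffAt.2 h4).comp t (h1 t)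

/-- A one-form which is locally exact is closed. -/
lemma DForm.d_eq_zero_of_exact {T : Mfd.{u}} {α : DForm T 1} {θ : T → ℝ} {t : T} (hθ : SmAt θ t)
    (h : ∀ᶠ s in 𝓝 t, ∀ v : Fin 1 → T.E, α s v = dm θ s (v 0)) : α.d t = 0 := by
  have hx := mem_extChartAt_source (I := T.I) t
  have he := (extChartAt T.I t).map_source hx
  have hc := smAt_ext_symm t he
  have hst : (extChartAt T.I t).symm (extChartAt T.I t t) = t := (extChartAt T.I t).left_inv hx
  let g : T.E → ℝ := fun e => θ ((extChartAt T.I t).symm e)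
  have hg : ContDiffAt ℝ ∞ g (extChartAt T.I t t) := by
    refine smAt_iff_contDiffAt.1 (ContMDiffAt.comp _ ?_ hc)
    rw [hst]
    exact hθ
  have hg0 : ContDiffAt ℝ ∞
      (fun e => ContinuousAlternatingMap.constOfIsEmpty ℝ T.E (Fin 0) (g e))
      (extChartAt T.I t t) :=
    (ContinuousAlternatingMap.constOfIsEmptyLIE ℝ T.E ℝ (Fin 0)).contDiff.contDiffAt.comp _ hg
  -- View `θ` in the chart as a 0-form; near the point `α` is its exterior derivative, and $d \circ
  -- d = 0$.
  have h2 : α.inChart t =ᶠ[𝓝 (extChartAt T.I t t)]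
      extDeriv (fun e => ContinuousAlternatingMap.constOfIsEmpty ℝ T.E (Fin 0) (g e)) := by
    have k1 := hc.continuousAt.eventually (hst.symm ▸ h.and hθ.eventually)
    filter_upwards [k1, ext_target_mem t he] with e h3 h4
    rw [extDeriv_constOfIsEmpty]
    ext v
    have h5 : dm g e = (dm θ ((extChartAt T.I t).symm e)).comp
        (dm ((extChartAt T.I t).symm : T.E → T) e) :=
      mfderiv_comp e h3.2 (smAt_ext_symm t h4).md
    rw [← dm_eq_fderiv, h5]
    exact h3.1 _
  change (extDeriv (α.inChart t) (extChartAt T.I t t)).compContinuousLinearMap _ = 0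
  rw [h2.extDeriv_eq, extDeriv_extDeriv_apply hg0 minSmoothness_two_le_infty]
  rfl

namespace U1Conn

variable (P : U1Conn.{u})

/-- The velocity of a circle orbit. -/
def velocity (r : ℝ) (p : P.tot) : P.tot.E := dm (fun θ : ℝ => (Circle.exp θ • p : P.tot)) r 1

lemma contMDiff_exp_smul :
    ContMDiff (𝓘(ℝ, ℝ).prod P.tot.I) P.tot.I ∞ (fun x : ℝ × P.tot => Circle.exp x.1 • x.2) :=
  P.smooth_act.comp ((contMDiff_circleExp.comp contMDiff_fst).prodMk contMDiff_snd)

lemma smAt_exp_smul (r : ℝ) (p : P.tot) : SmAt (fun θ : ℝ => (Circle.exp θ • p : P.tot)) r :=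
  (P.smooth_act.comp (contMDiff_circleExp.prodMk contMDiff_const)).contMDiffAt

lemma smooth_const_smul (c : Circle) : Smooth (fun p : P.tot => (c • p : P.tot)) :=
  P.smooth_smul contMDiff_const (Smooth.id _)

/-- The normalization of `A` is given at angle zero; the velocity at `r` is the velocity at zero of
the orbit restarted at `Circle.exp r • p`. -/
lemma A_velocity (r : ℝ) (p : P.tot) :
    (P.A (Circle.exp r • p) : P.tot.E [⋀^Fin 1]→L[ℝ] ℝ) (fun _ => P.velocity r p) = 1 := by
  have h0 : P.velocity r p = P.velocity 0 (Circle.exp r • p) := by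
    have h1 : (fun θ : ℝ => (Circle.exp θ • p : P.tot)) =
        fun θ => Circle.exp (θ - r) • Circle.exp r • p := by
      funext θ
      rw [smul_smul, ← Circle.exp_add, sub_add_cancel]
    have h2 : SmAt (fun θ : ℝ => θ - r) r :=
      smAt_iff_contDiffAt.2 (contDiffAt_id.sub contDiffAt_const)
    have h3 := P.smAt_exp_smul (r - r) (Circle.exp r • p)
    have h4 := dm_comp_apply (g := fun θ : ℝ => (Circle.exp θ • (Circle.exp r • p) : P.tot))
      (f := fun θ : ℝ => θ - r) h3 h2 (1 : ℝ)
    have h5 : dm (fun θ : ℝ => θ - r) r (1 : ℝ) = 1 := by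
      rw [dm_eq_fderiv, fderiv_sub_const]
      simp
    rw [velocity, h1, h4, h5, sub_self]
    rfl
  have h := P.vert_A (Circle.exp r • p)
  change (P.A (Circle.exp 0 • Circle.exp r • p) : P.tot.E [⋀^Fin 1]→L[ℝ] ℝ)
    (fun _ => P.velocity 0 (Circle.exp r • p)) = 1 at h
  rwa [Circle.exp_zero, one_smul, ← h0] at h

lemma A_smul (c : Circle) (p : P.tot) (v : Fin 1 → P.tot.E) :
    (P.A (c • p) : P.tot.E [⋀^Fin 1]→L[ℝ] ℝ)
      (fun i => dm (fun p : P.tot => (c • p : P.tot)) p (v i)) = P.A p v :=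
  congrArg (fun T => T v) (congrFun (P.inv_A c) p)

/-- The pullback of the connection form along `θ ↦ exp (i θ) • a`. -/
lemma pb_exp_smul {T : Mfd.{u}} {θ : T → ℝ} {a : T → P.tot} {t : T}
    (hθ : MDifferentiableAt T.I 𝓘(ℝ, ℝ) θ t) (ha : SmAt a t) (v : Fin 1 → T.E) :
    (pb (fun s => (Circle.exp (θ s) • a s : P.tot)) P.A t) v =
      dm θ t (v 0) + (pb a P.A t) v := by
  have h1 := (P.contMDiff_exp_smul.mdifferentiable (by simp)) (θ t, a t)
  have h2 : MDifferentiableAt T.I (𝓘(ℝ, ℝ).prod P.tot.I) (fun s => (θ s, a s)) t :=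
    hθ.prodMk ha.md
  -- The Leibniz rule splits the derivative into a vertical part, on which `A` is normalized, and a
  -- translate of `da`, on which `A` is invariant.
  have h3 : ∀ ν : T.E, dm (fun s => (Circle.exp (θ s) • a s : P.tot)) t ν =
      (dm θ t ν) • P.velocity (θ t) (a t) +
        dm (fun p : P.tot => (Circle.exp (θ t) • p : P.tot)) (a t) (dm a t ν) := by
    intro ν
    have h4 := mfderiv_comp t h1 h2
    have h5 : dm (fun s => (Circle.exp (θ s) • a s : P.tot)) t ν =
        mfderiv (𝓘(ℝ, ℝ).prod P.tot.I) P.tot.I (fun x : ℝ × P.tot => Circle.exp x.1 • x.2)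
          (θ t, a t) (mfderiv T.I (𝓘(ℝ, ℝ).prod P.tot.I) (fun s => (θ s, a s)) t ν) :=
      congrArg (fun L => L ν) h4
    rw [h5, mfderiv_prod_eq_add_apply h1, mfderiv_prodMk hθ ha.md]
    have h6 : (dm θ t ν) • P.velocity (θ t) (a t) =
        dm (fun r : ℝ => (Circle.exp r • a t : P.tot)) (θ t) (dm θ t ν) := by
      rw [velocity, ← map_smul, smul_eq_mul, mul_one]
    rw [h6]
    rfl
  have hv : v = fun _ => v 0 := by
    funext i
    rw [Subsingleton.elim i 0]
  rw [hv]
  change (P.A (Circle.exp (θ t) • a t) : P.tot.E [⋀^Fin 1]→L[ℝ] ℝ)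
    (fun _ => dm (fun s => (Circle.exp (θ s) • a s : P.tot)) t (v 0)) = _
  simp only [h3]
  have h7 : ∀ (B : P.tot.E [⋀^Fin 1]→L[ℝ] ℝ) (x y : P.tot.E) (r : ℝ),
      B (fun _ => r • x + y) = r * B (fun _ => x) + B (fun _ => y) := by
    intro B x y r
    have e : ∀ z : P.tot.E, (fun _ : Fin 1 => z) = Function.update (fun _ : Fin 1 => z) 0 z := by
      intro z
      simp
    have k := B.map_update_add (fun _ => (0 : P.tot.E)) 0 (r • x) y
    have k2 := B.map_update_smul (fun _ => (0 : P.tot.E)) 0 r x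
    have e2 : ∀ z : P.tot.E, Function.update (fun _ : Fin 1 => (0 : P.tot.E)) 0 z = fun _ => z := by
      intro z
      funext i
      rw [Subsingleton.elim i 0]
      simp
    rw [k2] at k
    simpa only [e2, smul_eq_mul] using k
  refine (h7 _ _ _ _).trans (congrArg₂ (· + ·) ?_ ?_)
  · exact (congrArg (dm θ t (v 0) * ·) (P.A_velocity _ _)).trans (mul_one _)
  · exact P.A_smul (Circle.exp (θ t)) (a t) fun _ => dm a t (v 0)

/-- The curvature of a connection is basic. -/
lemma d_pullback_eq_of_smul {T : Mfd.{u}} {a b : T → P.tot} {c : T → Circle} (ha : Smooth a)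
    (hb : Smooth b) (hc : ContMDiff T.I (𝓡 1) ∞ c) (h : ∀ t, c t • a t = b t) :
    P.A.d.pullback b = P.A.d.pullback a := by
  rw [← P.smooth_A.d_pullback ha, ← P.smooth_A.d_pullback hb, ← sub_eq_zero,
    ← (P.smooth_A.pullback hb).d_sub (P.smooth_A.pullback ha)]
  funext t
  -- Dividing by the value at `t` moves the phase to 1, where the argument is smooth; the constant
  -- factor `c t` does not affect `A`. The difference of the two pullbacks of `A` is then $d\theta$
  -- near `t`.
  have hc' : ContMDiff T.I (𝓡 1) ∞ (fun s => c s * (c t)⁻¹) :=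
    contMDiff_circle_mul hc contMDiff_const
  have hθ : SmAt (fun s => Complex.arg ((c s * (c t)⁻¹ : Circle) : ℂ)) t :=
    smAt_arg hc' (mul_inv_cancel _)
  refine DForm.d_eq_zero_of_exact hθ ?_
  filter_upwards [hθ.eventually] with s hs v
  have h1 : b = fun s => Circle.exp (Complex.arg ((c s * (c t)⁻¹ : Circle) : ℂ)) • c t • a s := by
    funext s
    rw [Circle.exp_arg, smul_smul, inv_mul_cancel_right, h]
  have h2 := P.pb_exp_smul hs (((P.smooth_const_smul (c t)).comp ha).smAt s) v
  rw [← h1] at h2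
  have h3 : pb (fun s => (c t • a s : P.tot)) P.A s = pb a P.A s := by
    have h4 := pb_comp_of_md P.A ((P.smooth_const_smul (c t)).smAt (a s)).md (ha.smAt s).md
    refine h4.trans ?_
    have h5 : pb (fun p : P.tot => (c t • p : P.tot)) P.A = P.A := P.inv_A (c t)
    rw [h5]
  rw [h3] at h2
  change pb b P.A s v - pb a P.A s v = _
  rw [h2, add_sub_cancel_right]

end U1Conn

end GerbeAction
end

noncomputable section
namespace GerbeAction

/-! ### The algebra of bundle gerbes and their isomorphisms -/

lemma IsPrincipal.smul_cancel {P : U1Conn.{u}} {r : P → P → Prop} (h : IsPrincipal P r)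
    {c c' : Circle} {p : P} (hc : c • p = c' • p) : c = c' := by
  have h1 : (c'⁻¹ * c) • p = p := by rw [mul_smul, hc, ← mul_smul, inv_mul_cancel, one_smul]
  have h2 := h.free _ _ h1
  rwa [inv_mul_eq_one, eq_comm] at h2

namespace BundleGerbe

variable {M : Mfd.{u}} (G : BundleGerbe M)

lemma s_smul (c : Circle) (p : G.P) : G.s (c • p) = G.s p :=
  (((G.principal.orbit p (c • p)).2 ⟨c, rfl⟩).1).symm

lemma t_smul (c : Circle) (p : G.P) : G.t (c • p) = G.t p :=
  (((G.principal.orbit p (c • p)).2 ⟨c, rfl⟩).2).symm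

lemma exists_smul {p p' : G.P} (hs : G.s p = G.s p') (ht : G.t p = G.t p') :
    ∃ c : Circle, c • p = p' := (G.principal.orbit p p').1 ⟨hs, ht⟩

lemma exists_fiber {y y' : G.Y} (h : G.π y = G.π y') : ∃ p : G.P, G.s p = y ∧ G.t p = y' :=
  G.proj.surj y y' h

lemma π_s (p : G.P) : G.π (G.s p) = G.π (G.t p) := G.proj.comm p

lemma smooth_s : Smooth (X := G.P.tot) G.s := G.proj.smooth_left

lemma smooth_t : Smooth (X := G.P.tot) G.t := G.proj.smooth_right

lemma s_subm : IsSurjSubmersion (X := G.P.tot) G.s := G.proj.surjSubmersion_left G.π_subm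

lemma μ_smul_left (c : Circle) (p p' : G.P) (h : G.t p = G.s p') (h' : G.t (c • p) = G.s p') :
    G.μ (c • p) p' h' = c • G.μ p p' h := by
  simpa using G.μ_smul c 1 p p' h (by simpa using h')

lemma μ_smul_right (c : Circle) (p p' : G.P) (h : G.t p = G.s p') (h' : G.t p = G.s (c • p')) :
    G.μ p (c • p') h' = c • G.μ p p' h := by
  simpa using G.μ_smul 1 c p p' h (by simpa using h')

/-- The two elements have the same end points, so they differ by a phase, which the equivariance of
`μ` and the freeness of the action force to be 1. -/
lemma μ_left_cancel {p x x' : G.P} {h : G.t p = G.s x} {h' : G.t p = G.s x'}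
    (e : G.μ p x h = G.μ p x' h') : x = x' := by
  have ht := congrArg G.t e
  rw [G.t_μ, G.t_μ] at ht
  obtain ⟨c, rfl⟩ := G.exists_smul (h.symm.trans h') ht
  rw [G.μ_smul_right c p x h, ← one_smul Circle (G.μ p x h), smul_smul, mul_one] at e
  rw [← G.principal.smul_cancel e, one_smul]

lemma μ_right_cancel {p x x' : G.P} {h : G.t x = G.s p} {h' : G.t x' = G.s p}
    (e : G.μ x p h = G.μ x' p h') : x = x' := by
  have hs := congrArg G.s e
  rw [G.s_μ, G.s_μ] at hs
  obtain ⟨c, rfl⟩ := G.exists_smul hs (h.trans h'.symm)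
  rw [G.μ_smul_left c x p h, ← one_smul Circle (G.μ x p h), smul_smul, mul_one] at e
  rw [← G.principal.smul_cancel e, one_smul]

/-- For any `p` over `(y, y)` the product `μ p p` is `c • p` for some phase `c`, and `c⁻¹ • p` is
then idempotent. -/
lemma exists_unit (y : G.Y) :
    ∃ e : G.P, G.s e = y ∧ G.t e = y ∧ ∀ h, G.μ e e h = e := by
  obtain ⟨p, hs, ht⟩ := G.exists_fiber (rfl : G.π y = G.π y)
  have h : G.t p = G.s p := ht.trans hs.symm
  obtain ⟨c, hc⟩ := G.exists_smul (p := p) (p' := G.μ p p h) (by rw [G.s_μ]) (by rw [G.t_μ])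
  refine ⟨c⁻¹ • p, by rw [s_smul, hs], by rw [t_smul, ht], fun h' => ?_⟩
  rw [G.μ_smul _ _ _ _ h, ← hc, smul_smul, inv_mul_cancel_right]

/-- The unit of `P_(y, y)`. -/
def unit (y : G.Y) : G.P := (G.exists_unit y).choose

@[simp] lemma s_unit (y : G.Y) : G.s (G.unit y) = y := (G.exists_unit y).choose_spec.1

@[simp] lemma t_unit (y : G.Y) : G.t (G.unit y) = y := (G.exists_unit y).choose_spec.2.1

lemma unit_μ_unit (y : G.Y) (h) : G.μ (G.unit y) (G.unit y) h = G.unit y :=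
  (G.exists_unit y).choose_spec.2.2 h

/-- Multiply once more by the idempotent unit, reassociate and cancel. -/
lemma unit_μ (y : G.Y) (p : G.P) (h : G.t (G.unit y) = G.s p) : G.μ (G.unit y) p h = p := by
  have h1 : G.t (G.unit y) = G.s (G.unit y) := by simp
  have h2 := G.μ_assoc (G.unit y) (G.unit y) p h1 h
  simp only [G.unit_μ_unit] at h2
  exact (G.μ_left_cancel h2).symm

lemma μ_unit (y : G.Y) (p : G.P) (h : G.t p = G.s (G.unit y)) : G.μ p (G.unit y) h = p := by
  have h1 : G.t (G.unit y) = G.s (G.unit y) := by simp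
  have h2 := G.μ_assoc p (G.unit y) (G.unit y) h h1
  simp only [G.unit_μ_unit] at h2
  exact G.μ_right_cancel h2

/-- Cancel `p` from $p \cdot p = p = p \cdot 1$; units are recognised by idempotence. -/
lemma eq_unit {y : G.Y} {p : G.P} (hs : G.s p = y) (h : G.t p = G.s p) (e : G.μ p p h = p) :
    p = G.unit y := by
  have h1 : G.t p = G.s (G.unit y) := by rw [s_unit, h, hs]
  exact G.μ_left_cancel (e.trans (G.μ_unit y p h1).symm)

lemma exists_ldiv {p r : G.P} (h : G.s p = G.s r) :
    ∃ x : G.P, ∃ h : G.t p = G.s x, G.μ p x h = r := by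
  obtain ⟨x, hx, hx'⟩ := G.exists_fiber (y := G.t p) (y' := G.t r)
    (by rw [← G.π_s, ← G.π_s, h])
  obtain ⟨c, hc⟩ := G.exists_smul (p := G.μ p x hx.symm) (p' := r) (by rw [G.s_μ, h])
    (by rw [G.t_μ, hx'])
  exact ⟨c • x, by rw [s_smul, hx], by rw [G.μ_smul_right c p x hx.symm, hc]⟩

section Lift

variable {G} {T : Mfd.{u}}

lemma exists_lift {y y' : T → G.Y} (hy : Smooth y) (hy' : Smooth y')
    (h : ∀ τ, G.π (y τ) = G.π (y' τ)) :
    ∃ (T' : Mfd.{u}) (c : T' → T) (p : T' → G.P.tot), IsSurjSubmersion c ∧ Smooth p ∧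
      (∀ τ, G.s (p τ) = y (c τ)) ∧ ∀ τ, G.t (p τ) = y' (c τ) :=
  G.proj.exists_lift G.π_subm.isSubm G.π_subm.smooth hy hy' h

end Lift

/-- A map to a `U(1)`-bundle is smooth if it is so on a cover up to a smooth function to
`U(1)`. -/
lemma _root_.GerbeAction.U1Conn.smooth_of_cover (P : U1Conn.{u}) {T T' : Mfd.{u}} {x : T → P.tot}
    {c : T' → T} {q : T' → P.tot} {k : T' → Circle} (hc : IsSurjSubmersion c) (hq : Smooth q)
    (hk : ContMDiff T'.I (𝓡 1) ∞ k) (h : ∀ τ, k τ • q τ = x (c τ)) : Smooth x :=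
  hc.smooth_of_comp ((funext h : (fun τ => (k τ • q τ : P.tot)) = fun τ => x (c τ)) ▸
    P.smooth_smul hk hq)

/-- Division in a bundle gerbe is smooth. -/
lemma smooth_of_μ {T : Mfd.{u}} {a x b : T → G.P.tot} (ha : Smooth a) (hb : Smooth b)
    (h : ∀ τ, G.t (a τ) = G.s (x τ)) (e : ∀ τ, G.μ (a τ) (x τ) (h τ) = b τ) : Smooth x := by
  have h1 : ∀ τ, G.t (b τ) = G.t (x τ) := fun τ => by rw [← e, G.t_μ]
  -- Only the end points of `x` are known to vary smoothly. They lift to a smooth `q` on a cover,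
  -- and the phase from `q` to `x` is also the phase from `μ a q` to `b`, hence smooth.
  obtain ⟨T', c, q, hc, hq, hs, ht⟩ := exists_lift (G := G) (G.smooth_t.comp ha)
    (G.smooth_t.comp hb) (fun τ => by
      rw [h1, h, G.π_s])
  have h2 : ∀ τ, ∃ k : Circle, k • (q τ : G.P) = x (c τ) := fun τ =>
    G.exists_smul ((hs τ).trans (h _)) ((ht τ).trans (h1 _))
  choose k hk using h2
  refine G.P.smooth_of_cover hc hq ?_ hk
  refine G.principal.smooth_div T' (fun τ => G.μ (a (c τ)) (q τ) (hs τ).symm) (fun τ => b (c τ)) k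
    (G.μ_smooth _ _ _ _ (ha.comp hc.smooth) hq) (hb.comp hc.smooth) fun τ => ?_
  rw [← e, ← G.μ_smul_right _ _ _ _ ((h _).trans (congrArg G.s (hk τ).symm))]
  simp only [hk]

/-- The unit solves `μ q x = q` for a local smooth `q`, and division is smooth. -/
lemma smooth_unit : Smooth (Y := G.P.tot) G.unit := by
  obtain ⟨T', c, q, hc, hq, hs, ht⟩ := exists_lift (G := G) (Smooth.id _) (Smooth.id _)
    (fun _ => rfl)
  have h : ∀ τ, G.t (q τ) = G.s (G.unit (c τ)) := fun τ => by rw [ht, s_unit]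
  refine hc.smooth_of_comp ?_
  exact G.smooth_of_μ hq hq h fun τ => G.μ_unit _ _ _

/-- The multiplication adds connection forms, so by idempotence the pullback equals twice itself. -/
lemma A_unit : G.P.A.pullback (X := G.Y) G.unit = 0 := by
  have h := G.μ_conn G.Y G.unit G.unit (fun y => by simp) G.smooth_unit G.smooth_unit
  simp only [unit_μ_unit] at h
  exact left_eq_add.1 h

/-! ### Isomorphisms: units, cancellation and smooth solutions of equations in Ψ -/

namespace Iso

variable {G} {G₁ G₂ : BundleGerbe M} (S : Iso G₁ G₂)

lemma pr_smul (c : Circle) (q : S.Q) : S.pr (c • q) = S.pr q :=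
  ((S.principal.orbit q (c • q)).2 ⟨c, rfl⟩).symm

lemma exists_smul {q q' : S.Q} (h : S.pr q = S.pr q') : ∃ c : Circle, c • q = q' :=
  (S.principal.orbit q q').1 h

lemma ζ_subm : IsSurjSubmersion S.ζ := S.ξ_subm.surjSubmersion_left G₂.π_subm

lemma η_subm : IsSurjSubmersion S.η := S.ξ_subm.surjSubmersion_right G₁.π_subm

lemma smooth_pr : Smooth (X := S.Q.tot) S.pr := S.pr_subm.smooth

lemma π_η (z : S.Z) : G₁.π (S.ζ z) = G₂.π (S.η z) := S.ξ_subm.comm z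

lemma Ψ_smul_mid (c : Circle) (q₁ : S.Q) (p : G₁.P) (q₂ : S.Q) (h h' k k') :
    S.Ψ q₁ (c • p) q₂ k k' = c • S.Ψ q₁ p q₂ h h' := by
  simpa using S.Ψ_smul 1 c 1 q₁ p q₂ h h' (by simpa using k) (by simpa using k')

lemma Ψ_smul_right (c : Circle) (q₁ : S.Q) (p : G₁.P) (q₂ : S.Q) (h h' k') :
    S.Ψ q₁ p (c • q₂) h k' = c • S.Ψ q₁ p q₂ h h' := by
  simpa using S.Ψ_smul 1 1 c q₁ p q₂ h h' (by simpa using h) (by simpa using k')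

/-- Compatibility with the multiplications makes the left side idempotent. -/
lemma Ψ_unit (q : S.Q) (y : G₁.Y) (h h') : S.Ψ q (G₁.unit y) q h h' = G₂.unit (S.η (S.pr q)) := by
  have h1 := S.Ψ_μ q (G₁.unit y) q (G₁.unit y) q h h' h h'
  simp only [unit_μ_unit] at h1
  exact G₂.eq_unit (S.s_Ψ _ _ _ _ _) ((S.t_Ψ _ _ _ _ _).trans (S.s_Ψ _ _ _ _ _).symm) h1.symm

/-- Over a fixed point of `Z`, applying `Ψ` to the unit measures the phase between `q` and `q'`. -/
lemma eq_of_Ψ_unit {q q' : S.Q} (hq : S.pr q = S.pr q') {y : G₁.Y} {y₂ : G₂.Y} {h h'}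
    (e : S.Ψ q (G₁.unit y) q' h h' = G₂.unit y₂) : q = q' := by
  obtain ⟨c, rfl⟩ := S.exists_smul hq
  have hs := congrArg G₂.s e
  rw [S.s_Ψ, s_unit] at hs
  subst hs
  have h1 : S.ζ (S.pr q) = G₁.t (G₁.unit y) := by rwa [S.pr_smul] at h'
  rw [S.Ψ_smul_right c q _ q h h1, S.Ψ_unit, ← one_smul Circle (G₂.unit _), smul_smul,
    mul_one] at e
  rw [G₂.principal.smul_cancel e, one_smul]

lemma Ψ_mid_cancel {q₁ q₂ : S.Q} {p p' : G₁.P} {h h' k k'}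
    (e : S.Ψ q₁ p q₂ h h' = S.Ψ q₁ p' q₂ k k') : p = p' := by
  obtain ⟨c, rfl⟩ := G₁.exists_smul (h.symm.trans k) (h'.symm.trans k')
  rw [S.Ψ_smul_mid c q₁ p q₂ h h', ← one_smul Circle (S.Ψ q₁ p q₂ h h'), smul_smul, mul_one] at e
  rw [← G₂.principal.smul_cancel e, one_smul]

lemma Ψ_right_cancel {q₁ q₂ q₂' : S.Q} {p : G₁.P} {h h' k'} (hq : S.pr q₂ = S.pr q₂')
    (e : S.Ψ q₁ p q₂ h h' = S.Ψ q₁ p q₂' h k') : q₂ = q₂' := by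
  obtain ⟨c, rfl⟩ := S.exists_smul hq
  rw [S.Ψ_smul_right c q₁ p q₂ h h'] at e
  have h1 : (1 : Circle) • S.Ψ q₁ p q₂ h h' = c • S.Ψ q₁ p q₂ h h' := by rwa [one_smul]
  rw [← G₂.principal.smul_cancel h1, one_smul]

lemma exists_fiber {y₁ : G₁.Y} {y₂ : G₂.Y} (h : G₁.π y₁ = G₂.π y₂) :
    ∃ q : S.Q, S.ζ (S.pr q) = y₁ ∧ S.η (S.pr q) = y₂ := by
  obtain ⟨z, rfl, rfl⟩ := S.ξ_subm.surj _ _ h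
  obtain ⟨q, rfl⟩ := S.pr_subm.surj z
  exact ⟨q, rfl, rfl⟩

/-- `Ψ` is an isomorphism in its middle variable. -/
lemma exists_Ψ {q₁ q₂ : S.Q} {p₂ : G₂.P} (h : S.η (S.pr q₁) = G₂.s p₂)
    (h' : S.η (S.pr q₂) = G₂.t p₂) : ∃ p k k', S.Ψ q₁ p q₂ k k' = p₂ := by
  obtain ⟨p, hs, ht⟩ := G₁.exists_fiber (y := S.ζ (S.pr q₁)) (y' := S.ζ (S.pr q₂))
    (by rw [S.π_η, S.π_η, h, h', G₂.π_s])
  obtain ⟨c, hc⟩ := G₂.exists_smul (p := S.Ψ q₁ p q₂ hs.symm ht.symm) (p' := p₂)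
    (by rw [S.s_Ψ, h]) (by rw [S.t_Ψ, h'])
  refine ⟨c • p, by rw [G₁.s_smul, hs], by rw [G₁.t_smul, ht], ?_⟩
  rw [S.Ψ_smul_mid c q₁ p q₂ hs.symm ht.symm, hc]

/-- `Ψ` is an isomorphism in its right variable. -/
lemma exists_Ψ_right {q₁ q : S.Q} {p : G₁.P} {p₂ : G₂.P} (h : S.ζ (S.pr q₁) = G₁.s p)
    (h' : S.ζ (S.pr q) = G₁.t p) (k : S.η (S.pr q₁) = G₂.s p₂) (k' : S.η (S.pr q) = G₂.t p₂) :
    ∃ q₂, S.pr q₂ = S.pr q ∧ ∃ l, S.Ψ q₁ p q₂ h l = p₂ := by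
  obtain ⟨c, hc⟩ := G₂.exists_smul (p := S.Ψ q₁ p q h h') (p' := p₂)
    (by rw [S.s_Ψ, k]) (by rw [S.t_Ψ, k'])
  exact ⟨c • q, S.pr_smul _ _, by rw [S.pr_smul, h'], by rw [S.Ψ_smul_right c q₁ p q h h', hc]⟩

section Lift

variable {T : Mfd.{u}}

lemma exists_lift_pr {z : T → S.Z} (hz : Smooth z) :
    ∃ (T' : Mfd.{u}) (c : T' → T) (q : T' → S.Q.tot), IsSurjSubmersion c ∧ Smooth q ∧
      ∀ τ, S.pr (q τ) = z (c τ) := S.pr_subm.exists_lift hz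

lemma exists_lift {y₁ : T → G₁.Y} {y₂ : T → G₂.Y} (hy₁ : Smooth y₁) (hy₂ : Smooth y₂)
    (h : ∀ τ, G₁.π (y₁ τ) = G₂.π (y₂ τ)) :
    ∃ (T' : Mfd.{u}) (c : T' → T) (q : T' → S.Q.tot), IsSurjSubmersion c ∧ Smooth q ∧
      (∀ τ, S.ζ (S.pr (q τ)) = y₁ (c τ)) ∧ ∀ τ, S.η (S.pr (q τ)) = y₂ (c τ) := by
  obtain ⟨T₁, c₁, z, hc₁, hz, h₁, h₂⟩ := S.ξ_subm.exists_lift G₁.π_subm.isSubm G₂.π_subm.smooth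
    hy₁ hy₂ h
  obtain ⟨T₂, c₂, q, hc₂, hq, h₃⟩ := S.exists_lift_pr hz
  exact ⟨T₂, fun τ => c₁ (c₂ τ), q, hc₁.comp hc₂, hq, fun τ => by rw [h₃, h₁],
    fun τ => by rw [h₃, h₂]⟩

/-- A map to `Q` is smooth if its projection is and it is smooth up to `Ψ`. -/
lemma smooth_of_Ψ {q₁ q₂ : T → S.Q.tot} {p : T → G₁.P.tot}
    {h : ∀ τ, S.ζ (S.pr (q₁ τ)) = G₁.s (p τ)} {h' : ∀ τ, S.ζ (S.pr (q₂ τ)) = G₁.t (p τ)} (hq₁ : Smooth q₁)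
    (hp : Smooth p) (hz : Smooth (fun τ => S.pr (q₂ τ)))
    (e : Smooth (Y := G₂.P.tot) (fun τ => S.Ψ (q₁ τ) (p τ) (q₂ τ) (h τ) (h' τ))) :
    Smooth q₂ := by
  obtain ⟨T', c, q, hc, hq, hqz⟩ := S.exists_lift_pr hz
  choose k hk using fun τ => S.exists_smul (hqz τ)
  refine S.Q.smooth_of_cover hc hq ?_ hk
  have h1 : ∀ τ, S.ζ (S.pr (q τ)) = G₁.t (p (c τ)) := fun τ => by rw [hqz, h']
  refine G₂.principal.smooth_div T' (fun τ => S.Ψ (q₁ (c τ)) (p (c τ)) (q τ) (h _) (h1 τ)) _ k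
    (S.Ψ_smooth _ _ _ _ _ _ (hq₁.comp hc.smooth) (hp.comp hc.smooth) hq) (e.comp hc.smooth)
    fun τ => ?_
  have h2 : S.ζ (S.pr (k τ • q τ : S.Q)) = G₁.t (p (c τ)) := by rw [S.pr_smul, h1]
  rw [← S.Ψ_smul_right _ _ _ _ _ _ h2]
  simp only [hk]

/-- A map to `P₁` is smooth if it is so after applying `Ψ`. -/
lemma smooth_mid_of_Ψ {q₁ q₂ : T → S.Q.tot} {p : T → G₁.P.tot}
    {h : ∀ τ, S.ζ (S.pr (q₁ τ)) = G₁.s (p τ)} {h' : ∀ τ, S.ζ (S.pr (q₂ τ)) = G₁.t (p τ)} (hq₁ : Smooth q₁)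
    (hq₂ : Smooth q₂)
    (e : Smooth (Y := G₂.P.tot) (fun τ => S.Ψ (q₁ τ) (p τ) (q₂ τ) (h τ) (h' τ))) :
    Smooth p := by
  obtain ⟨T', c, r, hc, hr, hs, ht⟩ := BundleGerbe.exists_lift (G := G₁)
    (S.ζ_subm.smooth.comp (S.smooth_pr.comp hq₁)) (S.ζ_subm.smooth.comp (S.smooth_pr.comp hq₂))
    (fun τ => by
      rw [h, h', G₁.π_s])
  have h1 : ∀ τ, S.ζ (S.pr (q₁ (c τ))) = G₁.s (r τ) := fun τ => (hs τ).symm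
  have h2 : ∀ τ, S.ζ (S.pr (q₂ (c τ))) = G₁.t (r τ) := fun τ => (ht τ).symm
  choose k hk using fun τ => G₁.exists_smul ((h1 τ).symm.trans (h _)) ((h2 τ).symm.trans (h' _))
  refine G₁.P.smooth_of_cover hc hr ?_ hk
  refine G₂.principal.smooth_div T' (fun τ => S.Ψ (q₁ (c τ)) (r τ) (q₂ (c τ)) (h1 _) (h2 τ)) _ k
    (S.Ψ_smooth _ _ _ _ _ _ (hq₁.comp hc.smooth) hr (hq₂.comp hc.smooth)) (e.comp hc.smooth)
    fun τ => ?_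
  rw [← S.Ψ_smul_mid (k τ) _ _ _ _ _ (by rw [G₁.s_smul]; exact h1 τ)
    (by rw [G₁.t_smul]; exact h2 τ)]
  simp only [hk]

end Lift

end Iso

end BundleGerbe

end GerbeAction
end

noncomputable section
namespace GerbeAction

/-! ### Curvings -/

lemma DForm.isSmooth_zero {X : Mfd.{u}} {k : ℕ} : (0 : DForm X k).IsSmooth := fun _ =>
  contDiffOn_const (c := 0)

lemma DForm.d_zero {X : Mfd.{u}} {k : ℕ} : (0 : DForm X k).d = 0 := by
  have h := DForm.isSmooth_zero.d_sub (DForm.isSmooth_zero (X := X) (k := k))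
  rwa [sub_self, sub_self] at h

namespace BundleGerbe

variable {M : Mfd.{u}} {G : BundleGerbe M}

/-- The curvature of the connection of a gerbe is the difference of the pullbacks of a curving. -/
lemma IsCurving.pullback_d {b : DForm G.Y 2} (hb : G.IsCurving b) {T : Mfd.{u}}
    {p : T → G.P.tot} (hp : Smooth p) : G.P.A.d.pullback p =
      b.pullback (fun τ => G.t (p τ)) - b.pullback (fun τ => G.s (p τ)) := by
  rw [← hb.eq, DForm.pullback_sub, DForm.pullback_comp G.smooth_t hp,
    DForm.pullback_comp G.smooth_s hp]

/-- The difference of the two pullbacks of $db$ is $d(dA) = 0$, so $db$ descends to `M`. -/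
lemma IsCurving.existsUnique_isCurvature {b : DForm G.Y 2} (hb : G.IsCurving b) :
    ∃! H : DForm M 3, G.IsCurvature b H := by
  obtain ⟨H, hH, hH'⟩ := G.π_subm.exists_descent_of_pullback hb.smooth.d
    fun T y y' hy hy' h => by
      obtain ⟨T', c, p, hc, hp, hs, ht⟩ := exists_lift (G := G) hy hy' h
      apply hc.pullback_injective
      rw [DForm.pullback_comp hy hc.smooth, DForm.pullback_comp hy' hc.smooth]
      have h1 := congrArg DForm.d (hb.pullback_d hp)
      have h2 := hb.smooth.pullback (G.smooth_t.comp hp)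
      have h3 := hb.smooth.pullback (G.smooth_s.comp hp)
      rw [G.P.smooth_A.d.d_pullback hp, G.P.smooth_A.d_d, h2.d_sub h3,
        hb.smooth.d_pullback (G.smooth_t.comp hp), hb.smooth.d_pullback (G.smooth_s.comp hp),
        funext hs, funext ht] at h1
      exact (sub_eq_zero.1 h1.symm).symm
  exact ⟨H, ⟨hH, hH'⟩, fun H' h => G.π_subm.pullback_injective (h.eq.trans hH'.symm)⟩

lemma IsCurving.add_pullback {b : DForm G.Y 2} (hb : G.IsCurving b) {ϕ : DForm M 2}
    (hϕ : ϕ.IsSmooth) : G.IsCurving (b + ϕ.pullback G.π) where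
  smooth := hb.smooth.add (hϕ.pullback G.π_subm.smooth)
  eq := by
    rw [DForm.pullback_add, DForm.pullback_add, DForm.pullback_comp G.π_subm.smooth G.smooth_t,
      DForm.pullback_comp G.π_subm.smooth G.smooth_s, funext G.π_s, add_sub_add_right_eq_sub, hb.eq]

/-- Both curvings have the same Čech differential $dA$, so their difference descends to `M`. -/
lemma IsCurving.existsUnique_sub {b₁ b₂ : DForm G.Y 2} (h₁ : G.IsCurving b₁)
    (h₂ : G.IsCurving b₂) : ∃! ϕ : DForm M 2, ϕ.IsSmooth ∧ b₁ = b₂ + ϕ.pullback G.π := by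
  obtain ⟨ϕ, hϕ, hϕ'⟩ := G.π_subm.exists_descent_of_pullback (h₁.smooth.sub h₂.smooth)
    fun T y y' hy hy' h => by
      obtain ⟨T', c, p, hc, hp, hs, ht⟩ := exists_lift (G := G) hy hy' h
      apply hc.pullback_injective
      rw [DForm.pullback_comp hy hc.smooth, DForm.pullback_comp hy' hc.smooth]
      have k := (h₁.pullback_d hp).symm.trans (h₂.pullback_d hp)
      rw [funext hs, funext ht] at k
      rw [DForm.pullback_sub, DForm.pullback_sub]
      rw [sub_eq_sub_iff_add_eq_add] at k ⊢
      rw [add_comm, ← k, add_comm]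
  refine ⟨ϕ, ⟨hϕ, by rw [hϕ', add_sub_cancel]⟩, fun ψ hψ => G.π_subm.pullback_injective ?_⟩
  rw [hϕ', hψ.2, add_sub_cancel_left]

/-- The pulled back gerbe has the same `Y`, bundle and connection; only the projection to `M`
changes. -/
lemma IsCurving.of_pullback {f : Diff M} {b : DForm G.Y 2} (hb : G.IsCurving b) :
    (G.pullback f).IsCurving b := ⟨hb.smooth, hb.eq⟩

lemma _root_.Diffeomorph.smooth (f : Diff M) : Smooth f := f.contMDiff

lemma IsCurvature.of_pullback {f : Diff M} {b : DForm G.Y 2} {H : DForm M 3}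
    (hH : G.IsCurvature b H) : (G.pullback f).IsCurvature b (H.pullback f) where
  smooth := hH.smooth.pullback f.smooth
  eq := by
    refine (DForm.pullback_comp f.smooth (f.symm.smooth.comp G.π_subm.smooth) H).trans ?_
    have h : (fun y => f (f.symm (G.π y))) = G.π := funext fun y => f.apply_symm_apply _
    exact (congrArg (fun g => H.pullback g) h).trans hH.eq

/-! ### Curvature of an isomorphism and descent of curvings -/

namespace Iso

variable {G₁ G₂ : BundleGerbe M} (S : Iso G₁ G₂)

lemma existsUnique_isCurvature : ∃! F : DForm S.Z 2, S.IsCurvature F := by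
  obtain ⟨F, hF, hF'⟩ := S.pr_subm.exists_descent_of_pullback S.Q.smooth_A.d
    fun T q q' hq hq' h => by
      choose c hc using fun τ => S.exists_smul (h τ)
      exact (S.Q.d_pullback_eq_of_smul hq hq' (S.principal.smooth_div T q q' c hq hq' hc) hc).symm
  exact ⟨F, ⟨hF, hF'⟩, fun F' h => S.pr_subm.pullback_injective (h.eq.trans hF'.symm)⟩

variable {S} {T : Mfd.{u}}

lemma IsCurvature.pullback {F : DForm S.Z 2} (hF : S.IsCurvature F) {q : T → S.Q.tot}
    (hq : Smooth q) : F.pullback (fun τ => S.pr (q τ)) = S.Q.A.d.pullback q := by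
  rw [← hF.eq, DForm.pullback_comp S.smooth_pr hq]

/-- The curvature form of the equation expressing that `Ψ` preserves connections. -/
lemma d_Ψ {b₂ : DForm G₂.Y 2} (hb₂ : G₂.IsCurving b₂) {q₁ q₂ : T → S.Q.tot} {p : T → G₁.P.tot}
    (hq₁ : Smooth q₁) (hp : Smooth p) (hq₂ : Smooth q₂) (h : ∀ τ, S.ζ (S.pr (q₁ τ)) = G₁.s (p τ))
    (h' : ∀ τ, S.ζ (S.pr (q₂ τ)) = G₁.t (p τ)) :
    (G₁.P.A.pullback p).d + S.Q.A.d.pullback q₂ = S.Q.A.d.pullback q₁ +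
      (b₂.pullback (fun τ => S.η (S.pr (q₂ τ))) - b₂.pullback (fun τ => S.η (S.pr (q₁ τ)))) := by
  have h1 := congrArg DForm.d (S.Ψ_conn T q₁ p q₂ h h' hq₁ hp hq₂)
  have hm := S.Ψ_smooth T q₁ p q₂ h h' hq₁ hp hq₂
  rw [(G₁.P.smooth_A.pullback hp).d_add (S.Q.smooth_A.pullback hq₂),
    (S.Q.smooth_A.pullback hq₁).d_add (G₂.P.smooth_A.pullback hm),
    S.Q.smooth_A.d_pullback hq₁, S.Q.smooth_A.d_pullback hq₂,
    G₂.P.smooth_A.d_pullback hm, hb₂.pullback_d hm] at h1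
  simp only [S.s_Ψ, S.t_Ψ] at h1
  exact h1

variable {b₂ : DForm G₂.Y 2} {F : DForm S.Z 2}

/-- After lifting both points to `Q`, use `d_Ψ` with the unit of `G₁` in the middle; the term of `A`
drops out by `A_unit`. -/
lemma IsCurvature.cech (hF : S.IsCurvature F) (hb₂ : G₂.IsCurving b₂) {z₁ z₂ : T → S.Z}
    (hz₁ : Smooth z₁) (hz₂ : Smooth z₂) (h : ∀ τ, S.ζ (z₁ τ) = S.ζ (z₂ τ)) :
    (b₂.pullback S.η - F).pullback z₁ = (b₂.pullback S.η - F).pullback z₂ := by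
  obtain ⟨T₁, c₁, q, hc₁, hq, hqz⟩ := S.exists_lift_pr hz₁
  obtain ⟨T₂, c₂, q₂, hc₂, hq₂, hqz₂⟩ := S.exists_lift_pr (hz₂.comp hc₁.smooth)
  have hc := hc₁.comp hc₂
  have hq₁ : Smooth (fun τ => q (c₂ τ)) := hq.comp hc₂.smooth
  apply hc.pullback_injective
  rw [DForm.pullback_comp hz₁ hc.smooth, DForm.pullback_comp hz₂ hc.smooth]
  have e₁ : (fun τ => z₁ (c₁ (c₂ τ))) = fun τ => S.pr (q (c₂ τ)) := funext fun τ => (hqz _).symm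
  have e₂ : (fun τ => z₂ (c₁ (c₂ τ))) = fun τ => S.pr (q₂ τ) := funext fun τ => (hqz₂ _).symm
  rw [e₁, e₂, DForm.pullback_sub, DForm.pullback_sub, hF.pullback hq₁, hF.pullback hq₂,
    DForm.pullback_comp S.η_subm.smooth (S.smooth_pr.comp hq₁),
    DForm.pullback_comp S.η_subm.smooth (S.smooth_pr.comp hq₂)]
  have hy : Smooth (fun τ => S.ζ (S.pr (q (c₂ τ)))) :=
    S.ζ_subm.smooth.comp (S.smooth_pr.comp hq₁)
  have h1 := d_Ψ hb₂ hq₁ (G₁.smooth_unit.comp hy) hq₂ (fun τ => by simp)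
    (fun τ => by simp [hqz, hqz₂, h])
  rw [← DForm.pullback_comp G₁.smooth_unit hy, A_unit] at h1
  have h2 : DForm.d ((0 : DForm G₁.Y 1).pullback (fun τ => S.ζ (S.pr (q (c₂ τ))))) = 0 := by
    have h3 : ((0 : DForm G₁.Y 1).pullback (fun τ => S.ζ (S.pr (q (c₂ τ))))) = 0 := rfl
    rw [h3, DForm.d_zero]
  rw [h2, zero_add] at h1
  rw [h1]
  abel

lemma IsCurvature.existsUnique_descent (hF : S.IsCurvature F) (hb₂ : G₂.IsCurving b₂) :
    ∃! b₁ : DForm G₁.Y 2, b₁.IsSmooth ∧ b₁.pullback S.ζ = b₂.pullback S.η - F := by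
  obtain ⟨b₁, h, h'⟩ := S.ζ_subm.exists_descent_of_pullback
    ((hb₂.smooth.pullback S.η_subm.smooth).sub hF.smooth)
    fun T z₁ z₂ hz₁ hz₂ hz => hF.cech hb₂ hz₁ hz₂ hz
  exact ⟨b₁, ⟨h, h'⟩, fun b hb => S.ζ_subm.pullback_injective (hb.2.trans h'.symm)⟩

variable {b₁ : DForm G₁.Y 2}

lemma IsCurvature.pullback_curving (hF : S.IsCurvature F)
    (h : b₁.pullback S.ζ = b₂.pullback S.η - F) {q : T → S.Q.tot} (hq : Smooth q) :
    b₁.pullback (fun τ => S.ζ (S.pr (q τ))) =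
      b₂.pullback (fun τ => S.η (S.pr (q τ))) - S.Q.A.d.pullback q := by
  have hz := S.smooth_pr.comp hq
  have h1 := congrArg (DForm.pullback fun τ => S.pr (q τ)) h
  rwa [DForm.pullback_sub, DForm.pullback_comp S.ζ_subm.smooth hz,
    DForm.pullback_comp S.η_subm.smooth hz, hF.pullback hq] at h1

/-- On a cover of `P`, lift the two end points to `Q`; `d_Ψ` then expresses $dA$ as the difference
of $\eta^*b_2 - d\Theta$ at these lifts, that is, of $b_1$ at the end points. -/
lemma IsCurvature.isCurving (hF : S.IsCurvature F) (hb₂ : G₂.IsCurving b₂) (hb₁ : b₁.IsSmooth)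
    (h : b₁.pullback S.ζ = b₂.pullback S.η - F) : G₁.IsCurving b₁ := by
  refine ⟨hb₁, ?_⟩
  obtain ⟨T₁, c₁, q, hc₁, hq, hs⟩ := (S.ζ_subm.comp S.pr_subm).exists_lift G₁.smooth_s
  obtain ⟨T₂, c₂, q₂, hc₂, hq₂, ht⟩ := (S.ζ_subm.comp S.pr_subm).exists_lift
    (G₁.smooth_t.comp hc₁.smooth)
  have hc := hc₁.comp hc₂
  have hq₁ : Smooth (fun τ => q (c₂ τ)) := hq.comp hc₂.smooth
  apply hc.pullback_injective
  have h1 := d_Ψ hb₂ hq₁ hc.smooth hq₂ (fun τ => hs _) ht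
  have h2 := hF.pullback_curving h hq₁
  have h3 := hF.pullback_curving h hq₂
  rw [DForm.pullback_sub, DForm.pullback_comp G₁.smooth_t hc.smooth,
    DForm.pullback_comp G₁.smooth_s hc.smooth]
  have e₁ : (fun τ => G₁.s (c₁ (c₂ τ))) = fun τ => S.ζ (S.pr (q (c₂ τ))) :=
    funext fun τ => (hs _).symm
  have e₂ : (fun τ => G₁.t (c₁ (c₂ τ))) = fun τ => S.ζ (S.pr (q₂ τ)) := funext fun τ => (ht _).symm
  rw [G₁.P.smooth_A.d_pullback hc.smooth] at h1
  rw [e₁, e₂, h2, h3, eq_sub_of_add_eq h1]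
  abel

/-- On `Q` the curvature of `Θ` is exact, so it does not contribute to $db_1$, and $\eta$ and
$\zeta$ lie over the same point of `M`. -/
lemma IsCurvature.isCurvature (hF : S.IsCurvature F) (hb₂ : G₂.IsCurving b₂) (hb₁ : b₁.IsSmooth)
    (h : b₁.pullback S.ζ = b₂.pullback S.η - F) {H : DForm M 3} (hH : G₂.IsCurvature b₂ H) :
    G₁.IsCurvature b₁ H := by
  refine ⟨hH.smooth, (S.ζ_subm.comp S.pr_subm).pullback_injective ?_⟩
  have hz := S.ζ_subm.smooth.comp S.smooth_pr
  have he := S.η_subm.smooth.comp S.smooth_pr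
  have h1 := congrArg DForm.d (hF.pullback_curving h (Smooth.id S.Q.tot))
  rw [hb₁.d_pullback hz, (hb₂.smooth.pullback he).d_sub (S.Q.smooth_A.d.pullback (Smooth.id _)),
    hb₂.smooth.d_pullback he, S.Q.smooth_A.d.d_pullback (Smooth.id _), S.Q.smooth_A.d_d,
    ← hH.eq, DForm.pullback_comp G₂.π_subm.smooth he] at h1
  rw [DForm.pullback_comp G₁.π_subm.smooth hz, h1, funext fun q => S.π_η (S.pr q)]
  exact (sub_zero _).symm

end Iso

end BundleGerbe

end GerbeAction
end

noncomputable section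
namespace GerbeAction

/-! ### 2-isomorphisms as relations -/

/-- The one-point manifold. -/
def Mfd.point : Mfd.{u} :=
  let _ : ChartedSpace PUnit.{1} PUnit.{u + 1} := ChartedSpace.ofDiscreteTopology
  { carrier := PUnit.{u + 1}
    E := PUnit.{1}
    mfd := IsManifold.of_discreteTopology ∞ }

lemma smooth_const {X Y : Mfd.{u}} (y : Y) : Smooth (fun _ : X => y) := contMDiff_const

namespace BundleGerbe.Iso

variable {M : Mfd.{u}} {G₁ G₂ G₃ : BundleGerbe M}

/-- The surjective submersion of an isomorphism, as a map to the fibre product. -/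
def ξ (S : Iso G₁ G₂) : S.Z → Mfd.fibProd G₁.π G₂.π G₁.π_subm.isSubm G₂.π_subm.smooth :=
  FibProd.pair G₁.π_subm.isSubm G₂.π_subm.smooth S.ζ S.η S.π_η

lemma surjSubmersion_ξ (S : Iso G₁ G₂) : IsSurjSubmersion S.ξ :=
  S.ξ_subm.surjSubmersion_pair G₁.π_subm.isSubm G₂.π_subm.smooth

lemma ξ_eq {S S' : Iso G₁ G₂} {z : S.Z} {z' : S'.Z} (h : S.ζ z = S'.ζ z') (h' : S.η z = S'.η z') :
    S.ξ z = S'.ξ z' := FibProd.ext _ _ h h'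

lemma ζ_eq_of_ξ {S S' : Iso G₁ G₂} {z : S.Z} {z' : S'.Z} (h : S.ξ z = S'.ξ z') :
    S.ζ z = S'.ζ z' :=
  congrArg (FibProd.fst G₁.π_subm.isSubm G₂.π_subm.smooth) h

lemma η_eq_of_ξ {S S' : Iso G₁ G₂} {z : S.Z} {z' : S'.Z} (h : S.ξ z = S'.ξ z') :
    S.η z = S'.η z' :=
  congrArg (FibProd.snd G₁.π_subm.isSubm G₂.π_subm.smooth) h

lemma dm_ξ_eq {S S' : Iso G₁ G₂} {z : S.Z} {z' : S'.Z} (hz : S.ξ z = S'.ξ z') {v : S.Z.E}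
    {v' : S'.Z.E} : dm S.ξ z v = dm S'.ξ z' v' ↔
      dm S.ζ z v = dm S'.ζ z' v' ∧ dm S.η z v = dm S'.η z' v' := by
  have h1 : ∀ (S : Iso G₁ G₂) (z : S.Z) (v : S.Z.E),
      dm (FibProd.fst G₁.π_subm.isSubm G₂.π_subm.smooth) (S.ξ z) (dm S.ξ z v) = dm S.ζ z v :=
    fun S z v => FibProd.dm_fst_pair _ _ _ S.ζ_subm.smooth S.η_subm.smooth z v
  have h2 : ∀ (S : Iso G₁ G₂) (z : S.Z) (v : S.Z.E),
      dm (FibProd.snd G₁.π_subm.isSubm G₂.π_subm.smooth) (S.ξ z) (dm S.ξ z v) = dm S.η z v :=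
    fun S z v => FibProd.dm_snd_pair _ _ _ S.ζ_subm.smooth S.η_subm.smooth z v
  rw [← h1, ← h2, ← h1, ← h2, hz]
  refine ⟨fun h => by rw [h]; exact ⟨rfl, rfl⟩, fun h => FibProd.dm_injective _ _ _ h.1 h.2⟩

/-! #### 2-isomorphisms `S → S'` -/

/-- The graph of a 2-isomorphism `S → S'`: the pairs `(q, β q)`. -/
structure IsTwoRel (S S' : Iso G₁ G₂) (K : S.Q → S'.Q → Prop) : Prop where
  ζ : ∀ {q q'}, K q q' → S.ζ (S.pr q) = S'.ζ (S'.pr q')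
  η : ∀ {q q'}, K q q' → S.η (S.pr q) = S'.η (S'.pr q')
  lift : ∀ (T : Mfd.{u}) (q : T → S.Q.tot) (z : T → S'.Z), Smooth q → Smooth z →
    (∀ τ, S.ζ (S.pr (q τ)) = S'.ζ (z τ)) → (∀ τ, S.η (S.pr (q τ)) = S'.η (z τ)) →
    ∃ (T' : Mfd.{u}) (c : T' → T) (q' : T' → S'.Q.tot), IsSurjSubmersion c ∧ Smooth q' ∧
      (∀ τ, S'.pr (q' τ) = z (c τ)) ∧ (∀ τ, K (q (c τ)) (q' τ)) ∧
      S'.Q.A.pullback q' = S.Q.A.pullback (fun τ => q (c τ))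
  Ψ : ∀ {q₁ q₁' q₂ q₂'} (p : G₁.P), K q₁ q₁' → K q₂ q₂' → ∀ h h' k k',
    S'.Ψ q₁' p q₂' h h' = S.Ψ q₁ p q₂ k k'

namespace IsTwoRel

variable {S S' : Iso G₁ G₂} {K : S.Q → S'.Q → Prop} (hK : IsTwoRel S S' K)
include hK

/-- Compatibility transports $\Psi(q, 1, q) = 1$ to $\Psi'(q_1, 1, q_2) = 1$, which forces equality.
-/
lemma unique {q : S.Q} {q₁ q₂ : S'.Q} (h₁ : K q q₁) (h₂ : K q q₂) (h : S'.pr q₁ = S'.pr q₂) :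
    q₁ = q₂ := by
  refine S'.eq_of_Ψ_unit (y := S'.ζ (S'.pr q₁)) (y₂ := S.η (S.pr q)) (h := by simp)
    (h' := by simp [h]) h ?_
  rw [hK.Ψ _ h₁ h₂ _ _ (by simp [hK.ζ h₁]) (by simp [hK.ζ h₁]), S.Ψ_unit]

/-- Pointwise existence is the lifting property on the one-point manifold. -/
lemma exists_of (q : S.Q) (z : S'.Z) (h : S.ζ (S.pr q) = S'.ζ z) (h' : S.η (S.pr q) = S'.η z) :
    ∃ q', S'.pr q' = z ∧ K q q' := by
  obtain ⟨T', c, q', hc, -, hz, hq, -⟩ := hK.lift Mfd.point (fun _ => q) (fun _ => z)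
    (smooth_const _) (smooth_const _) (fun _ => h) (fun _ => h')
  obtain ⟨τ, -⟩ := hc.surj PUnit.unit
  exact ⟨q' τ, hz τ, hq τ⟩

/-- Equivariance is not part of the relation: it follows by comparing both points through `Ψ` at the
unit, as in `unique`. -/
lemma smul_unique (c : Circle) {q : S.Q} {q₁ q₂ : S'.Q} (h₁ : K q q₁) (h₂ : K (c • q) q₂)
    (h : S'.pr q₁ = S'.pr q₂) : q₂ = c • q₁ := by
  have k : S'.ζ (S'.pr q₁) = G₁.t (G₁.unit (S'.ζ (S'.pr q₁))) := by simp
  have k₂ : S'.ζ (S'.pr q₂) = G₁.t (G₁.unit (S'.ζ (S'.pr q₁))) := by simp [h]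
  have k₃ : S'.ζ (S'.pr (c • q₁)) = G₁.t (G₁.unit (S'.ζ (S'.pr q₁))) := by simp [S'.pr_smul]
  have l : S.ζ (S.pr q) = G₁.s (G₁.unit (S'.ζ (S'.pr q₁))) := by simp [hK.ζ h₁]
  have l' : S.ζ (S.pr q) = G₁.t (G₁.unit (S'.ζ (S'.pr q₁))) := by simp [hK.ζ h₁]
  refine S'.Ψ_right_cancel (q₁ := q₁) (p := G₁.unit (S'.ζ (S'.pr q₁))) (h := by simp) (h' := k₂)
    (k' := k₃) (by rw [S'.pr_smul, h]) ?_
  rw [hK.Ψ _ h₁ h₂ _ _ l (by rwa [S.pr_smul]), S'.Ψ_smul_right c q₁ _ q₁ _ k,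
    S.Ψ_smul_right c q _ q _ l', S.Ψ_unit, S'.Ψ_unit, hK.η h₁]

/-- The 2-isomorphism with a given graph. -/
lemma nonempty_twoIso : Nonempty (TwoIso S S') := by
  let hf := S.surjSubmersion_ξ.isSubm
  let hg := S'.surjSubmersion_ξ.smooth
  -- The largest possible domain, so that surjectivity and submersivity hold by construction.
  let W := Mfd.fibProd S.ξ S'.ξ hf hg
  let w : W → S.Z := FibProd.fst hf hg
  let w' : W → S'.Z := FibProd.snd hf hg
  have hξ : ∀ x, S.ξ (w x) = S'.ξ (w' x) := FibProd.comm hf hg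
  have hw' : Smooth w' := FibProd.smooth_snd hf hg
  have h1 : ∀ (x : W) (q : S.Q), S.pr q = w x → S.ζ (S.pr q) = S'.ζ (w' x) :=
    fun x q h => by rw [h]; exact ζ_eq_of_ξ (hξ x)
  have h2 : ∀ (x : W) (q : S.Q), S.pr q = w x → S.η (S.pr q) = S'.η (w' x) :=
    fun x q h => by rw [h]; exact η_eq_of_ξ (hξ x)
  choose β hβ hβK using fun x q h => hK.exists_of q (w' x) (h1 x q h) (h2 x q h)
  have hlift : ∀ (T : Mfd.{u}) (x : T → W) (a : T → S.Q.tot) (h : ∀ τ, S.pr (a τ) = w (x τ)),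
      Smooth x → Smooth a → ∃ (T' : Mfd.{u}) (c : T' → T), IsSurjSubmersion c ∧
        Smooth (fun τ => (β (x (c τ)) (a (c τ)) (h _) : S'.Q.tot)) ∧
        S'.Q.A.pullback (fun τ => (β (x (c τ)) (a (c τ)) (h _) : S'.Q.tot)) =
          S.Q.A.pullback (fun τ => a (c τ)) := by
    intro T x a h hx ha
    obtain ⟨T', c, q', hc, hq', hz, hKq, hA⟩ := hK.lift T a (fun τ => w' (x τ)) ha
      (hw'.comp hx) (fun τ => h1 _ _ (h τ)) (fun τ => h2 _ _ (h τ))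
    -- By uniqueness the pointwise choice `β` agrees with the smooth local solution, so it inherits
    -- its smoothness and its connection form.
    have e : q' = fun τ => (β (x (c τ)) (a (c τ)) (h _) : S'.Q.tot) := funext fun τ =>
      hK.unique (hKq τ) (hβK _ _ _) ((hz τ).trans (hβ _ _ _).symm)
    exact ⟨T', c, hc, e ▸ hq', e ▸ hA⟩
  have hsm : ∀ (T : Mfd.{u}) (x : T → W) (a : T → S.Q.tot) (h : ∀ τ, S.pr (a τ) = w (x τ)),
      Smooth x → Smooth a → Smooth (fun τ => (β (x τ) (a τ) (h τ) : S'.Q.tot)) := by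
    intro T x a h hx ha
    obtain ⟨T', c, hc, hs, -⟩ := hlift T x a h hx ha
    exact hc.smooth_of_comp hs
  exact ⟨{
    W := W
    w := w
    w' := w'
    smooth_w := FibProd.smooth_fst hf hg
    smooth_w' := hw'
    comm₁ := fun x => ζ_eq_of_ξ (hξ x)
    comm₂ := fun x => η_eq_of_ξ (hξ x)
    surj := fun z z' h h' => ⟨FibProd.mk hf hg z z' (ξ_eq h h'), rfl, rfl⟩
    subm := fun x v v' h h' =>
      FibProd.exists_tangent hf hg x v v' ((dm_ξ_eq (hξ x)).2 ⟨h, h'⟩)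
    β := β
    pr_β := hβ
    β_smul := fun c x q h h' => hK.smul_unique c (hβK _ _ _) (hβK _ _ _) (by rw [hβ, hβ])
    β_smooth := hsm
    β_conn := fun T x a h hx ha => by
      obtain ⟨T', c, hc, -, hA⟩ := hlift T x a h hx ha
      apply hc.pullback_injective
      rw [DForm.pullback_comp (hsm T x a h hx ha) hc.smooth, DForm.pullback_comp ha hc.smooth]
      exact hA
    β_Ψ := fun x₁ x₂ q₁ p q₂ h₁ h₂ k₁ k₂ k₁' k₂' => hK.Ψ p (hβK _ _ _) (hβK _ _ _) _ _ _ _ }⟩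

lemma exists_lift {T : Mfd.{u}} {q : T → S.Q.tot} (hq : Smooth q) :
    ∃ (T' : Mfd.{u}) (c : T' → T) (q' : T' → S'.Q.tot), IsSurjSubmersion c ∧ Smooth q' ∧
      (∀ τ, K (q (c τ)) (q' τ)) ∧ S'.Q.A.pullback q' = S.Q.A.pullback (fun τ => q (c τ)) := by
  have hz := S.smooth_pr.comp hq
  obtain ⟨T₁, c₁, z, hc₁, hz, hζ, hη⟩ := S'.ξ_subm.exists_lift G₁.π_subm.isSubm G₂.π_subm.smooth
    (S.ζ_subm.smooth.comp hz) (S.η_subm.smooth.comp hz) (fun τ => S.π_η (S.pr (q τ)))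
  obtain ⟨T₂, c₂, q', hc₂, hq', -, hK', hA⟩ := hK.lift T₁ (fun τ => q (c₁ τ)) z
    (hq.comp hc₁.smooth) hz (fun τ => (hζ τ).symm) (fun τ => (hη τ).symm)
  exact ⟨T₂, fun τ => c₁ (c₂ τ), q', hc₁.comp hc₂, hq', hK', hA⟩

end IsTwoRel

/-- The graph of a 2-isomorphism. -/
lemma TwoIso.isTwoRel {S S' : Iso G₁ G₂} (e : TwoIso S S') :
    IsTwoRel S S' (fun q q' => ∃ x h, e.β x q h = q') where
  ζ := by
    rintro q _ ⟨x, h, rfl⟩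
    rw [e.pr_β, h, e.comm₁]
  η := by
    rintro q _ ⟨x, h, rfl⟩
    rw [e.pr_β, h, e.comm₂]
  lift T q z hq hz hζ hη := by
    have hW : IsSurjSubmersionOnto S.ξ S'.ξ e.w e.w' :=
      { smooth_left := e.smooth_w
        smooth_right := e.smooth_w'
        comm := fun x => ξ_eq (e.comm₁ x) (e.comm₂ x)
        surj := fun z z' h => e.surj z z' (ζ_eq_of_ξ h) (η_eq_of_ξ h)
        subm := fun x v v' h => by
          have h1 := (dm_ξ_eq (ξ_eq (e.comm₁ x) (e.comm₂ x))).1 h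
          exact e.subm x v v' h1.1 h1.2 }
    obtain ⟨T', c, x, hc, hx, hxq, hxz⟩ := hW.exists_lift S.surjSubmersion_ξ.isSubm
      S'.surjSubmersion_ξ.smooth (S.smooth_pr.comp hq) hz (fun τ => ξ_eq (hζ τ) (hη τ))
    refine ⟨T', c, fun τ => e.β (x τ) (q (c τ)) (hxq τ).symm, hc,
      e.β_smooth _ _ _ _ hx (hq.comp hc.smooth), fun τ => ?_, fun τ => ⟨_, _, rfl⟩,
      e.β_conn _ _ _ _ hx (hq.comp hc.smooth)⟩
    rw [e.pr_β, hxz]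
  Ψ := by
    rintro q₁ _ q₂ _ p ⟨x, h, rfl⟩ ⟨x', h', rfl⟩ k k' l l'
    exact e.β_Ψ _ _ _ _ _ _ _ _ _ _ _

/-! #### 2-isomorphisms `id → S` -/

/-- The graph of a 2-isomorphism `id → S`. -/
structure IsIdRel (S : Iso G₁ G₁) (K : G₁.P → S.Q → Prop) : Prop where
  s : ∀ {r k}, K r k → G₁.s r = S.ζ (S.pr k)
  t : ∀ {r k}, K r k → G₁.t r = S.η (S.pr k)
  lift : ∀ (T : Mfd.{u}) (r : T → G₁.P.tot) (z : T → S.Z), Smooth r → Smooth z →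
    (∀ τ, G₁.s (r τ) = S.ζ (z τ)) → (∀ τ, G₁.t (r τ) = S.η (z τ)) →
    ∃ (T' : Mfd.{u}) (c : T' → T) (k : T' → S.Q.tot), IsSurjSubmersion c ∧ Smooth k ∧
      (∀ τ, S.pr (k τ) = z (c τ)) ∧ (∀ τ, K (r (c τ)) (k τ)) ∧
      S.Q.A.pullback k = G₁.P.A.pullback (fun τ => r (c τ))
  Ψ : ∀ {r₁ k₁ r₂ k₂} (p : G₁.P), K r₁ k₁ → K r₂ k₂ → ∀ h h' l l',
    G₁.μ r₁ (S.Ψ k₁ p k₂ h h') l = G₁.μ p r₂ l'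

/-- The graph of a 2-isomorphism from the identity. -/
lemma IdIso.isIdRel {G : BundleGerbe M} {S : Iso G (G.pullback (Diffeomorph.refl M.I M ∞))}
    (e : IdIso S) : IsIdRel (G₁ := G) S (fun r k => ∃ x h h', e.β x r h h' = k) where
  s := by
    rintro r _ ⟨x, h, h', rfl⟩
    exact h.trans (congrArg S.ζ (e.pr_β _ _ _ _).symm)
  t := by
    rintro r _ ⟨x, h, h', rfl⟩
    exact h'.trans (congrArg S.η (e.pr_β _ _ _ _).symm)
  lift T r z hr hz hs ht := by
    obtain ⟨T', c, x, hc, hx, hxz⟩ := e.w_subm.exists_lift hz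
    refine ⟨T', c, fun τ => e.β (x τ) (r (c τ)) ((hs _).trans (congrArg S.ζ (hxz τ).symm))
      ((ht _).trans (congrArg S.η (hxz τ).symm)), hc, e.β_smooth _ _ _ _ _ hx (hr.comp hc.smooth),
      fun τ => ?_, fun τ => ⟨_, _, _, rfl⟩, e.β_conn _ _ _ _ _ hx (hr.comp hc.smooth)⟩
    exact (e.pr_β _ _ _ _).trans (hxz τ)
  Ψ := by
    rintro r₁ _ r₂ _ p ⟨x, h, h', rfl⟩ ⟨x', k, k', rfl⟩ l l' m m'
    exact e.β_Ψ _ _ _ _ _ _ _ _ _ _ _ _ _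

namespace IsIdRel

variable {S : Iso G₁ G₁} {K : G₁.P → S.Q → Prop} (hK : IsIdRel S K)
include hK

lemma exists_lift {T : Mfd.{u}} {r : T → G₁.P.tot} (hr : Smooth r) :
    ∃ (T' : Mfd.{u}) (c : T' → T) (k : T' → S.Q.tot), IsSurjSubmersion c ∧ Smooth k ∧
      (∀ τ, K (r (c τ)) (k τ)) ∧ S.Q.A.pullback k = G₁.P.A.pullback (fun τ => r (c τ)) := by
  obtain ⟨T₁, c₁, z, hc₁, hz, hζ, hη⟩ := S.ξ_subm.exists_lift G₁.π_subm.isSubm G₁.π_subm.smooth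
    (G₁.smooth_s.comp hr) (G₁.smooth_t.comp hr) (fun τ => G₁.π_s (r τ))
  obtain ⟨T₂, c₂, k, hc₂, hk, -, hK', hA⟩ := hK.lift T₁ (fun τ => r (c₁ τ)) z
    (hr.comp hc₁.smooth) hz (fun τ => (hζ τ).symm) (fun τ => (hη τ).symm)
  exact ⟨T₂, fun τ => c₁ (c₂ τ), k, hc₁.comp hc₂, hk, hK', hA⟩

end IsIdRel

end BundleGerbe.Iso

end GerbeAction
end

/-! ### Graphs of 2-isomorphisms from an identity: equivariance and factorization -/

noncomputable section
namespace GerbeAction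

namespace BundleGerbe.Iso

variable {M : Mfd.{u}} {G₁ G₂ G₃ : BundleGerbe M}

namespace IsIdRel

variable {S : Iso G₁ G₁} {K : G₁.P → S.Q → Prop} (hK : IsIdRel S K)
include hK

/-- With the unit in the middle, compatibility reads $r \cdot \Psi = c\,r$; cancel `r`. -/
lemma Ψ_smul_unit (c : Circle) {r : G₁.P} {k₁ k₂ : S.Q} (h₁ : K r k₁) (h₂ : K (c • r) k₂) :
    ∃ h h', S.Ψ k₁ (G₁.unit (G₁.s r)) k₂ h h' = c • G₁.unit (G₁.t r) := by
  have h : S.ζ (S.pr k₁) = G₁.s (G₁.unit (G₁.s r)) := by rw [s_unit, hK.s h₁]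
  have h' : S.ζ (S.pr k₂) = G₁.t (G₁.unit (G₁.s r)) := by rw [t_unit, ← hK.s h₂, s_smul]
  refine ⟨h, h', ?_⟩
  have l : G₁.t r = G₁.s (S.Ψ k₁ (G₁.unit (G₁.s r)) k₂ h h') := by rw [S.s_Ψ, hK.t h₁]
  have l' : G₁.t r = G₁.s (G₁.unit (G₁.t r)) := by simp
  have l'' : G₁.t r = G₁.s (c • G₁.unit (G₁.t r)) := by simp [G₁.s_smul]
  refine G₁.μ_left_cancel (p := r) (h := l) (h' := l'') ?_
  rw [hK.Ψ _ h₁ h₂ h h' l (by simp [G₁.s_smul]), unit_μ, G₁.μ_smul_right c _ _ l', μ_unit]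

lemma smul_unique (c : Circle) {r : G₁.P} {k₁ k₂ : S.Q} (h₁ : K r k₁) (h₂ : K (c • r) k₂)
    (h : S.pr k₁ = S.pr k₂) : k₂ = c • k₁ := by
  obtain ⟨k, k', e⟩ := hK.Ψ_smul_unit c h₁ h₂
  obtain ⟨c', rfl⟩ := S.exists_smul h
  have l : S.ζ (S.pr k₁) = G₁.t (G₁.unit (G₁.s r)) := by rw [t_unit, hK.s h₁]
  rw [S.Ψ_smul_right c' k₁ _ k₁ _ l, S.Ψ_unit, hK.t h₁] at e
  rw [G₁.principal.smul_cancel e]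

lemma unique {r : G₁.P} {k₁ k₂ : S.Q} (h₁ : K r k₁) (h₂ : K r k₂) (h : S.pr k₁ = S.pr k₂) :
    k₂ = k₁ := by
  have := hK.smul_unique 1 h₁ (by rwa [one_smul]) h
  rwa [one_smul] at this

lemma exists_of (r : G₁.P) (z : S.Z) (h : G₁.s r = S.ζ z) (h' : G₁.t r = S.η z) :
    ∃ k, S.pr k = z ∧ K r k := by
  obtain ⟨T', c, k, hc, -, hz, hk, -⟩ := hK.lift Mfd.point (fun _ => r) (fun _ => z)
    (smooth_const _) (smooth_const _) (fun _ => h) (fun _ => h')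
  obtain ⟨τ, -⟩ := hc.surj PUnit.unit
  exact ⟨k τ, hz τ, hk τ⟩

/-- Some point over the same base point is related to `c • r`, and `smul_unique` identifies it as `c
• k`. -/
lemma smul (c : Circle) {r : G₁.P} {k : S.Q} (h : K r k) : K (c • r) (c • k) := by
  obtain ⟨k', h1, h2⟩ := hK.exists_of (c • r) (S.pr k) (by rw [s_smul, hK.s h])
    (by rw [t_smul, hK.t h])
  rwa [← hK.smul_unique c h h2 h1.symm]

variable {T : Mfd.{u}}

/-- Uniqueness passes the connection identity from the solution given by `lift` to every smooth
solution. -/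
lemma conn {r : T → G₁.P.tot} {k : T → S.Q.tot} (hr : Smooth r) (hk : Smooth k)
    (h : ∀ τ, K (r τ) (k τ)) : S.Q.A.pullback k = G₁.P.A.pullback r := by
  obtain ⟨T', c, k', hc, hk', hz, hKk, hA⟩ := hK.lift T r (fun τ => S.pr (k τ)) hr
    (S.smooth_pr.comp hk) (fun τ => hK.s (h τ)) (fun τ => hK.t (h τ))
  apply hc.pullback_injective
  rw [DForm.pullback_comp hk hc.smooth, DForm.pullback_comp hr hc.smooth, ← hA]
  congr 1
  exact funext fun τ => hK.unique (hKk τ) (h _) (hz τ)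

/-- A map to `Q` comes, on a cover, from a map to `P`. -/
lemma exists_factor {k : T → S.Q.tot} (hk : Smooth k) :
    ∃ (T' : Mfd.{u}) (c : T' → T) (r : T' → G₁.P.tot), IsSurjSubmersion c ∧ Smooth r ∧
      ∀ τ, K (r τ) (k (c τ)) := by
  have hz := S.smooth_pr.comp hk
  obtain ⟨T₁, c₁, r, hc₁, hr, hs, ht⟩ := BundleGerbe.exists_lift (G := G₁)
    (S.ζ_subm.smooth.comp hz) (S.η_subm.smooth.comp hz) (fun τ => S.π_η (S.pr (k τ)))
  obtain ⟨T₂, c₂, k', hc₂, hk', hz', hKk, -⟩ := hK.lift T₁ r (fun τ => S.pr (k (c₁ τ))) hr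
    (hz.comp hc₁.smooth) hs ht
  -- The lift `r` was arbitrary; the smooth phase `g` between its image and `k` is absorbed into
  -- `r`.
  choose g hg using fun τ => S.exists_smul (hz' τ)
  have hgs := S.principal.smooth_div T₂ k' _ g hk' ((hk.comp hc₁.smooth).comp hc₂.smooth) hg
  exact ⟨T₂, fun τ => c₁ (c₂ τ), fun τ => g τ • r (c₂ τ), hc₁.comp hc₂,
    G₁.P.smooth_smul hgs (hr.comp hc₂.smooth), fun τ => hg τ ▸ hK.smul (g τ) (hKk τ)⟩

end IsIdRel

/-! #### 2-isomorphisms `S' ∘ S → S''` -/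

/-- The graph of a 2-isomorphism `S' ∘ S → S''`. -/
structure IsCompRel (S : Iso G₁ G₂) (S' : Iso G₂ G₃) (S'' : Iso G₁ G₃)
    (K : S.Q → S'.Q → S''.Q → Prop) : Prop where
  ζ : ∀ {q q' q''}, K q q' q'' → S.ζ (S.pr q) = S''.ζ (S''.pr q'')
  mid : ∀ {q q' q''}, K q q' q'' → S.η (S.pr q) = S'.ζ (S'.pr q')
  η : ∀ {q q' q''}, K q q' q'' → S'.η (S'.pr q') = S''.η (S''.pr q'')
  lift : ∀ (T : Mfd.{u}) (q : T → S.Q.tot) (q' : T → S'.Q.tot) (z : T → S''.Z), Smooth q →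
    Smooth q' → Smooth z → (∀ τ, S.ζ (S.pr (q τ)) = S''.ζ (z τ)) →
    (∀ τ, S.η (S.pr (q τ)) = S'.ζ (S'.pr (q' τ))) → (∀ τ, S'.η (S'.pr (q' τ)) = S''.η (z τ)) →
    ∃ (T' : Mfd.{u}) (c : T' → T) (q'' : T' → S''.Q.tot), IsSurjSubmersion c ∧ Smooth q'' ∧
      (∀ τ, S''.pr (q'' τ) = z (c τ)) ∧ (∀ τ, K (q (c τ)) (q' (c τ)) (q'' τ)) ∧
      S''.Q.A.pullback q'' =
        S.Q.A.pullback (fun τ => q (c τ)) + S'.Q.A.pullback (fun τ => q' (c τ))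
  Ψ : ∀ {q₁ q₁' q₁'' q₂ q₂' q₂''} (p : G₁.P), K q₁ q₁' q₁'' → K q₂ q₂' q₂'' →
    ∀ h h' k k' l l', S''.Ψ q₁'' p q₂'' h h' = S'.Ψ q₁' (S.Ψ q₁ p q₂ k k') q₂' l l'

namespace IsCompRel

variable {S : Iso G₁ G₂} {S' : Iso G₂ G₃} {S'' : Iso G₁ G₃} {K : S.Q → S'.Q → S''.Q → Prop}
  (hK : IsCompRel S S' S'' K)
include hK

/-- At the unit, the two-step map $\Psi'(q', \Psi(q, 1, c\,q), c' q')$ equals $c\,c'$ times a unit,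
and compatibility equates it with $\Psi''(q_1, 1, q_2)$. -/
lemma smul_unique (c c' : Circle) {q : S.Q} {q' : S'.Q} {q₁ q₂ : S''.Q} (h₁ : K q q' q₁)
    (h₂ : K (c • q) (c' • q') q₂) (h : S''.pr q₁ = S''.pr q₂) : q₂ = (c * c') • q₁ := by
  have k : S''.ζ (S''.pr q₁) = G₁.s (G₁.unit (S''.ζ (S''.pr q₁))) := by simp
  have k₁ : S''.ζ (S''.pr q₁) = G₁.t (G₁.unit (S''.ζ (S''.pr q₁))) := by simp
  have k₂ : S''.ζ (S''.pr q₂) = G₁.t (G₁.unit (S''.ζ (S''.pr q₁))) := by simp [h]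
  have k₃ : S''.ζ (S''.pr ((c * c') • q₁)) = G₁.t (G₁.unit (S''.ζ (S''.pr q₁))) := by
    simp [S''.pr_smul]
  have l : S.ζ (S.pr q) = G₁.s (G₁.unit (S''.ζ (S''.pr q₁))) := by simp [hK.ζ h₁]
  have l' : S.ζ (S.pr q) = G₁.t (G₁.unit (S''.ζ (S''.pr q₁))) := by simp [hK.ζ h₁]
  have m : S'.ζ (S'.pr q') = G₂.s (G₂.unit (S.η (S.pr q))) := by simp [hK.mid h₁]
  have m' : S'.ζ (S'.pr q') = G₂.t (G₂.unit (S.η (S.pr q))) := by simp [hK.mid h₁]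
  refine S''.Ψ_right_cancel (q₁ := q₁) (p := G₁.unit (S''.ζ (S''.pr q₁))) (h := k) (h' := k₂)
    (k' := k₃) (by rw [S''.pr_smul, h]) ?_
  have e : S.Ψ q (G₁.unit (S''.ζ (S''.pr q₁))) (c • q) l (by rwa [S.pr_smul]) =
      c • G₂.unit (S.η (S.pr q)) := by
    rw [S.Ψ_smul_right c q _ q _ l', S.Ψ_unit]
  have m₁ : S'.ζ (S'.pr q') = G₂.s (c • G₂.unit (S.η (S.pr q))) := by rwa [s_smul]
  have m₂ : S'.ζ (S'.pr q') = G₂.t (c • G₂.unit (S.η (S.pr q))) := by rwa [t_smul]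
  rw [S''.Ψ_smul_right (c * c') q₁ _ q₁ k k₁, S''.Ψ_unit,
    hK.Ψ _ h₁ h₂ k k₂ l (by rwa [S.pr_smul]) (by rw [e]; exact m₁)
      (by rw [e, S'.pr_smul]; exact m₂)]
  simp only [e]
  rw [S'.Ψ_smul_right c' _ _ _ m₁ m₂, S'.Ψ_smul_mid c _ _ _ m m', S'.Ψ_unit, hK.η h₁, smul_smul,
    mul_comm]

lemma unique {q : S.Q} {q' : S'.Q} {q₁ q₂ : S''.Q} (h₁ : K q q' q₁)
    (h₂ : K q q' q₂) (h : S''.pr q₁ = S''.pr q₂) : q₂ = q₁ := by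
  have := hK.smul_unique 1 1 h₁ (by rwa [one_smul, one_smul]) h
  rwa [mul_one, one_smul] at this

lemma exists_of (q : S.Q) (q' : S'.Q) (z : S''.Z) (h : S.ζ (S.pr q) = S''.ζ z)
    (h' : S.η (S.pr q) = S'.ζ (S'.pr q')) (h'' : S'.η (S'.pr q') = S''.η z) :
    ∃ q'', S''.pr q'' = z ∧ K q q' q'' := by
  obtain ⟨T', c, k, hc, -, hz, hk, -⟩ := hK.lift Mfd.point (fun _ => q) (fun _ => q') (fun _ => z)
    (smooth_const _) (smooth_const _) (smooth_const _) (fun _ => h) (fun _ => h') (fun _ => h'')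
  obtain ⟨τ, -⟩ := hc.surj PUnit.unit
  exact ⟨k τ, hz τ, hk τ⟩

lemma smul (c c' : Circle) {q : S.Q} {q' : S'.Q} {q'' : S''.Q} (h : K q q' q'') :
    K (c • q) (c' • q') ((c * c') • q'') := by
  obtain ⟨x, h1, h2⟩ := hK.exists_of (c • q) (c' • q') (S''.pr q'') (by rw [pr_smul, hK.ζ h])
    (by rw [pr_smul, pr_smul, hK.mid h]) (by rw [pr_smul, hK.η h])
  rwa [← hK.smul_unique c c' h h2 h1.symm]

variable {T : Mfd.{u}}

lemma conn {q : T → S.Q.tot} {q' : T → S'.Q.tot} {q'' : T → S''.Q.tot} (hq : Smooth q)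
    (hq' : Smooth q') (hq'' : Smooth q'') (h : ∀ τ, K (q τ) (q' τ) (q'' τ)) :
    S''.Q.A.pullback q'' = S.Q.A.pullback q + S'.Q.A.pullback q' := by
  obtain ⟨T', c, x, hc, hx, hz, hKx, hA⟩ := hK.lift T q q' (fun τ => S''.pr (q'' τ)) hq hq'
    (S''.smooth_pr.comp hq'') (fun τ => hK.ζ (h τ)) (fun τ => hK.mid (h τ)) (fun τ => hK.η (h τ))
  apply hc.pullback_injective
  rw [DForm.pullback_add, DForm.pullback_comp hq'' hc.smooth, DForm.pullback_comp hq hc.smooth,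
    DForm.pullback_comp hq' hc.smooth, ← hA]
  congr 1
  exact funext fun τ => hK.unique (hKx τ) (h _) (hz τ)

lemma exists_lift {q : T → S.Q.tot} {q' : T → S'.Q.tot} (hq : Smooth q) (hq' : Smooth q')
    (h : ∀ τ, S.η (S.pr (q τ)) = S'.ζ (S'.pr (q' τ))) :
    ∃ (T' : Mfd.{u}) (c : T' → T) (q'' : T' → S''.Q.tot), IsSurjSubmersion c ∧ Smooth q'' ∧
      ∀ τ, K (q (c τ)) (q' (c τ)) (q'' τ) := by
  obtain ⟨T₁, c₁, z, hc₁, hz, hζ, hη⟩ := S''.ξ_subm.exists_lift G₁.π_subm.isSubm G₃.π_subm.smooth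
    (S.ζ_subm.smooth.comp (S.smooth_pr.comp hq)) (S'.η_subm.smooth.comp (S'.smooth_pr.comp hq'))
    (fun τ => by
      rw [S.π_η, h, S'.π_η])
  obtain ⟨T₂, c₂, q'', hc₂, hq'', -, hK', -⟩ := hK.lift T₁ (fun τ => q (c₁ τ))
    (fun τ => q' (c₁ τ)) z (hq.comp hc₁.smooth) (hq'.comp hc₁.smooth) hz (fun τ => (hζ τ).symm)
    (fun τ => h _) (fun τ => (hη τ).symm)
  exact ⟨T₂, fun τ => c₁ (c₂ τ), q'', hc₁.comp hc₂, hq'', hK'⟩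

/-- A map to the bundle of a composite comes, on a cover, from maps to the two bundles. -/
lemma exists_factor {q'' : T → S''.Q.tot} (hq'' : Smooth q'') :
    ∃ (T' : Mfd.{u}) (c : T' → T) (q : T' → S.Q.tot) (q' : T' → S'.Q.tot), IsSurjSubmersion c ∧
      Smooth q ∧ Smooth q' ∧ ∀ τ, K (q τ) (q' τ) (q'' (c τ)) := by
  have hz := S''.smooth_pr.comp hq''
  have hy₁ := S''.ζ_subm.smooth.comp hz
  have hy₃ := S''.η_subm.smooth.comp hz
  obtain ⟨T₁, c₁, q, hc₁, hq, hqζ⟩ := (S.ζ_subm.comp S.pr_subm).exists_lift hy₁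
  have hqm := S.η_subm.smooth.comp (S.smooth_pr.comp hq)
  obtain ⟨T₂, c₂, q', hc₂, hq', hζ, hη⟩ := S'.exists_lift hqm (hy₃.comp hc₁.smooth) (fun τ => by
    refine (S.π_η (S.pr (q τ))).symm.trans ?_
    rw [hqζ]
    exact S''.π_η _)
  have hc := hc₁.comp hc₂
  have hq₂ : Smooth (fun τ => q (c₂ τ)) := hq.comp hc₂.smooth
  obtain ⟨T₃, c₃, x, hc₃, hx, hz', hKx, -⟩ := hK.lift T₂ (fun τ => q (c₂ τ)) q'
    (fun τ => S''.pr (q'' (c₁ (c₂ τ)))) hq₂ hq' (hz.comp hc.smooth) (fun τ => hqζ _)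
    (fun τ => (hζ τ).symm) hη
  -- The phase between the product of the chosen lifts and `q''` is smooth and is absorbed into the
  -- first factor.
  choose g hg using fun τ => S''.exists_smul (hz' τ)
  have hgs := S''.principal.smooth_div T₃ x _ g hx ((hq''.comp hc.smooth).comp hc₃.smooth) hg
  refine ⟨T₃, fun τ => c₁ (c₂ (c₃ τ)), fun τ => g τ • q (c₂ (c₃ τ)), fun τ => q' (c₃ τ),
    hc.comp hc₃, S.Q.smooth_smul hgs (hq₂.comp hc₃.smooth), hq'.comp hc₃.smooth, fun τ => ?_⟩
  have := hK.smul (g τ) 1 (hKx τ)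
  rwa [mul_one, one_smul, hg τ] at this

/-- The graph of the pullback along a diffeomorphism of the base. -/
lemma pullback (f : Diff M) : IsCompRel (S.pullback f) (S'.pullback f) (S''.pullback f) K :=
  ⟨hK.ζ, hK.mid, hK.η, hK.lift, hK.Ψ⟩

end IsCompRel

end BundleGerbe.Iso

end GerbeAction
end

/-! ### Passing between 2-isomorphisms from a composite and their graphs -/

noncomputable section
namespace GerbeAction

namespace BundleGerbe.Iso

variable {M : Mfd.{u}} {G₁ G₂ G₃ : BundleGerbe M}

section Middle

variable (S : Iso G₁ G₂) (S' : Iso G₂ G₃)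

/-- The surjective submersion `Z ×_{Y₂} Z' → Y₁ ×_M Y₃` of a composite. -/
def ξComp : Mfd.fibProd S.η S'.ζ S.η_subm.isSubm S'.ζ_subm.smooth →
    Mfd.fibProd G₁.π G₃.π G₁.π_subm.isSubm G₃.π_subm.smooth :=
  FibProd.pair G₁.π_subm.isSubm G₃.π_subm.smooth (fun x => S.ζ (FibProd.fst _ _ x))
    (fun x => S'.η (FibProd.snd _ _ x))
    (fun x => by
      rw [S.π_η, FibProd.comm S.η_subm.isSubm S'.ζ_subm.smooth, S'.π_η])

lemma smooth_ζ_fst : Smooth fun x : Mfd.fibProd S.η S'.ζ S.η_subm.isSubm S'.ζ_subm.smooth =>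
    S.ζ (FibProd.fst _ _ x) := S.ζ_subm.smooth.comp (FibProd.smooth_fst _ _)

lemma smooth_η_snd : Smooth fun x : Mfd.fibProd S.η S'.ζ S.η_subm.isSubm S'.ζ_subm.smooth =>
    S'.η (FibProd.snd _ _ x) := S'.η_subm.smooth.comp (FibProd.smooth_snd _ _)

lemma smooth_ξComp : Smooth (ξComp S S') :=
  FibProd.smooth_pair _ _ _ (smooth_ζ_fst S S') (smooth_η_snd S S')

variable {S S'} {S'' : Iso G₁ G₃}

lemma dm_ξ_eq_ξComp {z'' : S''.Z} {x : Mfd.fibProd S.η S'.ζ S.η_subm.isSubm S'.ζ_subm.smooth}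
    (h : S''.ξ z'' = ξComp S S' x) {v'' : S''.Z.E} {ν} :
    dm S''.ξ z'' v'' = dm (ξComp S S') x ν ↔
      dm S.ζ (FibProd.fst _ _ x) (dm (FibProd.fst _ _) x ν) = dm S''.ζ z'' v'' ∧
      dm S'.η (FibProd.snd _ _ x) (dm (FibProd.snd _ _) x ν) = dm S''.η z'' v'' := by
  have h1 : dm (FibProd.fst G₁.π_subm.isSubm G₃.π_subm.smooth) (S''.ξ z'') (dm S''.ξ z'' v'') =
      dm S''.ζ z'' v'' :=
    FibProd.dm_fst_pair _ _ _ S''.ζ_subm.smooth S''.η_subm.smooth z'' v''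
  have h2 : dm (FibProd.snd G₁.π_subm.isSubm G₃.π_subm.smooth) (S''.ξ z'') (dm S''.ξ z'' v'') =
      dm S''.η z'' v'' :=
    FibProd.dm_snd_pair _ _ _ S''.ζ_subm.smooth S''.η_subm.smooth z'' v''
  have h3 : dm (FibProd.fst G₁.π_subm.isSubm G₃.π_subm.smooth) (ξComp S S' x)
      (dm (ξComp S S') x ν) = dm S.ζ (FibProd.fst _ _ x) (dm (FibProd.fst _ _) x ν) :=
    (FibProd.dm_fst_pair _ _ _ (smooth_ζ_fst S S') (smooth_η_snd S S') x ν).trans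
      (dm_comp_apply (S.ζ_subm.smooth.smAt _) ((FibProd.smooth_fst _ _).smAt _) ν)
  have h4 : dm (FibProd.snd G₁.π_subm.isSubm G₃.π_subm.smooth) (ξComp S S' x)
      (dm (ξComp S S') x ν) = dm S'.η (FibProd.snd _ _ x) (dm (FibProd.snd _ _) x ν) :=
    (FibProd.dm_snd_pair _ _ _ (smooth_ζ_fst S S') (smooth_η_snd S S') x ν).trans
      (dm_comp_apply (S'.η_subm.smooth.smAt _) ((FibProd.smooth_snd _ _).smAt _) ν)
  rw [← h1, ← h2, ← h3, ← h4, h]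
  exact ⟨fun e => by rw [e]; exact ⟨rfl, rfl⟩, fun e => FibProd.dm_injective _ _ _ e.1.symm e.2.symm⟩

lemma ξ_eq_ξComp {z'' : S''.Z} {x : Mfd.fibProd S.η S'.ζ S.η_subm.isSubm S'.ζ_subm.smooth} :
    S''.ξ z'' = ξComp S S' x ↔
      S.ζ (FibProd.fst _ _ x) = S''.ζ z'' ∧ S'.η (FibProd.snd _ _ x) = S''.η z'' :=
  ⟨fun h => ⟨(congrArg (FibProd.fst G₁.π_subm.isSubm G₃.π_subm.smooth) h).symm,
    (congrArg (FibProd.snd G₁.π_subm.isSubm G₃.π_subm.smooth) h).symm⟩,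
    fun h => FibProd.ext _ _ h.1.symm h.2.symm⟩

end Middle

variable {S : Iso G₁ G₂} {S' : Iso G₂ G₃} {S'' : Iso G₁ G₃}

/-- The graph of a 2-isomorphism from a composite. -/
lemma CompIso.isCompRel (e : CompIso S S' S'') :
    IsCompRel S S' S'' (fun q q' q'' => ∃ x h h', e.β x q q' h h' = q'') where
  ζ := by
    rintro q q' _ ⟨x, h, h', rfl⟩
    rw [e.pr_β, h, e.comm₁]
  mid := by
    rintro q q' _ ⟨x, h, h', rfl⟩
    rw [h, h', e.comm₂]
  η := by
    rintro q q' _ ⟨x, h, h', rfl⟩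
    rw [e.pr_β, h', e.comm₃]
  lift T q q' z hq hq' hz hζ hm hη := by
    let hf := S.η_subm.isSubm
    let hg := S'.ζ_subm.smooth
    -- The data of `W` is regrouped as a surjective submersion onto the fibre product of `S''.ξ` and
    -- `ξComp`. The former comes first because only the first map has to be a submersion.
    have hW : IsSurjSubmersionOnto S''.ξ (ξComp S S') e.w''
        (FibProd.pair hf hg e.w e.w' e.comm₂) :=
      { smooth_left := e.smooth_w''
        smooth_right := FibProd.smooth_pair _ _ _ e.smooth_w e.smooth_w'
        comm := fun x => ξ_eq_ξComp.2 ⟨e.comm₁ x, e.comm₃ x⟩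
        surj := fun z'' x h => by
          have h1 := ξ_eq_ξComp.1 h
          obtain ⟨n, h2, h3, h4⟩ := e.surj _ _ z'' h1.1 (FibProd.comm hf hg x) h1.2
          exact ⟨n, h4, FibProd.ext hf hg h2 h3⟩
        subm := fun n v'' ν h => by
          have h1 := (dm_ξ_eq_ξComp (ξ_eq_ξComp.2 ⟨e.comm₁ n, e.comm₃ n⟩)).1 h
          obtain ⟨μ, h2, h3, h4⟩ := e.subm n _ _ v'' h1.1
            (dm_eq_of_comm hf.smooth hg (FibProd.smooth_fst _ _) (FibProd.smooth_snd _ _)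
              (FibProd.comm hf hg) (FibProd.pair hf hg e.w e.w' e.comm₂ n) ν) h1.2
          refine ⟨μ, h4, FibProd.dm_injective hf hg (FibProd.pair hf hg e.w e.w' e.comm₂ n) ?_ ?_⟩
          · exact (FibProd.dm_fst_pair hf hg _ e.smooth_w e.smooth_w' n μ).trans h2
          · exact (FibProd.dm_snd_pair hf hg _ e.smooth_w e.smooth_w' n μ).trans h3 }
    obtain ⟨T', c, x, hc, hx, hx'', hxx⟩ := hW.exists_lift S''.surjSubmersion_ξ.isSubm
      (smooth_ξComp S S') hz (FibProd.smooth_pair hf hg hm (S.smooth_pr.comp hq)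
        (S'.smooth_pr.comp hq')) (fun τ => ξ_eq_ξComp.2 ⟨hζ τ, hη τ⟩)
    have h1 : ∀ τ, e.w (x τ) = S.pr (q (c τ)) := fun τ => congrArg (FibProd.fst hf hg) (hxx τ)
    have h2 : ∀ τ, e.w' (x τ) = S'.pr (q' (c τ)) := fun τ => congrArg (FibProd.snd hf hg) (hxx τ)
    refine ⟨T', c, fun τ => e.β (x τ) (q (c τ)) (q' (c τ)) (h1 τ).symm (h2 τ).symm, hc,
      e.β_smooth _ _ _ _ _ _ hx (hq.comp hc.smooth) (hq'.comp hc.smooth), fun τ => ?_,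
      fun τ => ⟨_, _, _, rfl⟩,
      e.β_conn _ _ _ _ _ _ hx (hq.comp hc.smooth) (hq'.comp hc.smooth)⟩
    rw [e.pr_β, hx'']
  Ψ := by
    rintro q₁ q₁' _ q₂ q₂' _ p ⟨x, h, h', rfl⟩ ⟨y, k, k', rfl⟩ l l' m m' n n'
    exact e.β_Ψ _ _ _ _ _ _ _ _ _ _ _ _ _ _ _ _ _

/-- The 2-isomorphism from a composite with a given graph. -/
lemma IsCompRel.nonempty_compIso {K : S.Q → S'.Q → S''.Q → Prop} (hK : IsCompRel S S' S'' K) :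
    Nonempty (CompIso S S' S'') := by
  let hf := S.η_subm.isSubm
  let hg := S'.ζ_subm.smooth
  let hF := S''.surjSubmersion_ξ.isSubm
  let hG := smooth_ξComp S S'
  let W := Mfd.fibProd S''.ξ (ξComp S S') hF hG
  let w'' : W → S''.Z := FibProd.fst hF hG
  let w : W → S.Z := fun x => FibProd.fst hf hg (FibProd.snd hF hG x)
  let w' : W → S'.Z := fun x => FibProd.snd hf hg (FibProd.snd hF hG x)
  have hw'' : Smooth w'' := FibProd.smooth_fst hF hG
  have hw : Smooth w := (FibProd.smooth_fst hf hg).comp (FibProd.smooth_snd hF hG)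
  have hw' : Smooth w' := (FibProd.smooth_snd hf hg).comp (FibProd.smooth_snd hF hG)
  have c₁ : ∀ x, S.ζ (w x) = S''.ζ (w'' x) := fun x => (ξ_eq_ξComp.1 (FibProd.comm hF hG x)).1
  have c₂ : ∀ x, S.η (w x) = S'.ζ (w' x) := fun x => FibProd.comm hf hg _
  have c₃ : ∀ x, S'.η (w' x) = S''.η (w'' x) := fun x => (ξ_eq_ξComp.1 (FibProd.comm hF hG x)).2
  choose β hβ hβK using fun (x : W) (q : S.Q) (q' : S'.Q) (h : S.pr q = w x)
    (h' : S'.pr q' = w' x) => hK.exists_of q q' (w'' x) (by rw [h, c₁]) (by rw [h, h', c₂])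
      (by rw [h', c₃])
  have hsm : ∀ (T : Mfd.{u}) (x : T → W) (a : T → S.Q.tot) (a' : T → S'.Q.tot)
      (h : ∀ τ, S.pr (a τ) = w (x τ)) (h' : ∀ τ, S'.pr (a' τ) = w' (x τ)),
      Smooth x → Smooth a → Smooth a' →
      Smooth (fun τ => (β (x τ) (a τ) (a' τ) (h τ) (h' τ) : S''.Q.tot)) := by
    intro T x a a' h h' hx ha ha'
    obtain ⟨T', c, q'', hc, hq'', hz, hKq, -⟩ := hK.lift T a a' (fun τ => w'' (x τ)) ha ha'
      (hw''.comp hx) (fun τ => by rw [h, c₁]) (fun τ => by rw [h, h', c₂])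
      (fun τ => by rw [h', c₃])
    have e : q'' = fun τ => (β (x (c τ)) (a (c τ)) (a' (c τ)) (h _) (h' _) : S''.Q.tot) :=
      funext fun τ => hK.unique (hβK _ _ _ _ _) (hKq τ) ((hβ _ _ _ _ _).trans (hz τ).symm)
    exact hc.smooth_of_comp (e ▸ hq'')
  exact ⟨{
    W := W
    w := w
    w' := w'
    w'' := w''
    smooth_w := hw
    smooth_w' := hw'
    smooth_w'' := hw''
    comm₁ := c₁
    comm₂ := c₂
    comm₃ := c₃
    surj := fun z z' z'' h h' h'' =>
      ⟨FibProd.mk hF hG z'' (FibProd.mk hf hg z z' h') (ξ_eq_ξComp.2 ⟨h, h''⟩), rfl, rfl, rfl⟩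
    subm := fun x v v' v'' h h' h'' => by
      obtain ⟨ν, h1, h2⟩ := FibProd.exists_tangent hf hg (FibProd.snd hF hG x) v v' h'
      obtain ⟨μ, h3, h4⟩ := FibProd.exists_tangent hF hG x v'' ν
        ((dm_ξ_eq_ξComp (FibProd.comm hF hG x)).2
          ⟨(congrArg (dm S.ζ (w x)) h1).trans h, (congrArg (dm S'.η (w' x)) h2).trans h''⟩)
      refine ⟨μ, ?_, ?_, h3⟩
      · refine (dm_comp_apply ((FibProd.smooth_fst hf hg).smAt _)
          ((FibProd.smooth_snd hF hG).smAt _) μ).trans ?_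
        rw [h4]
        exact h1
      · refine (dm_comp_apply ((FibProd.smooth_snd hf hg).smAt _)
          ((FibProd.smooth_snd hF hG).smAt _) μ).trans ?_
        rw [h4]
        exact h2
    β := β
    pr_β := hβ
    β_smul := fun c c' x q q' h h' k k' =>
      hK.smul_unique c c' (hβK _ _ _ _ _) (hβK _ _ _ _ _) (by rw [hβ, hβ])
    β_smooth := hsm
    β_conn := fun T x a a' h h' hx ha ha' =>
      hK.conn ha ha' (hsm T x a a' h h' hx ha ha') fun τ => hβK _ _ _ _ _
    β_Ψ := fun x₁ x₂ q₁ q₁' p q₂ q₂' h₁ h₁' h₂ h₂' k₁ k₂ l₁ l₂ m₁ m₂ =>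
      hK.Ψ p (hβK _ _ _ _ _) (hβK _ _ _ _ _) _ _ _ _ _ _ }⟩

end BundleGerbe.Iso

end GerbeAction
end

noncomputable section
namespace GerbeAction

namespace BundleGerbe.Iso

variable {M : Mfd.{u}} {G₁ G₂ G₃ G₄ : BundleGerbe M}

/-! #### Laws of composition, up to 2-isomorphism -/

/-- Transport along `Ψ` solves for the right variable smoothly. -/
lemma exists_Ψ_right_smooth (S : Iso G₁ G₂) {T : Mfd.{u}} {q₁ : T → S.Q.tot} {p : T → G₁.P.tot}
    {r : T → G₂.P.tot} {z : T → S.Z} (hq₁ : Smooth q₁) (hp : Smooth p) (hr : Smooth r)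
    (hz : Smooth z) (h : ∀ τ, S.ζ (S.pr (q₁ τ)) = G₁.s (p τ)) (h' : ∀ τ, S.ζ (z τ) = G₁.t (p τ))
    (k : ∀ τ, S.η (S.pr (q₁ τ)) = G₂.s (r τ)) (k' : ∀ τ, S.η (z τ) = G₂.t (r τ)) :
    ∃ q₂ : T → S.Q.tot, Smooth q₂ ∧ (∀ τ, S.pr (q₂ τ) = z τ) ∧
      ∃ l : ∀ τ, S.ζ (S.pr (q₂ τ)) = G₁.t (p τ), ∀ τ, S.Ψ (q₁ τ) (p τ) (q₂ τ) (h τ) (l τ) = r τ := by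
  choose q hq using fun τ => S.pr_subm.surj (z τ)
  choose q₂ hq₂ l hl using fun τ => S.exists_Ψ_right (q₁ := q₁ τ) (q := q τ) (h τ)
    ((congrArg S.ζ (hq τ)).trans (h' τ)) (k τ) ((congrArg S.η (hq τ)).trans (k' τ))
  have hz' : ∀ τ, S.pr (q₂ τ) = z τ := fun τ => (hq₂ τ).trans (hq τ)
  refine ⟨q₂, S.smooth_of_Ψ (h := h) (h' := l) hq₁ hp ?_ ?_, hz', l, hl⟩
  · exact (funext hz' : (fun τ => S.pr (q₂ τ)) = z) ▸ hz
  · exact (funext hl : (fun τ => S.Ψ (q₁ τ) (p τ) (q₂ τ) (h τ) (l τ)) = r) ▸ hr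

/-- The canonical isomorphism between the fibres of `Q` over points with the same image in
`Y₁ ×_M Y₂` respects `Ψ`. -/
lemma Ψ_eq_of_unit (S : Iso G₁ G₂) {q₁ q₁' q₂ q₂' : S.Q} {p : G₁.P} {y₁ y₂ : G₁.Y} {x₁ x₂ : G₂.Y}
    {h₁ h₁' h₂ h₂' h h' k k'} (e₁ : S.Ψ q₁ (G₁.unit y₁) q₁' h₁ h₁' = G₂.unit x₁)
    (e₂ : S.Ψ q₂ (G₁.unit y₂) q₂' h₂ h₂' = G₂.unit x₂) :
    S.Ψ q₁' p q₂' h h' = S.Ψ q₁ p q₂ k k' := by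
  have l₁ : S.ζ (S.pr q₁') = G₁.s p := h
  have l₂ : S.ζ (S.pr q₂) = G₁.s (G₁.unit y₂) := h₂
  have a := S.Ψ_μ q₁ (G₁.unit y₁) q₁' p q₂' h₁ h₁' h h'
  have b := S.Ψ_μ q₁ p q₂ (G₁.unit y₂) q₂' k k' h₂ h₂'
  simp only [unit_μ, e₁] at a
  simp only [μ_unit, e₂] at b
  exact a.symm.trans b

/-- The points `q` and `q'` may lie over different points of `Z` with the same image in $Y_1
\times_M Y_2$; `Ψ` at the unit is the descent datum that identifies the two fibres. -/
lemma isTwoRel_refl (S : Iso G₁ G₂) : IsTwoRel S S (fun q q' =>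
    ∃ h h', S.Ψ q (G₁.unit (S.ζ (S.pr q))) q' h h' = G₂.unit (S.η (S.pr q))) where
  ζ := by
    rintro q q' ⟨h, h', -⟩
    rw [h', t_unit]
  η := by
    rintro q q' ⟨h, h', e⟩
    have := congrArg G₂.t e
    rwa [S.t_Ψ, t_unit, eq_comm] at this
  lift T q z hq hz hζ hη := by
    have hy₁ := S.ζ_subm.smooth.comp (S.smooth_pr.comp hq)
    have hy₂ := S.η_subm.smooth.comp (S.smooth_pr.comp hq)
    obtain ⟨q', hq', hz', l, e⟩ := S.exists_Ψ_right_smooth hq (G₁.smooth_unit.comp hy₁)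
      (G₂.smooth_unit.comp hy₂) hz (fun τ => by simp) (fun τ => by simp [hζ]) (fun τ => by simp)
      (fun τ => by simp [hη])
    refine ⟨T, fun τ => τ, q', IsSurjSubmersion.id _, hq', hz', fun τ => ⟨_, _, e τ⟩, ?_⟩
    have h := S.Ψ_conn T q _ q' (fun τ => by simp) l hq (G₁.smooth_unit.comp hy₁) hq'
    simp only [e] at h
    rw [← DForm.pullback_comp G₁.smooth_unit hy₁, ← DForm.pullback_comp G₂.smooth_unit hy₂,
      A_unit, A_unit] at h
    exact (zero_add _).symm.trans (h.trans (add_zero _))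
  Ψ := by
    rintro q₁ q₁' q₂ q₂' p ⟨_, _, e₁⟩ ⟨_, _, e₂⟩ h h' k k'
    exact S.Ψ_eq_of_unit e₁ e₂

section Congr

variable {S T : Iso G₁ G₂} {S' T' : Iso G₂ G₃} {U V : Iso G₁ G₃} {K : S.Q → T.Q → Prop}
  {K' : S'.Q → T'.Q → Prop} {L : S.Q → S'.Q → U.Q → Prop} {N : T.Q → T'.Q → V.Q → Prop}

/-- Composition is well defined on isomorphism classes. -/
lemma IsCompRel.congr (hK : IsTwoRel S T K) (hK' : IsTwoRel S' T' K') (hL : IsCompRel S S' U L)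
    (hN : IsCompRel T T' V N) :
    IsTwoRel U V (fun u v => ∃ q q' r r', L q q' u ∧ K q r ∧ K' q' r' ∧ N r r' v) where
  ζ := by
    rintro u v ⟨q, q', r, r', hl, hk, hk', hn⟩
    rw [← hL.ζ hl, hK.ζ hk, hN.ζ hn]
  η := by
    rintro u v ⟨q, q', r, r', hl, hk, hk', hn⟩
    rw [← hL.η hl, hK'.η hk', hN.η hn]
  lift X u z hu hz hζ hη := by
    obtain ⟨X₁, c₁, q, q', hc₁, hq, hq', hl⟩ := hL.exists_factor hu
    obtain ⟨X₂, c₂, r, hc₂, hr, hk, hA⟩ := hK.exists_lift hq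
    obtain ⟨X₃, c₃, r', hc₃, hr', hk', hA'⟩ := hK'.exists_lift (hq'.comp hc₂.smooth)
    have hc₁₂ := hc₁.comp hc₂
    have hc := hc₁₂.comp hc₃
    obtain ⟨X₄, c₄, v, hc₄, hv, hvz, hn, hAn⟩ := hN.lift X₃ (fun τ => r (c₃ τ)) r'
      (fun τ => z (c₁ (c₂ (c₃ τ)))) (hr.comp hc₃.smooth) hr' (hz.comp hc.smooth)
      (fun τ => by rw [← hζ, ← hK.ζ (hk _), hL.ζ (hl _)])
      (fun τ => by rw [← hK.η (hk _), hL.mid (hl _), hK'.ζ (hk' _)])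
      (fun τ => by rw [← hη, ← hK'.η (hk' _), hL.η (hl _)])
    refine ⟨X₄, fun τ => c₁ (c₂ (c₃ (c₄ τ))), v, hc.comp hc₄, hv, hvz,
      fun τ => ⟨_, _, _, _, hl _, hk _, hk' _, hn _⟩, ?_⟩
    have h₃ := hc₃.comp hc₄
    have h₂ := hc₂.comp h₃
    have e := hL.conn (hq.comp h₂.smooth) (hq'.comp h₂.smooth) (hu.comp (hc.comp hc₄).smooth)
      (fun τ => hl _)
    have e₁ := congrArg (DForm.pullback fun τ => c₃ (c₄ τ)) hA
    have e₂ := congrArg (DForm.pullback c₄) hA'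
    rw [DForm.pullback_comp hr h₃.smooth, DForm.pullback_comp (hq.comp hc₂.smooth) h₃.smooth] at e₁
    rw [DForm.pullback_comp hr' hc₄.smooth,
      DForm.pullback_comp ((hq'.comp hc₂.smooth).comp hc₃.smooth) hc₄.smooth] at e₂
    exact hAn.trans ((congrArg₂ (· + ·) e₁ e₂).trans e.symm)
  Ψ := by
    rintro u₁ v₁ u₂ v₂ p ⟨q₁, q₁', r₁, r₁', hl₁, hk₁, hk₁', hn₁⟩
      ⟨q₂, q₂', r₂, r₂', hl₂, hk₂, hk₂', hn₂⟩ h h' k k'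
    have a : S.ζ (S.pr q₁) = G₁.s p := (hL.ζ hl₁).trans k
    have a' : S.ζ (S.pr q₂) = G₁.t p := (hL.ζ hl₂).trans k'
    have b : T.ζ (T.pr r₁) = G₁.s p := (hK.ζ hk₁).symm.trans a
    have b' : T.ζ (T.pr r₂) = G₁.t p := (hK.ζ hk₂).symm.trans a'
    have c : S'.ζ (S'.pr q₁') = G₂.s (S.Ψ q₁ p q₂ a a') := by rw [S.s_Ψ, hL.mid hl₁]
    have c' : S'.ζ (S'.pr q₂') = G₂.t (S.Ψ q₁ p q₂ a a') := by rw [S.t_Ψ, hL.mid hl₂]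
    have d : T'.ζ (T'.pr r₁') = G₂.s (T.Ψ r₁ p r₂ b b') := by rw [T.s_Ψ, hN.mid hn₁]
    have d' : T'.ζ (T'.pr r₂') = G₂.t (T.Ψ r₁ p r₂ b b') := by rw [T.t_Ψ, hN.mid hn₂]
    rw [hL.Ψ p hl₁ hl₂ k k' a a' c c', hN.Ψ p hn₁ hn₂ h h' b b' d d',
      hK'.Ψ _ hk₁' hk₂' d d' (by rw [hK.Ψ p hk₁ hk₂ b b' a a']; exact c)
        (by rw [hK.Ψ p hk₁ hk₂ b b' a a']; exact c')]
    simp only [hK.Ψ p hk₁ hk₂ b b' a a']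

end Congr

section Assoc

variable {S : Iso G₁ G₂} {S' : Iso G₂ G₃} {S'' : Iso G₃ G₄} {A : Iso G₁ G₃} {B : Iso G₁ G₄}
  {C : Iso G₂ G₄} {D : Iso G₁ G₄} {KA : S.Q → S'.Q → A.Q → Prop} {KB : A.Q → S''.Q → B.Q → Prop}
  {KC : S'.Q → S''.Q → C.Q → Prop} {KD : S.Q → C.Q → D.Q → Prop}

/-- Composition is associative. -/
lemma IsCompRel.assoc (hA : IsCompRel S S' A KA) (hB : IsCompRel A S'' B KB)
    (hC : IsCompRel S' S'' C KC) (hD : IsCompRel S C D KD) :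
    IsTwoRel B D (fun b d => ∃ q q' q'' a c, KA q q' a ∧ KB a q'' b ∧ KC q' q'' c ∧
      KD q c d) where
  ζ := by
    rintro b d ⟨q, q', q'', a, c, ha, hb, hc, hd⟩
    rw [← hB.ζ hb, ← hA.ζ ha, hD.ζ hd]
  η := by
    rintro b d ⟨q, q', q'', a, c, ha, hb, hc, hd⟩
    rw [← hB.η hb, hC.η hc, hD.η hd]
  lift X b z hb hz hζ hη := by
    obtain ⟨X₁, c₁, a, q'', hc₁, ha, hq'', hb'⟩ := hB.exists_factor hb
    obtain ⟨X₂, c₂, q, q', hc₂, hq, hq', ha'⟩ := hA.exists_factor ha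
    obtain ⟨X₃, c₃, c, hc₃, hc, hc'⟩ := hC.exists_lift hq' (hq''.comp hc₂.smooth)
      (fun τ => by rw [hA.η (ha' _), hB.mid (hb' _)])
    have h₁₂ := hc₁.comp hc₂
    have h₁₃ := h₁₂.comp hc₃
    obtain ⟨X₄, c₄, d, hc₄, hd, hdz, hd', -⟩ := hD.lift X₃ (fun τ => q (c₃ τ)) c
      (fun τ => z (c₁ (c₂ (c₃ τ)))) (hq.comp hc₃.smooth) hc (hz.comp h₁₃.smooth)
      (fun τ => by rw [← hζ, hA.ζ (ha' _), hB.ζ (hb' _)])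
      (fun τ => by rw [hA.mid (ha' _), hC.ζ (hc' _)])
      (fun τ => by rw [← hη, ← hC.η (hc' _), hB.η (hb' _)])
    refine ⟨X₄, fun τ => c₁ (c₂ (c₃ (c₄ τ))), d, h₁₃.comp hc₄, hd, hdz,
      fun τ => ⟨_, _, _, _, _, ha' _, hb' _, hc' _, hd' _⟩, ?_⟩
    have h₃ := hc₃.comp hc₄
    have h₂ := hc₂.comp h₃
    rw [hD.conn (hq.comp h₃.smooth) (hc.comp hc₄.smooth) hd fun τ => hd' _,
      hC.conn (hq'.comp h₃.smooth) (hq''.comp h₂.smooth) (hc.comp hc₄.smooth) fun τ => hc' _,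
      hB.conn (ha.comp h₂.smooth) (hq''.comp h₂.smooth) (hb.comp (h₁₃.comp hc₄).smooth)
        fun τ => hb' _,
      hA.conn (hq.comp h₃.smooth) (hq'.comp h₃.smooth) (ha.comp h₂.smooth) fun τ => ha' _,
      add_assoc]
  Ψ := by
    rintro b₁ d₁ b₂ d₂ p ⟨q₁, q₁', q₁'', a₁, c₁, ha₁, hb₁, hc₁, hd₁⟩
      ⟨q₂, q₂', q₂'', a₂, c₂, ha₂, hb₂, hc₂, hd₂⟩ h h' k k'
    have l : S.ζ (S.pr q₁) = G₁.s p := (hD.ζ hd₁).trans h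
    have l' : S.ζ (S.pr q₂) = G₁.t p := (hD.ζ hd₂).trans h'
    have m : A.ζ (A.pr a₁) = G₁.s p := (hB.ζ hb₁).trans k
    have m' : A.ζ (A.pr a₂) = G₁.t p := (hB.ζ hb₂).trans k'
    have n : S'.ζ (S'.pr q₁') = G₂.s (S.Ψ q₁ p q₂ l l') := by rw [S.s_Ψ, hA.mid ha₁]
    have n' : S'.ζ (S'.pr q₂') = G₂.t (S.Ψ q₁ p q₂ l l') := by rw [S.t_Ψ, hA.mid ha₂]
    have o : C.ζ (C.pr c₁) = G₂.s (S.Ψ q₁ p q₂ l l') := by rw [S.s_Ψ, hD.mid hd₁]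
    have o' : C.ζ (C.pr c₂) = G₂.t (S.Ψ q₁ p q₂ l l') := by rw [S.t_Ψ, hD.mid hd₂]
    have x : S''.ζ (S''.pr q₁'') = G₃.s (A.Ψ a₁ p a₂ m m') := by rw [A.s_Ψ, hB.mid hb₁]
    have x' : S''.ζ (S''.pr q₂'') = G₃.t (A.Ψ a₁ p a₂ m m') := by rw [A.t_Ψ, hB.mid hb₂]
    have y : S''.ζ (S''.pr q₁'') = G₃.s (S'.Ψ q₁' (S.Ψ q₁ p q₂ l l') q₂' n n') := by
      rw [S'.s_Ψ, hC.mid hc₁]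
    have y' : S''.ζ (S''.pr q₂'') = G₃.t (S'.Ψ q₁' (S.Ψ q₁ p q₂ l l') q₂' n n') := by
      rw [S'.t_Ψ, hC.mid hc₂]
    rw [hD.Ψ p hd₁ hd₂ h h' l l' o o', hC.Ψ _ hc₁ hc₂ o o' n n' y y',
      hB.Ψ p hb₁ hb₂ k k' m m' x x']
    simp only [hA.Ψ p ha₁ ha₂ m m' l l' n n']

end Assoc

section Unit

/-- Any two identities are isomorphic. -/
lemma IsIdRel.isTwoRel {E E' : Iso G₁ G₁} {K : G₁.P → E.Q → Prop} {K' : G₁.P → E'.Q → Prop}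
    (hK : IsIdRel E K) (hK' : IsIdRel E' K') :
    IsTwoRel E E' (fun k k' => ∃ r, K r k ∧ K' r k') where
  ζ := by
    rintro k k' ⟨r, h, h'⟩
    rw [← hK.s h, hK'.s h']
  η := by
    rintro k k' ⟨r, h, h'⟩
    rw [← hK.t h, hK'.t h']
  lift X k z hk hz hζ hη := by
    obtain ⟨X₁, c₁, r, hc₁, hr, hr'⟩ := hK.exists_factor hk
    obtain ⟨X₂, c₂, k', hc₂, hk', hkz, hkr, hA⟩ := hK'.lift X₁ r (fun τ => z (c₁ τ)) hr
      (hz.comp hc₁.smooth) (fun τ => by rw [hK.s (hr' _), hζ]) (fun τ => by rw [hK.t (hr' _), hη])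
    refine ⟨X₂, fun τ => c₁ (c₂ τ), k', hc₁.comp hc₂, hk', hkz, fun τ => ⟨_, hr' _, hkr _⟩, ?_⟩
    rw [hA, hK.conn (hr.comp hc₂.smooth) (hk.comp (hc₁.comp hc₂).smooth) fun τ => hr' _]
  Ψ := by
    rintro k₁ k₁' k₂ k₂' p ⟨r₁, h₁, h₁'⟩ ⟨r₂, h₂, h₂'⟩ h h' l l'
    have m : G₁.t p = G₁.s r₂ := by rw [hK.s h₂, l']
    have n : G₁.t r₁ = G₁.s (E.Ψ k₁ p k₂ l l') := by rw [hK.t h₁, E.s_Ψ]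
    have n' : G₁.t r₁ = G₁.s (E'.Ψ k₁' p k₂' h h') := by rw [hK'.t h₁', E'.s_Ψ]
    exact G₁.μ_left_cancel ((hK'.Ψ p h₁' h₂' h h' n' m).trans (hK.Ψ p h₁ h₂ l l' n m).symm)

variable {S : Iso G₁ G₂} {E : Iso G₂ G₂} {U : Iso G₁ G₂} {K : G₂.P → E.Q → Prop}
  {L : S.Q → E.Q → U.Q → Prop}

/-- The identity is a unit of the composition. -/
lemma IsCompRel.isTwoRel_of_isIdRel (hL : IsCompRel S E U L) (hK : IsIdRel E K) :
    IsTwoRel U S (fun u v => ∃ q k r, L q k u ∧ K r k ∧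
      ∃ h h', S.Ψ q (G₁.unit (S.ζ (S.pr q))) v h h' = r) where
  ζ := by
    rintro u v ⟨q, k, r, hl, hk, h, h', rfl⟩
    rw [← hL.ζ hl, h', t_unit]
  η := by
    rintro u v ⟨q, k, r, hl, hk, h, h', rfl⟩
    rw [← hL.η hl, ← hK.t hk, S.t_Ψ]
  lift X u z hu hz hζ hη := by
    obtain ⟨X₁, c₁, q, k, hc₁, hq, hk, hl⟩ := hL.exists_factor hu
    obtain ⟨X₂, c₂, r, hc₂, hr, hkr⟩ := hK.exists_factor hk
    have hc := hc₁.comp hc₂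
    have hq₂ := hq.comp hc₂.smooth
    have hy := S.ζ_subm.smooth.comp (S.smooth_pr.comp hq₂)
    obtain ⟨v, hv, hvz, l, e⟩ := S.exists_Ψ_right_smooth (q₁ := fun τ => q (c₂ τ))
      (z := fun τ => z (c₁ (c₂ τ))) hq₂ (G₁.smooth_unit.comp hy) hr (hz.comp hc.smooth)
      (fun τ => by simp) (fun τ => by simp [← hζ, hL.ζ (hl _)])
      (fun τ => by rw [hK.s (hkr _), hL.mid (hl _)])
      (fun τ => by rw [← hη, ← hL.η (hl _), hK.t (hkr _)])
    refine ⟨X₂, fun τ => c₁ (c₂ τ), v, hc, hv, hvz,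
      fun τ => ⟨_, _, _, hl _, hkr _, _, _, e τ⟩, ?_⟩
    have h := S.Ψ_conn X₂ _ _ v (fun τ => by simp) l hq₂ (G₁.smooth_unit.comp hy) hv
    simp only [e] at h
    rw [← DForm.pullback_comp G₁.smooth_unit hy, A_unit] at h
    rw [hL.conn hq₂ (hk.comp hc₂.smooth) (hu.comp hc.smooth) fun τ => hl _,
      hK.conn hr (hk.comp hc₂.smooth) hkr]
    exact (zero_add _).symm.trans h
  Ψ := by
    rintro u₁ v₁ u₂ v₂ p ⟨q₁, k₁, r₁, hl₁, hk₁, a₁, b₁, e₁⟩ ⟨q₂, k₂, r₂, hl₂, hk₂, a₂, b₂, e₂⟩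
      h h' l l'
    have m : S.ζ (S.pr q₁) = G₁.s p := (hL.ζ hl₁).trans l
    have m' : S.ζ (S.pr q₂) = G₁.t p := (hL.ζ hl₂).trans l'
    have n : E.ζ (E.pr k₁) = G₂.s (S.Ψ q₁ p q₂ m m') := by rw [S.s_Ψ, hL.mid hl₁]
    have n' : E.ζ (E.pr k₂) = G₂.t (S.Ψ q₁ p q₂ m m') := by rw [S.t_Ψ, hL.mid hl₂]
    have x : G₂.t r₁ = G₂.s (E.Ψ k₁ (S.Ψ q₁ p q₂ m m') k₂ n n') := by rw [E.s_Ψ, hK.t hk₁]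
    have x' : G₂.t (S.Ψ q₁ p q₂ m m') = G₂.s r₂ := by rw [hK.s hk₂, n']
    have y : G₂.t r₁ = G₂.s (S.Ψ v₁ p v₂ h h') := by rw [← e₁, S.t_Ψ, S.s_Ψ]
    -- Writing `p` as $1 \cdot p$ and as $p \cdot 1$ gives $r_1 \cdot \Psi(v_1, p, v_2) = \Psi(q_1,
    -- p, q_2) \cdot r_2$, the equation that also characterises `E.Ψ`; cancel $r_1$.
    have a := S.Ψ_μ q₁ _ v₁ p v₂ a₁ b₁ h h'
    have b := S.Ψ_μ q₁ p q₂ _ v₂ m m' a₂ b₂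
    simp only [unit_μ, e₁] at a
    simp only [μ_unit, e₂] at b
    rw [hL.Ψ p hl₁ hl₂ l l' m m' n n']
    exact G₂.μ_left_cancel (h := y) (h' := x)
      ((a.symm.trans b).trans (hK.Ψ _ hk₁ hk₂ n n' x x').symm)

end Unit

end BundleGerbe.Iso

end GerbeAction
end

noncomputable section
namespace GerbeAction

/-! ### Inverses and identities -/

lemma _root_.ContinuousAlternatingMap.apply_neg_one {V : Type*} [NormedAddCommGroup V]
    [NormedSpace ℝ V] (B : V [⋀^Fin 1]→L[ℝ] ℝ) (x : V) : B (fun _ => -x) = -B (fun _ => x) := by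
  have h := B.map_update_smul (fun _ => x) 0 (-1) x
  have e : ∀ z : V, Function.update (fun _ : Fin 1 => x) 0 z = fun _ => z := by
    intro z
    funext i
    rw [Subsingleton.elim i 0]
    simp
  rw [e, e] at h
  simpa using h

namespace U1Conn

variable (P : U1Conn.{u})

/-- The velocity of the inverse action. -/
lemma A_velocity_inv (p : P.tot) : (P.A (Circle.exp 0 • p) : P.tot.E [⋀^Fin 1]→L[ℝ] ℝ)
    (fun _ => dm (fun θ : ℝ => ((Circle.exp θ)⁻¹ • p : P.tot)) 0 1) = -1 := by
  have h1 : (fun θ : ℝ => ((Circle.exp θ)⁻¹ • p : P.tot)) =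
      fun θ => Circle.exp (-θ) • p := by
    funext θ
    rw [Circle.exp_neg]
  have h2 : SmAt (fun θ : ℝ => -θ) (0 : ℝ) := smAt_iff_contDiffAt.2 contDiffAt_id.neg
  have h3 := P.smAt_exp_smul (-0) p
  have h4 := dm_comp_apply (g := fun θ : ℝ => (Circle.exp θ • p : P.tot))
    (f := fun θ : ℝ => -θ) h3 h2 (1 : ℝ)
  have h5 : dm (fun θ : ℝ => -θ) (0 : ℝ) (1 : ℝ) = -1 := by
    rw [dm_eq_fderiv, fderiv_fun_neg]
    simp
  have h6 := P.A_velocity 0 p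
  rw [h1, h4, h5, map_neg, neg_zero]
  change (P.A (Circle.exp 0 • p) : P.tot.E [⋀^Fin 1]→L[ℝ] ℝ) (fun _ => -P.velocity 0 p) = -1
  exact (ContinuousAlternatingMap.apply_neg_one (V := P.tot.E) _ _).trans (congrArg Neg.neg h6)

/-- The conjugate bundle: the same total space with the inverse action. -/
def conj : U1Conn.{u} where
  tot := P.tot
  act :=
    { smul := fun c p => c⁻¹ • p
      one_smul := fun p => by change (1 : Circle)⁻¹ • p = p; simp
      mul_smul := fun c c' p => by
        change (c * c')⁻¹ • p = c⁻¹ • c'⁻¹ • p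
        rw [smul_smul, mul_inv] }
  smooth_act := P.smooth_act.comp ((contMDiff_fst.inv).prodMk contMDiff_snd)
  A := -P.A
  smooth_A := P.smooth_A.neg
  inv_A c := congrArg (fun B => -B) (P.inv_A c⁻¹)
  vert_A p := by
    have h := P.A_velocity_inv p
    have e : (Circle.exp 0)⁻¹ • p = Circle.exp 0 • p := by simp
    change -(P.A ((Circle.exp 0)⁻¹ • p) : P.tot.E [⋀^Fin 1]→L[ℝ] ℝ)
      (fun _ => dm (fun θ : ℝ => ((Circle.exp θ)⁻¹ • p : P.tot)) 0 1) = 1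
    rw [e, h, neg_neg]

end U1Conn

lemma IsPrincipal.conj {P : U1Conn.{u}} {r : P → P → Prop} (h : IsPrincipal P r) :
    IsPrincipal P.conj r where
  free c p hc := inv_eq_one.1 (h.free c⁻¹ p hc)
  orbit p p' := by
    have h1 : ∀ p p' : P, (∃ c : Circle, c • p = p') ↔ ∃ c : Circle, c⁻¹ • p = p' := fun p p' =>
      ⟨fun ⟨c, hc⟩ => ⟨c⁻¹, by rwa [inv_inv]⟩, fun ⟨c, hc⟩ => ⟨c⁻¹, hc⟩⟩
    exact (h.orbit p p').trans (h1 p p')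
  smooth_div T a b c ha hb hc := by
    have h1 := contMDiff_circle_inv (h.smooth_div T a b (fun τ => (c τ)⁻¹) ha hb hc)
    simpa using h1

lemma IsSurjSubmersionOnto.symm {X Y B N : Mfd.{u}} {f : X → B} {g : Y → B} {p : N → X}
    {q : N → Y} (h : IsSurjSubmersionOnto f g p q) : IsSurjSubmersionOnto g f q p where
  smooth_left := h.smooth_right
  smooth_right := h.smooth_left
  comm n := (h.comm n).symm
  surj x y e := (h.surj y x e.symm).imp fun _ hn => hn.symm
  subm n v w e := (h.subm n w v e.symm).imp fun _ hn => hn.symm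

namespace BundleGerbe.Iso

variable {M : Mfd.{u}} {G₁ G₂ : BundleGerbe M} (S : Iso G₁ G₂)

/-- The inverse of `Ψ` in its middle variable. -/
def invΨ (q₁ : S.Q) (p : G₂.P) (q₂ : S.Q) (h : S.η (S.pr q₁) = G₂.s p)
    (h' : S.η (S.pr q₂) = G₂.t p) : G₁.P := (S.exists_Ψ h h').choose

lemma s_invΨ (q₁ : S.Q) (p : G₂.P) (q₂ : S.Q) (h h') :
    G₁.s (S.invΨ q₁ p q₂ h h') = S.ζ (S.pr q₁) := (S.exists_Ψ h h').choose_spec.choose.symm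

lemma t_invΨ (q₁ : S.Q) (p : G₂.P) (q₂ : S.Q) (h h') :
    G₁.t (S.invΨ q₁ p q₂ h h') = S.ζ (S.pr q₂) :=
  (S.exists_Ψ h h').choose_spec.choose_spec.choose.symm

lemma Ψ_invΨ (q₁ : S.Q) (p : G₂.P) (q₂ : S.Q) (h h') (k k') :
    S.Ψ q₁ (S.invΨ q₁ p q₂ h h') q₂ k k' = p :=
  (S.exists_Ψ h h').choose_spec.choose_spec.choose_spec

lemma invΨ_smooth {T : Mfd.{u}} {q₁ q₂ : T → S.Q.tot} {p : T → G₂.P.tot}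
    (h : ∀ τ, S.η (S.pr (q₁ τ)) = G₂.s (p τ)) (h' : ∀ τ, S.η (S.pr (q₂ τ)) = G₂.t (p τ))
    (hq₁ : Smooth q₁) (hp : Smooth p) (hq₂ : Smooth q₂) :
    Smooth (Y := G₁.P.tot) fun τ => S.invΨ (q₁ τ) (p τ) (q₂ τ) (h τ) (h' τ) := by
  refine S.smooth_mid_of_Ψ (q₁ := q₁) (q₂ := q₂) (h := fun τ => (S.s_invΨ _ _ _ _ _).symm)
    (h' := fun τ => (S.t_invΨ _ _ _ _ _).symm) hq₁ hq₂ ?_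
  simpa only [Ψ_invΨ] using hp

/-- The phases on `q₁` and `q₂` are inverted because in the inverse isomorphism these points belong
to the conjugate bundle. -/
lemma invΨ_smul (c₁ c c₂ : Circle) (q₁ : S.Q) (p : G₂.P) (q₂ : S.Q) (h h')
    (h₁ : S.η (S.pr (c₁⁻¹ • q₁)) = G₂.s (c • p)) (h₁' : S.η (S.pr (c₂⁻¹ • q₂)) = G₂.t (c • p)) :
    S.invΨ (c₁⁻¹ • q₁) (c • p) (c₂⁻¹ • q₂) h₁ h₁' = (c₁⁻¹ * c * c₂) • S.invΨ q₁ p q₂ h h' := by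
  have k : S.ζ (S.pr (c₁⁻¹ • q₁)) = G₁.s ((c₁⁻¹ * c * c₂) • S.invΨ q₁ p q₂ h h') := by
    rw [G₁.s_smul, s_invΨ, S.pr_smul]
  have k' : S.ζ (S.pr (c₂⁻¹ • q₂)) = G₁.t ((c₁⁻¹ * c * c₂) • S.invΨ q₁ p q₂ h h') := by
    rw [G₁.t_smul, t_invΨ, S.pr_smul]
  refine S.Ψ_mid_cancel (h := (S.s_invΨ _ _ _ _ _).symm) (h' := (S.t_invΨ _ _ _ _ _).symm)
    (k := k) (k' := k') ?_
  rw [Ψ_invΨ, S.Ψ_smul _ _ _ _ _ _ (S.s_invΨ _ _ _ _ _).symm (S.t_invΨ _ _ _ _ _).symm,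
    Ψ_invΨ]
  congr 1
  rw [inv_inv, mul_assoc c₁⁻¹, mul_inv_cancel_left, mul_inv_cancel_right]

lemma invΨ_conn {T : Mfd.{u}} {q₁ q₂ : T → S.Q.tot} {p : T → G₂.P.tot}
    (h : ∀ τ, S.η (S.pr (q₁ τ)) = G₂.s (p τ)) (h' : ∀ τ, S.η (S.pr (q₂ τ)) = G₂.t (p τ))
    (hq₁ : Smooth q₁) (hp : Smooth p) (hq₂ : Smooth q₂) :
    G₂.P.A.pullback p + -S.Q.A.pullback q₂ = -S.Q.A.pullback q₁ +
      G₁.P.A.pullback (X := T) (fun τ => S.invΨ (q₁ τ) (p τ) (q₂ τ) (h τ) (h' τ)) := by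
  have e := S.Ψ_conn T q₁ _ q₂ (fun τ => (S.s_invΨ _ _ _ (h τ) (h' τ)).symm)
    (fun τ => (S.t_invΨ _ _ _ _ _).symm) hq₁ (S.invΨ_smooth h h' hq₁ hp hq₂) hq₂
  simp only [Ψ_invΨ] at e
  rw [← sub_eq_add_neg, sub_eq_iff_eq_add, add_assoc, e, neg_add_cancel_left]

/-- Apply the injective map `Ψ` to both sides and use its own compatibility with the
multiplications. -/
lemma invΨ_μ (q₁ : S.Q) (p₁₂ : G₂.P) (q₂ : S.Q) (p₂₃ : G₂.P) (q₃ : S.Q)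
    (h₁ : S.η (S.pr q₁) = G₂.s p₁₂) (h₂ : S.η (S.pr q₂) = G₂.t p₁₂)
    (h₂' : S.η (S.pr q₂) = G₂.s p₂₃) (h₃ : S.η (S.pr q₃) = G₂.t p₂₃) :
    S.invΨ q₁ (G₂.μ p₁₂ p₂₃ (h₂.symm.trans h₂')) q₃
        (h₁.trans (G₂.s_μ _ _ _).symm) (h₃.trans (G₂.t_μ _ _ _).symm) =
      G₁.μ (S.invΨ q₁ p₁₂ q₂ h₁ h₂) (S.invΨ q₂ p₂₃ q₃ h₂' h₃)
        ((S.t_invΨ _ _ _ _ _).trans (S.s_invΨ _ _ _ _ _).symm) := by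
  have k₁ : S.ζ (S.pr q₁) = G₁.s (S.invΨ q₁ p₁₂ q₂ h₁ h₂) := (S.s_invΨ _ _ _ _ _).symm
  have k₂ : S.ζ (S.pr q₂) = G₁.t (S.invΨ q₁ p₁₂ q₂ h₁ h₂) := (S.t_invΨ _ _ _ _ _).symm
  have k₃ : S.ζ (S.pr q₂) = G₁.s (S.invΨ q₂ p₂₃ q₃ h₂' h₃) := (S.s_invΨ _ _ _ _ _).symm
  have k₄ : S.ζ (S.pr q₃) = G₁.t (S.invΨ q₂ p₂₃ q₃ h₂' h₃) := (S.t_invΨ _ _ _ _ _).symm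
  refine S.Ψ_mid_cancel (q₁ := q₁) (q₂ := q₃) (h := (S.s_invΨ _ _ _ _ _).symm)
    (h' := (S.t_invΨ _ _ _ _ _).symm) (k := k₁.trans (G₁.s_μ _ _ _).symm)
    (k' := k₄.trans (G₁.t_μ _ _ _).symm) ?_
  rw [S.Ψ_μ _ _ _ _ _ k₁ k₂ k₃ k₄]
  simp only [Ψ_invΨ]

/-- The inverse isomorphism. -/
def inv : Iso G₂ G₁ where
  Z := S.Z
  ζ := S.η
  η := S.ζ
  ξ_subm := S.ξ_subm.symm
  Q := S.Q.conj
  pr := S.pr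
  pr_subm := S.pr_subm
  principal := S.principal.conj
  Ψ := S.invΨ
  s_Ψ := S.s_invΨ
  t_Ψ := S.t_invΨ
  Ψ_smul := S.invΨ_smul
  Ψ_smooth _ _ _ _ h h' h₁ ha h₂ := S.invΨ_smooth h h' h₁ ha h₂
  Ψ_conn _ _ _ _ h h' h₁ ha h₂ := S.invΨ_conn h h' h₁ ha h₂
  Ψ_μ := S.invΨ_μ

/-- An isomorphism composed with its inverse is the identity. -/
lemma IsCompRel.isTwoRel_inv {S : Iso G₁ G₂} {U E : Iso G₁ G₁} {L : S.Q → S.inv.Q → U.Q → Prop}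
    {K : G₁.P → E.Q → Prop} (hL : IsCompRel S S.inv U L) (hK : IsIdRel E K) :
    IsTwoRel U E (fun u k => ∃ (q q' : S.Q) (r : G₁.P), L q q' u ∧ K r k ∧
      ∃ h h', S.Ψ q r q' h h' = G₂.unit (S.η (S.pr q))) where
  ζ := by
    rintro u k ⟨q, q', r, hl, hk, h, h', e⟩
    rw [← hL.ζ hl, ← hK.s hk, h]
  η := by
    rintro u k ⟨q, q', r, hl, hk, h, h', e⟩
    rw [← hL.η hl, ← hK.t hk]
    exact h'
  lift X u z hu hz hζ hη := by
    obtain ⟨X₁, c₁, q, q', hc₁, hq, hq', hl⟩ : ∃ (X₁ : Mfd.{u}) (c₁ : X₁ → X)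
      (q q' : X₁ → S.Q.tot), IsSurjSubmersion c₁ ∧ Smooth q ∧ Smooth q' ∧
        ∀ τ, L (q τ) (q' τ) (u (c₁ τ)) := hL.exists_factor hu
    have hm : ∀ τ, S.η (S.pr (q τ)) = S.η (S.pr (q' τ)) := fun τ => hL.mid (hl τ)
    have hy := S.η_subm.smooth.comp (S.smooth_pr.comp hq)
    have he : Smooth (Y := G₂.P.tot) fun τ => G₂.unit (S.η (S.pr (q τ))) :=
      G₂.smooth_unit.comp hy
    have a : ∀ τ, S.η (S.pr (q τ)) = G₂.s (G₂.unit (S.η (S.pr (q τ)))) := fun τ => by simp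
    have a' : ∀ τ, S.η (S.pr (q' τ)) = G₂.t (G₂.unit (S.η (S.pr (q τ)))) := fun τ => by simp [hm]
    have hr := S.invΨ_smooth (q₁ := q) (q₂ := q') a a' hq he hq'
    have b : ∀ τ, S.ζ (S.pr (q τ)) = G₁.s (S.invΨ _ _ _ (a τ) (a' τ)) :=
      fun τ => (S.s_invΨ _ _ _ _ _).symm
    have b' : ∀ τ, S.ζ (S.pr (q' τ)) = G₁.t (S.invΨ _ _ _ (a τ) (a' τ)) :=
      fun τ => (S.t_invΨ _ _ _ _ _).symm
    obtain ⟨X₂, c₂, k, hc₂, hk, hkz, hkr, hA⟩ := hK.lift X₁ _ (fun τ => z (c₁ τ)) hr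
      (hz.comp hc₁.smooth) (fun τ => by rw [← b, ← hζ, hL.ζ (hl _)])
      (fun τ => by rw [← b', ← hη]; exact hL.η (hl _))
    have hc := hc₁.comp hc₂
    refine ⟨X₂, fun τ => c₁ (c₂ τ), k, hc, hk, hkz,
      fun τ => ⟨q (c₂ τ), q' (c₂ τ), _, hl _, hkr _, b _, b' _, S.Ψ_invΨ _ _ _ _ _ _ _⟩, ?_⟩
    have h := S.Ψ_conn X₁ q _ q' b b' hq hr hq'
    simp only [Ψ_invΨ] at h
    rw [← DForm.pullback_comp G₂.smooth_unit hy, A_unit] at h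
    have h2 := congrArg (DForm.pullback c₂) h
    rw [DForm.pullback_add, DForm.pullback_add, DForm.pullback_comp hr hc₂.smooth,
      DForm.pullback_comp hq hc₂.smooth, DForm.pullback_comp hq' hc₂.smooth] at h2
    rw [hA, hL.conn (q := fun τ => q (c₂ τ)) (q' := fun τ => q' (c₂ τ)) (hq.comp hc₂.smooth)
      (hq'.comp hc₂.smooth) (hu.comp hc.smooth) fun τ => hl _, eq_sub_of_add_eq h2]
    have alg : ∀ a b : DForm X₂ 1, a + 0 - b = a + -b := fun a b => by
      rw [add_zero, sub_eq_add_neg]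
    exact alg _ _
  Ψ := by
    rintro u₁ k₁ u₂ k₂ p ⟨q₁, q₁', r₁, hl₁, hk₁, a₁, b₁, e₁⟩ ⟨q₂, q₂', r₂, hl₂, hk₂, a₂, b₂, e₂⟩
      h h' l l'
    have m : S.ζ (S.pr q₁) = G₁.s p := (hL.ζ hl₁).trans l
    have m' : S.ζ (S.pr q₂) = G₁.t p := (hL.ζ hl₂).trans l'
    have n : S.η (S.pr q₁') = G₂.s (S.Ψ q₁ p q₂ m m') := by
      rw [S.s_Ψ]
      exact (hL.mid hl₁).symm
    have n' : S.η (S.pr q₂') = G₂.t (S.Ψ q₁ p q₂ m m') := by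
      rw [S.t_Ψ]
      exact (hL.mid hl₂).symm
    have x : G₁.t r₁ = G₁.s (E.Ψ k₁ p k₂ h h') := by rw [E.s_Ψ, hK.t hk₁]
    have x' : G₁.t p = G₁.s r₂ := by rw [hK.s hk₂, h']
    have c : S.ζ (S.pr q₁') = G₁.s (S.invΨ q₁' (S.Ψ q₁ p q₂ m m') q₂' n n') :=
      (S.s_invΨ _ _ _ _ _).symm
    have c' : S.ζ (S.pr q₂') = G₁.t (S.invΨ q₁' (S.Ψ q₁ p q₂ m m') q₂' n n') :=
      (S.t_invΨ _ _ _ _ _).symm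
    -- Since $r_i$ pairs $q_i$ with $q_i'$ to a unit, both $r_1 \cdot \Psi^{-1}(q_1', \Psi(q_1, p,
    -- q_2), q_2')$ and $p \cdot r_2$ are sent by $\Psi(q_1, -, q_2')$ to $\Psi(q_1, p, q_2)$.
    have a := S.Ψ_μ q₁ r₁ q₁' _ q₂' a₁ b₁ c c'
    have b := S.Ψ_μ q₁ p q₂ r₂ q₂' m m' a₂ b₂
    simp only [e₁, Ψ_invΨ, unit_μ] at a
    simp only [e₂, μ_unit] at b
    rw [hL.Ψ p hl₁ hl₂ l l' m m' n n']
    exact G₁.μ_left_cancel (h := x) (h' := b₁.symm.trans c)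
      ((hK.Ψ p hk₁ hk₂ h h' x x').trans (S.Ψ_mid_cancel (b.trans a.symm)))

end BundleGerbe.Iso

/-! ### Division in a gerbe and the identity isomorphism -/

namespace BundleGerbe

variable {M : Mfd.{u}} (G : BundleGerbe M)

/-- Division in a bundle gerbe: `P_(y₁, y₂)` and `P_(y₁, y₃)` give `P_(y₂, y₃)`. -/
def ldiv (p r : G.P) (h : G.s p = G.s r) : G.P := (G.exists_ldiv h).choose

lemma s_ldiv (p r : G.P) (h) : G.s (G.ldiv p r h) = G.t p :=
  (G.exists_ldiv h).choose_spec.choose.symm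

lemma μ_ldiv (p r : G.P) (h) (k) : G.μ p (G.ldiv p r h) k = r :=
  (G.exists_ldiv h).choose_spec.choose_spec

lemma t_ldiv (p r : G.P) (h) : G.t (G.ldiv p r h) = G.t r := by
  have := congrArg G.t (G.μ_ldiv p r h (G.s_ldiv p r h).symm)
  rwa [G.t_μ] at this

lemma eq_ldiv {p r x : G.P} (h) (k : G.t p = G.s x) (e : G.μ p x k = r) : x = G.ldiv p r h :=
  G.μ_left_cancel (e.trans (G.μ_ldiv p r h (G.s_ldiv p r h).symm).symm)

/-- The map `P_(y₁, y₂) ⊗ P_(y₂, y₂') → P_(y₁, y₁') ⊗ P_(y₁', y₂')` of the identity. -/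
def idΨ (r₁ p r₂ : G.P) (h : G.s r₁ = G.s p) (h' : G.s r₂ = G.t p) : G.P :=
  G.ldiv r₁ (G.μ p r₂ h'.symm) (h.trans (G.s_μ _ _ _).symm)

lemma s_idΨ (r₁ p r₂ : G.P) (h h') : G.s (G.idΨ r₁ p r₂ h h') = G.t r₁ := G.s_ldiv _ _ _

lemma t_idΨ (r₁ p r₂ : G.P) (h h') : G.t (G.idΨ r₁ p r₂ h h') = G.t r₂ :=
  (G.t_ldiv _ _ _).trans (G.t_μ _ _ _)

lemma μ_idΨ (r₁ p r₂ : G.P) (h h') (k) : G.μ r₁ (G.idΨ r₁ p r₂ h h') k = G.μ p r₂ h'.symm :=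
  G.μ_ldiv _ _ _ _

lemma eq_idΨ {r₁ p r₂ x : G.P} (h h') (k : G.t r₁ = G.s x)
    (e : G.μ r₁ x k = G.μ p r₂ h'.symm) : G.idΨ r₁ p r₂ h h' = x := (G.eq_ldiv _ k e).symm

lemma idΨ_smul (c₁ c c₂ : Circle) (r₁ p r₂ : G.P) (h h')
    (h₁ : G.s (c₁ • r₁) = G.s (c • p)) (h₁' : G.s (c₂ • r₂) = G.t (c • p)) :
    G.idΨ (c₁ • r₁) (c • p) (c₂ • r₂) h₁ h₁' = (c₁⁻¹ * c * c₂) • G.idΨ r₁ p r₂ h h' := by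
  have k : G.t r₁ = G.s (G.idΨ r₁ p r₂ h h') := (G.s_idΨ _ _ _ _ _).symm
  have k' : G.t (c₁ • r₁) = G.s ((c₁⁻¹ * c * c₂) • G.idΨ r₁ p r₂ h h') := by
    rwa [G.t_smul, G.s_smul]
  refine G.eq_idΨ _ _ k' ?_
  rw [G.μ_smul _ _ _ _ k, μ_idΨ, G.μ_smul _ _ _ _ h'.symm, mul_assoc c₁⁻¹, mul_inv_cancel_left]

lemma idΨ_smooth {T : Mfd.{u}} {r₁ p r₂ : T → G.P.tot} (h : ∀ τ, G.s (r₁ τ) = G.s (p τ))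
    (h' : ∀ τ, G.s (r₂ τ) = G.t (p τ)) (h₁ : Smooth r₁) (hp : Smooth p) (h₂ : Smooth r₂) :
    Smooth (Y := G.P.tot) fun τ => G.idΨ (r₁ τ) (p τ) (r₂ τ) (h τ) (h' τ) :=
  G.smooth_of_μ h₁ (G.μ_smooth T p r₂ (fun τ => (h' τ).symm) hp h₂)
    (fun _ => (G.s_idΨ _ _ _ _ _).symm) fun _ => G.μ_idΨ _ _ _ _ _ _

lemma idΨ_conn {T : Mfd.{u}} {r₁ p r₂ : T → G.P.tot} (h : ∀ τ, G.s (r₁ τ) = G.s (p τ))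
    (h' : ∀ τ, G.s (r₂ τ) = G.t (p τ)) (h₁ : Smooth r₁) (hp : Smooth p) (h₂ : Smooth r₂) :
    G.P.A.pullback p + G.P.A.pullback r₂ = G.P.A.pullback r₁ +
      G.P.A.pullback (X := T) fun τ => G.idΨ (r₁ τ) (p τ) (r₂ τ) (h τ) (h' τ) := by
  have e := G.μ_conn T r₁ _ (fun _ => (G.s_idΨ _ _ _ _ _).symm) h₁ (G.idΨ_smooth h h' h₁ hp h₂)
  simp only [μ_idΨ] at e
  rwa [G.μ_conn T p r₂ _ hp h₂] at e

/-- Multiplied by $r_1$ on the left, both sides become $p_{12} p_{23} r_3$ by associativity and the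
defining property of `idΨ`. -/
lemma idΨ_μ (r₁ p₁₂ r₂ p₂₃ r₃ : G.P) (h₁ : G.s r₁ = G.s p₁₂) (h₂ : G.s r₂ = G.t p₁₂)
    (h₂' : G.s r₂ = G.s p₂₃) (h₃ : G.s r₃ = G.t p₂₃) :
    G.idΨ r₁ (G.μ p₁₂ p₂₃ (h₂.symm.trans h₂')) r₃ (h₁.trans (G.s_μ _ _ _).symm)
        (h₃.trans (G.t_μ _ _ _).symm) =
      G.μ (G.idΨ r₁ p₁₂ r₂ h₁ h₂) (G.idΨ r₂ p₂₃ r₃ h₂' h₃)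
        ((G.t_idΨ _ _ _ _ _).trans (G.s_idΨ _ _ _ _ _).symm) := by
  have k₁ : G.t r₁ = G.s (G.idΨ r₁ p₁₂ r₂ h₁ h₂) := (G.s_idΨ _ _ _ _ _).symm
  have k₂ : G.t r₂ = G.s (G.idΨ r₂ p₂₃ r₃ h₂' h₃) := (G.s_idΨ _ _ _ _ _).symm
  have k₃ : G.t (G.idΨ r₁ p₁₂ r₂ h₁ h₂) = G.s (G.idΨ r₂ p₂₃ r₃ h₂' h₃) :=
    (G.t_idΨ _ _ _ _ _).trans k₂
  refine G.eq_idΨ _ _ (k₁.trans (G.s_μ _ _ k₃).symm) ?_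
  rw [← G.μ_assoc _ _ _ k₁ k₃]
  simp only [μ_idΨ]
  rw [G.μ_assoc _ _ _ h₂.symm k₂]
  simp only [μ_idΨ]
  rw [G.μ_assoc]

/-- The identity isomorphism of a bundle gerbe. -/
def idIso : Iso G G where
  Z := Mfd.fibProd G.π G.π G.π_subm.isSubm G.π_subm.smooth
  ζ := FibProd.fst _ _
  η := FibProd.snd _ _
  ξ_subm :=
    { smooth_left := FibProd.smooth_fst _ _
      smooth_right := FibProd.smooth_snd _ _
      comm := FibProd.comm _ _
      surj := fun x y h => ⟨FibProd.mk _ _ x y h, rfl, rfl⟩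
      subm := fun n v w h => FibProd.exists_tangent _ _ n v w h }
  Q := G.P
  pr := FibProd.pair G.π_subm.isSubm G.π_subm.smooth G.s G.t G.π_s
  pr_subm := G.proj.surjSubmersion_pair G.π_subm.isSubm G.π_subm.smooth
  principal :=
    { free := G.principal.free
      orbit := fun p p' => Iff.trans ⟨fun h =>
        ⟨congrArg (FibProd.fst G.π_subm.isSubm G.π_subm.smooth) h,
          congrArg (FibProd.snd G.π_subm.isSubm G.π_subm.smooth) h⟩,
        fun h => FibProd.ext G.π_subm.isSubm G.π_subm.smooth h.1 h.2⟩ (G.principal.orbit p p')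
      smooth_div := G.principal.smooth_div }
  Ψ := G.idΨ
  s_Ψ := G.s_idΨ
  t_Ψ := G.t_idΨ
  Ψ_smul := G.idΨ_smul
  Ψ_smooth _ _ _ _ h h' h₁ hp h₂ := G.idΨ_smooth h h' h₁ hp h₂
  Ψ_conn _ _ _ _ h h' h₁ hp h₂ := G.idΨ_conn h h' h₁ hp h₂
  Ψ_μ := G.idΨ_μ

/-- The 2-isomorphism from the identity to itself. -/
lemma nonempty_idIso :
    Nonempty (Iso.IdIso (S := (G.idIso : Iso G (G.pullback (Diffeomorph.refl M.I M ∞))))) :=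
  ⟨{W := G.idIso.Z
    w := fun x => x
    w_subm := IsSurjSubmersion.id _
    β := fun _ r _ _ => r
    pr_β := fun _ _ h h' => FibProd.ext G.π_subm.isSubm G.π_subm.smooth h h'
    β_smul := fun _ _ _ _ _ _ _ => rfl
    β_smooth := fun _ _ _ _ _ _ ha => ha
    β_conn := fun _ _ _ _ _ _ _ => rfl
    β_Ψ := fun _ _ r₁ p r₂ _ _ _ _ k₁ k₂ l _ => G.μ_idΨ r₁ p r₂ k₁ k₂ l }⟩

end BundleGerbe

end GerbeAction
end

noncomputable section
namespace GerbeAction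

/-! ### Composites -/

/-- The product of the circle with a manifold. -/
def Mfd.circleProd (X : Mfd.{u}) : Mfd.{u} where
  carrier := Circle × X
  E := EuclideanSpace ℝ (Fin 1) × X.E
  charted := prodChartedSpace (EuclideanSpace ℝ (Fin 1)) Circle X.E X
  mfd := by
    have h : IsManifold ((𝓡 1).prod X.I) ∞ (Circle × X) := inferInstance
    rwa [← modelWithCornersSelf_prod] at h

/-- Passes between the product model, used for group actions, and the single model of an `Mfd`, for
which the fibre product criterion `smooth_of_components` is stated. -/
lemma smooth_circleProd_iff {X Y : Mfd.{u}} {f : Circle × X → Y} :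
    Smooth (X := X.circleProd) f ↔ ContMDiff ((𝓡 1).prod X.I) Y.I ∞ f := by
  have h : X.circleProd.I = (𝓡 1).prod X.I := modelWithCornersSelf_prod
  unfold Smooth
  rw [h]
  rfl

namespace BundleGerbe.Iso

variable {M : Mfd.{u}} {G₁ G₂ G₃ : BundleGerbe M} (S : Iso G₁ G₂) (S' : Iso G₂ G₃)

lemma isSubm_η_pr : IsSubm (fun q : S.Q.tot => S.η (S.pr q)) :=
  (S.η_subm.comp S.pr_subm).isSubm

lemma smooth_ζ_pr : Smooth (fun q : S.Q.tot => S.ζ (S.pr q)) :=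
  (S.ζ_subm.comp S.pr_subm).smooth

/-- The total space `Q ×_{Y₂} Q'` of the bundle of a composite, over `Z ×_{Y₂} Q'`. -/
abbrev compTot : Mfd.{u} :=
  Mfd.fibProd (fun q : S.Q.tot => S.η (S.pr q)) (fun q : S'.Q.tot => S'.ζ (S'.pr q))
    S.isSubm_η_pr S'.smooth_ζ_pr

/-- The first component. -/
abbrev compFst : compTot S S' → S.Q.tot := FibProd.fst S.isSubm_η_pr S'.smooth_ζ_pr

/-- The second component. -/
abbrev compSnd : compTot S S' → S'.Q.tot := FibProd.snd S.isSubm_η_pr S'.smooth_ζ_pr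

lemma comp_comm (x : compTot S S') :
    S.η (S.pr (compFst S S' x)) = S'.ζ (S'.pr (compSnd S S' x)) := FibProd.comm _ _ x

lemma smooth_compFst : Smooth (compFst S S') := FibProd.smooth_fst _ _

lemma smooth_compSnd : Smooth (compSnd S S') := FibProd.smooth_snd _ _

/-- The circle acts on the first component. -/
def compSmul (c : Circle) (x : compTot S S') : compTot S S' :=
  FibProd.mk S.isSubm_η_pr S'.smooth_ζ_pr (c • compFst S S' x : S.Q) (compSnd S S' x)
    (by rw [S.pr_smul]; exact comp_comm S S' x)

lemma smooth_compSmul : ContMDiff ((𝓡 1).prod (compTot S S').I) (compTot S S').I ∞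
    (fun x : Circle × compTot S S' => compSmul S S' x.1 x.2) := by
  refine smooth_circleProd_iff.1 (FibProd.smooth_of_components _ _ ?_ ?_)
  · refine smooth_circleProd_iff.2 ?_
    exact S.Q.smooth_act.comp (contMDiff_fst.prodMk ((ContMDiff.comp (smooth_compFst S S') contMDiff_snd)))
  · refine smooth_circleProd_iff.2 ?_
    have h : ContMDiff ((𝓡 1).prod (compTot S S').I) S'.Q.tot.I ∞
        (fun x : Circle × compTot S S' => compSnd S S' x.2) :=
      (show ContMDiff (compTot S S').I S'.Q.tot.I ∞ (compSnd S S') from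
        smooth_compSnd S S').comp contMDiff_snd
    exact h

lemma smooth_compSmul_const (c : Circle) : Smooth (compSmul S S' c) :=
  (smooth_compSmul S S').comp (contMDiff_const.prodMk contMDiff_id)

/-- The connection form of a composite. -/
def compA : DForm (compTot S S') 1 :=
  S.Q.A.pullback (compFst S S') + S'.Q.A.pullback (compSnd S S')

lemma compA_pullback {T : Mfd.{u}} {x : T → compTot S S'} (hx : Smooth x) :
    (compA S S').pullback x = S.Q.A.pullback (fun τ => compFst S S' (x τ)) +
      S'.Q.A.pullback (fun τ => compSnd S S' (x τ)) := by
  rw [compA, DForm.pullback_add, DForm.pullback_comp (smooth_compFst S S') hx,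
    DForm.pullback_comp (smooth_compSnd S S') hx]

/-- The bundle `Q ⊗ Q'` of a composite. -/
def compQ : U1Conn.{u} where
  tot := compTot S S'
  act :=
    { smul := compSmul S S'
      one_smul := fun x => FibProd.ext _ _ (one_smul Circle (compFst S S' x : S.Q)) rfl
      mul_smul := fun c c' x =>
        FibProd.ext _ _ (mul_smul c c' (compFst S S' x : S.Q)) rfl }
  smooth_act := smooth_compSmul S S'
  A := compA S S'
  smooth_A := (S.Q.smooth_A.pullback (smooth_compFst S S')).add
    (S'.Q.smooth_A.pullback (smooth_compSnd S S'))
  inv_A c := by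
    refine (compA_pullback S S' (smooth_compSmul_const S S' c)).trans ?_
    have h := DForm.pullback_comp (S.Q.smooth_const_smul c) (smooth_compFst S S') S.Q.A
    rw [S.Q.inv_A] at h
    exact congrArg (· + _) h.symm
  vert_A x := by
    have hx : ContMDiff 𝓘(ℝ, ℝ) (compTot S S').I ∞
        (fun θ : ℝ => compSmul S S' (Circle.exp θ) x) :=
      (smooth_compSmul S S').comp (contMDiff_circleExp.prodMk contMDiff_const)
    have h₁ := dm_comp_apply (g := compFst S S')
      (f := fun θ : ℝ => compSmul S S' (Circle.exp θ) x) (x := (0 : ℝ))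
      ((smooth_compFst S S').smAt _) hx.contMDiffAt (1 : ℝ)
    have h₂ := dm_comp_apply (g := compSnd S S')
      (f := fun θ : ℝ => compSmul S S' (Circle.exp θ) x) (x := (0 : ℝ))
      ((smooth_compSnd S S').smAt _) hx.contMDiffAt (1 : ℝ)
    have e₁ := S.Q.A_velocity 0 (compFst S S' x)
    have h₃ : dm (fun θ : ℝ => compSnd S S' (compSmul S S' (Circle.exp θ) x)) (0 : ℝ) (1 : ℝ) =
        0 := by
      change dm (fun _ : ℝ => compSnd S S' x) (0 : ℝ) (1 : ℝ) = 0
      rw [dm_const]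
      rfl
    have e₂ : ∀ B : S'.Q.tot.E [⋀^Fin 1]→L[ℝ] ℝ, B (fun _ => dm (compSnd S S')
        (compSmul S S' (Circle.exp 0) x) (dm (fun θ : ℝ => compSmul S S' (Circle.exp θ) x)
          (0 : ℝ) (1 : ℝ))) = 0 := fun B => by
      rw [← h₂, h₃]
      exact B.map_coord_zero 0 rfl
    have e₃ : (S.Q.A (Circle.exp 0 • compFst S S' x) : S.Q.tot.E [⋀^Fin 1]→L[ℝ] ℝ)
        (fun _ => dm (compFst S S') (compSmul S S' (Circle.exp 0) x)
          (dm (fun θ : ℝ => compSmul S S' (Circle.exp θ) x) (0 : ℝ) (1 : ℝ))) = 1 := by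
      rw [← h₁]
      exact e₁
    exact (congrArg₂ (· + ·) e₃ (e₂ _)).trans (add_zero _)

/-- The base `Z ×_{Y₂} Q'`. -/
abbrev compZ : Mfd.{u} :=
  Mfd.fibProd S.η (fun q : S'.Q.tot => S'.ζ (S'.pr q)) S.η_subm.isSubm S'.smooth_ζ_pr

/-- The projection `Q ×_{Y₂} Q' → Z ×_{Y₂} Q'`. -/
def compPr : compTot S S' → compZ S S' :=
  FibProd.pair S.η_subm.isSubm S'.smooth_ζ_pr (fun x => S.pr (compFst S S' x)) (compSnd S S')
    (comp_comm S S')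

lemma compPr_eq {x x' : compTot S S'} : compPr S S' x = compPr S S' x' ↔
    S.pr (compFst S S' x) = S.pr (compFst S S' x') ∧ compSnd S S' x = compSnd S S' x' :=
  ⟨fun h => ⟨congrArg (FibProd.fst S.η_subm.isSubm S'.smooth_ζ_pr) h,
    congrArg (FibProd.snd S.η_subm.isSubm S'.smooth_ζ_pr) h⟩, fun h => FibProd.ext _ _ h.1 h.2⟩

lemma smooth_pr_compFst : Smooth fun x : compTot S S' => S.pr (compFst S S' x) :=
  S.smooth_pr.comp (smooth_compFst S S')

lemma compPr_subm : IsSurjSubmersion (compPr S S') where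
  smooth := FibProd.smooth_pair _ _ _ (smooth_pr_compFst S S') (smooth_compSnd S S')
  surj z := by
    obtain ⟨q, hq⟩ := S.pr_subm.surj (FibProd.fst _ _ z)
    refine ⟨FibProd.mk S.isSubm_η_pr S'.smooth_ζ_pr q (FibProd.snd _ _ z) ?_,
      FibProd.ext _ _ hq rfl⟩
    rw [hq]
    exact FibProd.comm S.η_subm.isSubm S'.smooth_ζ_pr z
  subm x ν := by
    obtain ⟨v, hv⟩ := S.pr_subm.subm (compFst S S' x)
      (dm (FibProd.fst S.η_subm.isSubm S'.smooth_ζ_pr) (compPr S S' x) ν)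
    have h1 := dm_eq_of_comm S.η_subm.smooth S'.smooth_ζ_pr
      (FibProd.smooth_fst S.η_subm.isSubm S'.smooth_ζ_pr)
      (FibProd.smooth_snd S.η_subm.isSubm S'.smooth_ζ_pr)
      (FibProd.comm S.η_subm.isSubm S'.smooth_ζ_pr) (compPr S S' x) ν
    have h2 : dm (fun q : S.Q.tot => S.η (S.pr q)) (compFst S S' x) v =
        dm S.η (S.pr (compFst S S' x))
          (dm (FibProd.fst S.η_subm.isSubm S'.smooth_ζ_pr) (compPr S S' x) ν) :=
      (dm_comp_apply (S.η_subm.smooth.smAt _) (S.smooth_pr.smAt _) v).trans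
        (congrArg (dm S.η (S.pr (compFst S S' x))) hv)
    obtain ⟨μ, h3, h4⟩ := FibProd.exists_tangent S.isSubm_η_pr S'.smooth_ζ_pr x v
      (dm (FibProd.snd S.η_subm.isSubm S'.smooth_ζ_pr) (compPr S S' x) ν) (h2.trans h1)
    refine ⟨μ, FibProd.dm_injective S.η_subm.isSubm S'.smooth_ζ_pr (compPr S S' x) ?_ ?_⟩
    · refine (FibProd.dm_fst_pair S.η_subm.isSubm S'.smooth_ζ_pr (comp_comm S S') (smooth_pr_compFst S S')
        (smooth_compSnd S S') x μ).trans ?_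
      refine (dm_comp_apply (S.smooth_pr.smAt _) ((smooth_compFst S S').smAt _) μ).trans ?_
      exact (congrArg (dm S.pr (compFst S S' x)) h3).trans hv
    · exact (FibProd.dm_snd_pair S.η_subm.isSubm S'.smooth_ζ_pr (comp_comm S S') (smooth_pr_compFst S S')
        (smooth_compSnd S S') x μ).trans h4

/-- The base $Z \times_{Y_2} \mathcal Q'$ remembers the second component, so the fibres are circle
orbits in the first factor and principality reduces to that of $\mathcal Q$. -/
lemma isPrincipal_compQ :
    IsPrincipal (compQ S S') (fun x x' : compTot S S' => compPr S S' x = compPr S S' x') where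
  free c x h := S.principal.free c _ (congrArg (compFst S S') h)
  orbit x x' := by
    refine (compPr_eq S S').trans ⟨fun ⟨h, h'⟩ => ?_, ?_⟩
    · obtain ⟨c, hc⟩ := S.exists_smul h
      exact ⟨c, FibProd.ext _ _ hc h'⟩
    · rintro ⟨c, rfl⟩
      exact ⟨(S.pr_smul c (compFst S S' x)).symm, rfl⟩
  smooth_div T a b c ha hb h := S.principal.smooth_div T (fun τ => compFst S S' (a τ))
    (fun τ => compFst S S' (b τ)) c ((smooth_compFst S S').comp ha)
    ((smooth_compFst S S').comp hb) fun τ => congrArg (compFst S S') (h τ)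

/-- Points and tangent vectors of $Y_1 \times_M Y_3$ are lifted by inserting an intermediate one in
$Y_2$ over the same point or vector of `M`. -/
lemma compξ_subm : IsSurjSubmersionOnto G₁.π G₃.π
    (fun z : compZ S S' => S.ζ (FibProd.fst _ _ z))
    (fun z : compZ S S' => S'.η (S'.pr (FibProd.snd _ _ z))) where
  smooth_left := S.ζ_subm.smooth.comp (FibProd.smooth_fst _ _)
  smooth_right := (S'.η_subm.comp S'.pr_subm).smooth.comp (FibProd.smooth_snd _ _)
  comm z := by
    rw [S.π_η, FibProd.comm S.η_subm.isSubm S'.smooth_ζ_pr, S'.π_η]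
  surj y₁ y₃ h := by
    obtain ⟨q, h1, h2⟩ := S.exists_fiber (G₂.π_subm.surj (G₁.π y₁)).choose_spec.symm
    obtain ⟨q', h3, h4⟩ := S'.exists_fiber (y₂ := y₃)
      ((G₂.π_subm.surj (G₁.π y₁)).choose_spec.trans h)
    exact ⟨FibProd.mk S.η_subm.isSubm S'.smooth_ζ_pr (S.pr q) q' (h2.trans h3.symm), h1, h4⟩
  subm n v w h := by
    have hn := FibProd.comm S.η_subm.isSubm S'.smooth_ζ_pr n
    obtain ⟨x, hx⟩ := G₂.π_subm.subm (S.η (FibProd.fst _ _ n))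
      (dm G₁.π (S.ζ (FibProd.fst _ _ n)) v)
    obtain ⟨ν, hν, hν'⟩ := S.ξ_subm.subm (FibProd.fst _ _ n) v x hx.symm
    have hx' : dm G₂.π (S.η (FibProd.fst _ _ n)) x =
        dm G₃.π (S'.η (S'.pr (FibProd.snd _ _ n))) w := hx.trans h
    rw [hn] at hx'
    obtain ⟨ν', h1, h2⟩ := S'.ξ_subm.subm (S'.pr (FibProd.snd _ _ n)) x w hx'
    obtain ⟨ρ, hρ⟩ := S'.pr_subm.subm (FibProd.snd _ _ n) ν'
    have h3 : dm (fun q : S'.Q.tot => S'.ζ (S'.pr q)) (FibProd.snd _ _ n) ρ = x :=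
      (dm_comp_apply (S'.ζ_subm.smooth.smAt _) (S'.smooth_pr.smAt _) ρ).trans
        ((congrArg (dm S'.ζ (S'.pr (FibProd.snd _ _ n))) hρ).trans h1)
    obtain ⟨μ, h4, h5⟩ := FibProd.exists_tangent S.η_subm.isSubm S'.smooth_ζ_pr n ν ρ
      (hν'.trans h3.symm)
    refine ⟨μ, ?_, ?_⟩
    · exact (dm_comp_apply (S.ζ_subm.smooth.smAt _) ((FibProd.smooth_fst _ _).smAt _) μ).trans
        ((congrArg (dm S.ζ (FibProd.fst _ _ n)) h4).trans hν)
    · refine (dm_comp_apply ((S'.η_subm.comp S'.pr_subm).smooth.smAt _)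
        ((FibProd.smooth_snd _ _).smAt _) μ).trans ?_
      rw [h5]
      exact (dm_comp_apply (S'.η_subm.smooth.smAt _) (S'.smooth_pr.smAt _) ρ).trans
        ((congrArg (dm S'.η (S'.pr (FibProd.snd _ _ n))) hρ).trans h2)

/-- The isomorphism `P₁ ⊗ Q ⊗ Q' → Q ⊗ Q' ⊗ P₃` of a composite. -/
def compΨ (x₁ : compTot S S') (p : G₁.P) (x₂ : compTot S S')
    (h : S.ζ (S.pr (compFst S S' x₁)) = G₁.s p) (h' : S.ζ (S.pr (compFst S S' x₂)) = G₁.t p) :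
    G₃.P :=
  S'.Ψ (compSnd S S' x₁) (S.Ψ (compFst S S' x₁) p (compFst S S' x₂) h h') (compSnd S S' x₂)
    (by rw [S.s_Ψ]; exact (comp_comm S S' x₁).symm) (by rw [S.t_Ψ]; exact (comp_comm S S' x₂).symm)

lemma compΨ_μ (x₁ : compTot S S') (p₁₂ : G₁.P) (x₂ : compTot S S') (p₂₃ : G₁.P)
    (x₃ : compTot S S') (h₁ : S.ζ (S.pr (compFst S S' x₁)) = G₁.s p₁₂)
    (h₂ : S.ζ (S.pr (compFst S S' x₂)) = G₁.t p₁₂) (h₂' : S.ζ (S.pr (compFst S S' x₂)) = G₁.s p₂₃)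
    (h₃ : S.ζ (S.pr (compFst S S' x₃)) = G₁.t p₂₃) :
    compΨ S S' x₁ (G₁.μ p₁₂ p₂₃ (h₂.symm.trans h₂')) x₃ (h₁.trans (G₁.s_μ _ _ _).symm)
        (h₃.trans (G₁.t_μ _ _ _).symm) =
      G₃.μ (compΨ S S' x₁ p₁₂ x₂ h₁ h₂) (compΨ S S' x₂ p₂₃ x₃ h₂' h₃)
        ((S'.t_Ψ _ _ _ _ _).trans (S'.s_Ψ _ _ _ _ _).symm) := by
  unfold compΨ
  simp only [S.Ψ_μ _ _ _ _ _ h₁ h₂ h₂' h₃]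
  rw [S'.Ψ_μ]

/-- The composite of two isomorphisms. -/
def comp : Iso G₁ G₃ where
  Z := compZ S S'
  ζ z := S.ζ (FibProd.fst _ _ z)
  η z := S'.η (S'.pr (FibProd.snd _ _ z))
  ξ_subm := compξ_subm S S'
  Q := compQ S S'
  pr := compPr S S'
  pr_subm := compPr_subm S S'
  principal := isPrincipal_compQ S S'
  Ψ := compΨ S S'
  s_Ψ _ _ _ _ _ := S'.s_Ψ _ _ _ _ _
  t_Ψ _ _ _ _ _ := S'.t_Ψ _ _ _ _ _
  Ψ_smul c₁ c c₂ x₁ p x₂ h h' h₁ h₁' := by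
    have e := S.Ψ_smul c₁ c c₂ (compFst S S' x₁) p (compFst S S' x₂) h h' h₁ h₁'
    change S'.Ψ (compSnd S S' x₁) (S.Ψ (c₁ • (compFst S S' x₁ : S.Q)) (c • p)
      (c₂ • (compFst S S' x₂ : S.Q)) h₁ h₁') (compSnd S S' x₂) _ _ = _
    simp only [e]
    exact S'.Ψ_smul_mid _ _ _ _ _ _ _ _
  Ψ_smooth T x₁ p x₂ h h' h₁ hp h₂ := S'.Ψ_smooth T _ _ _ _ _ ((smooth_compSnd S S').comp h₁)
    (S.Ψ_smooth T _ _ _ h h' ((smooth_compFst S S').comp h₁) hp ((smooth_compFst S S').comp h₂))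
    ((smooth_compSnd S S').comp h₂)
  Ψ_conn T x₁ p x₂ h h' h₁ hp h₂ := by
    have e := S.Ψ_conn T _ _ _ h h' ((smooth_compFst S S').comp h₁) hp
      ((smooth_compFst S S').comp h₂)
    have e' := S'.Ψ_conn T _ _ _ (fun τ => (comp_comm S S' (x₁ τ)).symm.trans (S.s_Ψ _ _ _ _ _).symm)
      (fun τ => (comp_comm S S' (x₂ τ)).symm.trans (S.t_Ψ _ _ _ _ _).symm) ((smooth_compSnd S S').comp h₁)
      (S.Ψ_smooth T _ _ _ h h' ((smooth_compFst S S').comp h₁) hp ((smooth_compFst S S').comp h₂))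
      ((smooth_compSnd S S').comp h₂)
    refine (congrArg (_ + ·) (compA_pullback S S' h₂)).trans
      (Eq.trans ?_ (congrArg (· + _) (compA_pullback S S' h₁)).symm)
    rw [← add_assoc]
    refine (congrArg (· + _) e).trans ?_
    rw [add_assoc, add_assoc]
    exact congrArg (_ + ·) e'
  Ψ_μ := compΨ_μ S S'

variable {S S'} in
-- The analogue of `Ψ_eq_of_unit` for the two-step map: the condition at the units says that $q_i
-- \otimes q_i'$ and $a_i \otimes a_i'$ are the same element of the tensor product.
lemma compΨ_eq {q₁ q₂ a₁ a₂ : S.Q} {q₁' q₂' a₁' a₂' : S'.Q} {p : G₁.P} {y₁ y₂ : G₁.Y}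
    {x₁ x₂ : G₃.Y} {h₁ h₂ k₁ k₂ h₁' h₂' k₁' k₂'}
    (e₁ : S'.Ψ q₁' (S.Ψ q₁ (G₁.unit y₁) a₁ h₁ k₁) a₁' h₁' k₁' = G₃.unit x₁)
    (e₂ : S'.Ψ q₂' (S.Ψ q₂ (G₁.unit y₂) a₂ h₂ k₂) a₂' h₂' k₂' = G₃.unit x₂) (h h' k k' l l' m m') :
    S'.Ψ a₁' (S.Ψ a₁ p a₂ h h') a₂' l l' = S'.Ψ q₁' (S.Ψ q₁ p q₂ k k') q₂' m m' := by
  have a := S.Ψ_μ q₁ (G₁.unit y₁) a₁ p a₂ h₁ k₁ h h'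
  have b := S.Ψ_μ q₁ p q₂ (G₁.unit y₂) a₂ k k' h₂ k₂
  simp only [unit_μ] at a
  simp only [μ_unit] at b
  have a' := S'.Ψ_μ q₁' _ a₁' _ a₂' h₁' k₁' l l'
  have b' := S'.Ψ_μ q₁' _ q₂' _ a₂' m m' h₂' k₂'
  simp only [e₁, unit_μ, ← a] at a'
  simp only [e₂, μ_unit, ← b] at b'
  exact a'.symm.trans b'

variable {S S'} in
-- Normalizes $q \otimes q'$ to have the prescribed second factor $a'$: the discrepancy between $q'$
-- and $a'$ is an element of $\mathcal P_2$ given by `invΨ`, and transporting $q$ along it gives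
-- `a`.
lemma exists_comp_smooth {T : Mfd.{u}} {q : T → S.Q.tot} {q' a' : T → S'.Q.tot} {z : T → S.Z}
    (hq : Smooth q) (hq' : Smooth q') (ha' : Smooth a') (hz : Smooth z)
    (hζ : ∀ τ, S.ζ (S.pr (q τ)) = S.ζ (z τ)) (hm : ∀ τ, S.η (S.pr (q τ)) = S'.ζ (S'.pr (q' τ)))
    (hm' : ∀ τ, S.η (z τ) = S'.ζ (S'.pr (a' τ)))
    (hη : ∀ τ, S'.η (S'.pr (q' τ)) = S'.η (S'.pr (a' τ))) :
    ∃ a : T → S.Q.tot, Smooth a ∧ (∀ τ, S.pr (a τ) = z τ) ∧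
      (∀ τ, ∃ h h' k k', S'.Ψ (q' τ) (S.Ψ (q τ) (G₁.unit (S.ζ (S.pr (q τ)))) (a τ) h h') (a' τ)
        k k' = G₃.unit (S'.η (S'.pr (q' τ)))) ∧
      S.Q.A.pullback a + S'.Q.A.pullback a' = S.Q.A.pullback q + S'.Q.A.pullback q' := by
  have hy := S.ζ_subm.smooth.comp (S.smooth_pr.comp hq)
  have hx := S'.η_subm.smooth.comp (S'.smooth_pr.comp hq')
  have k : ∀ τ, S'.η (S'.pr (q' τ)) = G₃.s (G₃.unit (S'.η (S'.pr (q' τ)))) := fun τ => by simp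
  have k' : ∀ τ, S'.η (S'.pr (a' τ)) = G₃.t (G₃.unit (S'.η (S'.pr (q' τ)))) :=
    fun τ => by simp [hη]
  have he : Smooth (Y := G₃.P.tot) fun τ => G₃.unit (S'.η (S'.pr (q' τ))) :=
    G₃.smooth_unit.comp hx
  have hr := S'.invΨ_smooth k k' hq' he ha'
  have l : ∀ τ, S'.ζ (S'.pr (q' τ)) = G₂.s (S'.invΨ _ _ _ (k τ) (k' τ)) :=
    fun τ => (S'.s_invΨ _ _ _ _ _).symm
  have l' : ∀ τ, S'.ζ (S'.pr (a' τ)) = G₂.t (S'.invΨ _ _ _ (k τ) (k' τ)) :=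
    fun τ => (S'.t_invΨ _ _ _ _ _).symm
  obtain ⟨a, ha, haz, m, e⟩ := S.exists_Ψ_right_smooth (z := z) hq (G₁.smooth_unit.comp hy) hr hz
    (fun τ => by simp) (fun τ => by simp [hζ]) (fun τ => (hm τ).trans (l τ))
    (fun τ => (hm' τ).trans (l' τ))
  have e' : ∀ τ h h', S'.Ψ (q' τ) (S.Ψ (q τ) (G₁.unit (S.ζ (S.pr (q τ)))) (a τ) (by simp) (m τ))
      (a' τ) h h' = G₃.unit (S'.η (S'.pr (q' τ))) := fun τ h h' => by
    simp only [e]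
    exact S'.Ψ_invΨ _ _ _ _ _ _ _
  refine ⟨a, ha, haz, fun τ => ⟨_, m τ, by rw [e]; exact l τ, by rw [e]; exact l' τ, e' τ _ _⟩, ?_⟩
  have h₁ := S.Ψ_conn T q _ a (fun τ => by simp) m hq (G₁.smooth_unit.comp hy) ha
  have h₂ := S'.Ψ_conn T q' _ a' l l' hq' hr ha'
  simp only [e] at h₁
  simp only [Ψ_invΨ] at h₂
  rw [← DForm.pullback_comp G₁.smooth_unit hy, A_unit] at h₁
  rw [← DForm.pullback_comp G₃.smooth_unit hx, A_unit] at h₂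
  have alg : ∀ a a' q q' r : DForm T 1, 0 + a = q + r → r + a' = q' + 0 → a + a' = q + q' := by
    intro a a' q q' r h h'
    rw [zero_add] at h
    rw [add_zero] at h'
    rw [h, add_assoc, h']
  exact alg _ _ _ _ _ h₁ h₂

/-- The 2-isomorphism from the composite to itself. -/
lemma isCompRel_comp : IsCompRel S S' (S.comp S') (fun q q' x => ∃ h h' k k',
    S'.Ψ q' (S.Ψ q (G₁.unit (S.ζ (S.pr q))) (compFst S S' x) h h') (compSnd S S' x) k k' =
      G₃.unit (S'.η (S'.pr q'))) where
  ζ := by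
    rintro q q' x ⟨h, h', k, k', e⟩
    exact ((G₁.t_unit _).symm.trans h'.symm)
  mid := by
    rintro q q' x ⟨h, h', k, k', e⟩
    rw [k, S.s_Ψ]
  η := by
    rintro q q' x ⟨h, h', k, k', e⟩
    have := congrArg G₃.t e
    rw [S'.t_Ψ, t_unit] at this
    exact this.symm
  lift T q q' z hq hq' hz hζ hm hη := by
    have hz₁ : Smooth fun τ => FibProd.fst S.η_subm.isSubm S'.smooth_ζ_pr (z τ) :=
      (FibProd.smooth_fst _ _).comp hz
    have hz₂ : Smooth fun τ => FibProd.snd S.η_subm.isSubm S'.smooth_ζ_pr (z τ) :=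
      (FibProd.smooth_snd _ _).comp hz
    have hz' : ∀ τ, S.η (FibProd.fst S.η_subm.isSubm S'.smooth_ζ_pr (z τ)) =
        S'.ζ (S'.pr (FibProd.snd S.η_subm.isSubm S'.smooth_ζ_pr (z τ))) :=
      fun τ => FibProd.comm _ _ _
    have hζ' : ∀ τ, S.ζ (S.pr (q τ)) =
      S.ζ (FibProd.fst S.η_subm.isSubm S'.smooth_ζ_pr (z τ)) := hζ
    have hη' : ∀ τ, S'.η (S'.pr (q' τ)) =
      S'.η (S'.pr (FibProd.snd S.η_subm.isSubm S'.smooth_ζ_pr (z τ))) := hη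
    obtain ⟨a, ha, haz, h, hA⟩ := exists_comp_smooth hq hq' hz₂ hz₁ hζ' hm hz' hη'
    have hc : ∀ τ, S.η (S.pr (a τ)) =
        S'.ζ (S'.pr (FibProd.snd S.η_subm.isSubm S'.smooth_ζ_pr (z τ))) := fun τ => by
      rw [haz, hz']
    have hx := FibProd.smooth_pair S.isSubm_η_pr S'.smooth_ζ_pr hc ha hz₂
    refine ⟨T, fun τ => τ, FibProd.pair S.isSubm_η_pr S'.smooth_ζ_pr _ _ hc, IsSurjSubmersion.id _,
      hx, fun τ => FibProd.ext _ _ (haz τ) rfl, h, ?_⟩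
    exact (compA_pullback S S' hx).trans hA
  Ψ := by
    rintro q₁ q₁' x₁ q₂ q₂' x₂ p ⟨a₁, b₁, c₁, d₁, e₁⟩ ⟨a₂, b₂, c₂, d₂, e₂⟩ h h' k k' l l'
    exact compΨ_eq e₁ e₂ h h' k k' _ _ l l'

end BundleGerbe.Iso

end GerbeAction
end

noncomputable section
namespace GerbeAction

/-! ### The group of isomorphism classes of automorphisms -/

namespace Diff.IsIsotopicToId

variable {M : Mfd.{u}} {f f' : Diff M}

lemma refl : Diff.IsIsotopicToId (Diffeomorph.refl M.I M ∞) :=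
  ⟨Diffeomorph.refl _ _ _, fun _ _ => rfl, fun _ => rfl, fun _ => rfl⟩

lemma trans (hf : f.IsIsotopicToId) (hf' : f'.IsIsotopicToId) :
    Diff.IsIsotopicToId (f.trans f') := by
  obtain ⟨Φ, h, h₀, h₁⟩ := hf
  obtain ⟨Φ', h', h₀', h₁'⟩ := hf'
  refine ⟨Φ.trans Φ', fun t x => ?_, fun x => ?_, fun x => ?_⟩
  · exact (h' (Φ (t, x)).1 (Φ (t, x)).2).trans (h t x)
  · have e : Φ (0, x) = (0, x) := Prod.ext (h 0 x) (h₀ x)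
    exact (congrArg (fun y => (Φ' y).2) e).trans (h₀' x)
  · have e : Φ (1, x) = (1, f x) := Prod.ext (h 1 x) (h₁ x)
    exact (congrArg (fun y => (Φ' y).2) e).trans (h₁' (f x))

lemma symm (hf : f.IsIsotopicToId) : Diff.IsIsotopicToId f.symm := by
  obtain ⟨Φ, h, h₀, h₁⟩ := hf
  have key : ∀ t x, (Φ.symm (t, x)).1 = t := fun t x => by
    have e := h (Φ.symm (t, x)).1 (Φ.symm (t, x)).2
    rw [Prod.mk.eta, Φ.apply_symm_apply] at e
    exact e.symm
  refine ⟨Φ.symm, key, fun x => ?_, fun x => ?_⟩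
  · have e : Φ.symm (0, x) = (0, (Φ.symm (0, x)).2) := Prod.ext (key 0 x) rfl
    have e' := h₀ (Φ.symm (0, x)).2
    rw [← e, Φ.apply_symm_apply] at e'
    exact e'.symm
  · have e : Φ.symm (1, x) = (1, (Φ.symm (1, x)).2) := Prod.ext (key 1 x) rfl
    have e' := h₁ (Φ.symm (1, x)).2
    rw [← e, Φ.apply_symm_apply] at e'
    exact (f.symm_apply_apply _).symm.trans (congrArg f.symm e'.symm)

end Diff.IsIsotopicToId

/-! ### Composition, unit and inverses of automorphisms up to isomorphism -/

namespace BundleGerbe.Aut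

variable {M : Mfd.{u}} {G : BundleGerbe M}

/-- Keeps `α` fixed and rewrites only `β`, so that both isomorphisms have the same codomain
`G.pullback α.f`. -/
lemma IsIsomorphic.exists_rel {α β : Aut G} (h : IsIsomorphic α β) :
    ∃ (hf : α.f.IsIsotopicToId) (S : Iso G (G.pullback α.f)) (K : _), β = ⟨α.f, hf, S⟩ ∧
      Iso.IsTwoRel α.iso S K := by
  cases h with
  | mk f hf S S' e => exact ⟨hf, S', _, rfl, e.isTwoRel⟩

lemma isIsomorphic_of_isTwoRel {f : Diff M} {hf hf' : f.IsIsotopicToId}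
    {S S' : Iso G (G.pullback f)} {K} (h : Iso.IsTwoRel S S' K) :
    IsIsomorphic ⟨f, hf, S⟩ ⟨f, hf', S'⟩ := by
  obtain ⟨e⟩ := h.nonempty_twoIso
  exact ⟨f, hf, S, S', e⟩

lemma IsIsomorphic.refl (α : Aut G) : IsIsomorphic α α := isIsomorphic_of_isTwoRel α.iso.isTwoRel_refl

lemma IsComp.exists_rel {α' α γ : Aut G} (h : IsComp α' α γ) :
    ∃ (hf : Diff.IsIsotopicToId (α.f.trans α'.f)) (S : Iso G (G.pullback (α.f.trans α'.f)))
      (K : _), γ = ⟨α.f.trans α'.f, hf, S⟩ ∧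
        Iso.IsCompRel (G₃ := G.pullback (α.f.trans α'.f)) α.iso (α'.iso.pullback α.f) S K := by
  cases h with
  | mk f f' hf hf' hff' S S' S'' e => exact ⟨hff', S'', _, rfl, e.isCompRel⟩

lemma IsId.exists_rel {ε : Aut G} (h : IsId ε) :
    ∃ (hf : Diff.IsIsotopicToId (Diffeomorph.refl M.I M ∞))
      (S : Iso G (G.pullback (Diffeomorph.refl M.I M ∞))) (K : _), ε = ⟨_, hf, S⟩ ∧
        Iso.IsIdRel (G₁ := G) S K := by
  cases h with
  | mk h S e => exact ⟨h, S, _, rfl, e.isIdRel⟩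

/-- Composition respects isomorphism. -/
lemma IsComp.isIsomorphic {α α' β β' γ δ : Aut G} (h : IsIsomorphic α β) (h' : IsIsomorphic α' β')
    (hγ : IsComp α' α γ) (hδ : IsComp β' β δ) : IsIsomorphic γ δ := by
  obtain ⟨_, S, K, rfl, hK⟩ := h.exists_rel
  obtain ⟨_, S', K', rfl, hK'⟩ := h'.exists_rel
  obtain ⟨_, U, L, rfl, hL⟩ := hγ.exists_rel
  obtain ⟨_, V, N, rfl, hN⟩ := hδ.exists_rel
  have hK'' : Iso.IsTwoRel (α'.iso.pullback α.f) (S'.pullback α.f) K' :=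
    ⟨hK'.ζ, hK'.η, hK'.lift, hK'.Ψ⟩
  exact isIsomorphic_of_isTwoRel (hL.congr hK hK'' hN)

/-- The composite of two automorphisms. -/
def mul (α' α : Aut G) : Aut G :=
  ⟨α.f.trans α'.f, α.isotopic.trans α'.isotopic, α.iso.comp (α'.iso.pullback α.f)⟩

lemma isComp_mul (α' α : Aut G) : IsComp α' α (mul α' α) := by
  obtain ⟨e⟩ := (Iso.isCompRel_comp α.iso (α'.iso.pullback α.f)).nonempty_compIso
  exact ⟨α.f, α'.f, α.isotopic, α'.isotopic, _, α.iso, α'.iso, _, e⟩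

/-- The identity automorphism. -/
def one (G : BundleGerbe M) : Aut G := ⟨_, Diff.IsIsotopicToId.refl, G.idIso⟩

lemma isId_one : IsId (one G) := by
  obtain ⟨e⟩ := G.nonempty_idIso
  exact ⟨_, _, e⟩

lemma IsId.isIsomorphic {ε ε' : Aut G} (h : IsId ε) (h' : IsId ε') : IsIsomorphic ε ε' := by
  obtain ⟨_, S, K, rfl, hK⟩ := h.exists_rel
  obtain ⟨_, S', K', rfl, hK'⟩ := h'.exists_rel
  exact isIsomorphic_of_isTwoRel (hK.isTwoRel hK')

/-- Iterated pullback of a gerbe agrees definitionally with pullback along the composite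
diffeomorphism, so `IsCompRel.assoc` applies without transport. -/
lemma mul_assoc_isIsomorphic (α'' α' α : Aut G) :
    IsIsomorphic (mul α'' (mul α' α)) (mul (mul α'' α') α) := by
  have hA := Iso.isCompRel_comp α.iso (α'.iso.pullback α.f)
  have hC := (Iso.isCompRel_comp α'.iso (α''.iso.pullback α'.f)).pullback α.f
  have hB := Iso.isCompRel_comp (mul α' α).iso (α''.iso.pullback (mul α' α).f)
  have hD := Iso.isCompRel_comp α.iso ((mul α'' α').iso.pullback α.f)
  exact isIsomorphic_of_isTwoRel (f := (α.f.trans α'.f).trans α''.f)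
    (Iso.IsCompRel.assoc (G₄ := G.pullback ((α.f.trans α'.f).trans α''.f)) hA hB hC hD)

lemma one_mul_isIsomorphic (α : Aut G) : IsIsomorphic (mul (one G) α) α := by
  obtain ⟨e⟩ := G.nonempty_idIso
  have hK := e.isIdRel
  have hK' : Iso.IsIdRel (G₁ := G.pullback α.f) (G.idIso.pullback α.f) _ :=
    ⟨hK.s, hK.t, hK.lift, hK.Ψ⟩
  have hL := Iso.isCompRel_comp (G₃ := G.pullback α.f) α.iso (G.idIso.pullback α.f)
  exact isIsomorphic_of_isTwoRel (f := α.f) (hL.isTwoRel_of_isIdRel hK')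

section Inv

variable {f : Diff M} (S : Iso G (G.pullback f))

/-- The inverse of an isomorphism `G → f^* G`, as an isomorphism between pullbacks. -/
def invPullback (a b : Diff M) (h : IsSurjSubmersionOnto (G.pullback a).π (G.pullback b).π S.η S.ζ) :
    Iso (G.pullback a) (G.pullback b) where
  Z := S.Z
  ζ := S.η
  η := S.ζ
  ξ_subm := h
  Q := S.Q.conj
  pr := S.pr
  pr_subm := S.pr_subm
  principal := S.inv.principal
  Ψ := S.inv.Ψ
  s_Ψ := S.inv.s_Ψ
  t_Ψ := S.inv.t_Ψ
  Ψ_smul := S.inv.Ψ_smul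
  Ψ_smooth := S.inv.Ψ_smooth
  Ψ_conn := S.inv.Ψ_conn
  Ψ_μ := S.inv.Ψ_μ

/-- Apply `f` to both projections to `M` and simplify $f(f^{-1}\pi) = \pi$. That identity is only
propositional, which is why `invPullback` takes this property as an argument. -/
lemma surjSubmersionOnto_symm : IsSurjSubmersionOnto (G.pullback (Diffeomorph.refl M.I M ∞)).π
    (G.pullback f.symm).π S.η S.ζ := by
  have h := (S.ξ_subm.postcomp G.π_subm.smooth (G.pullback f).π_subm.smooth f).symm
  have e : (fun y => f ((G.pullback f).π y)) = G.π := funext fun y => f.apply_symm_apply _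
  rw [e] at h
  exact h

/-- The inverse of an automorphism. -/
def inv (α : Aut G) : Aut G :=
  ⟨α.f.symm, α.isotopic.symm, invPullback α.iso _ _ (surjSubmersionOnto_symm α.iso)⟩

/-- The diffeomorphism is a variable `g`, so that the propositional equality of $f^{-1} \circ f$
with the identity can be eliminated by substitution. -/
lemma invPullback_comp (g : Diff M) (hg : g = Diffeomorph.refl M.I M ∞)
    (h : IsSurjSubmersionOnto (G.pullback f).π (G.pullback g).π S.η S.ζ)
    (hgi : g.IsIsotopicToId) (U : Iso G (G.pullback g)) {L}
    (hL : Iso.IsCompRel S (invPullback S f g h) U L) : IsIsomorphic ⟨g, hgi, U⟩ (one G) := by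
  subst hg
  obtain ⟨e⟩ := G.nonempty_idIso
  have hL' : Iso.IsCompRel (G₃ := G) S S.inv U L := hL
  exact isIsomorphic_of_isTwoRel (hL'.isTwoRel_inv e.isIdRel)

lemma inv_mul_isIsomorphic (α : Aut G) : IsIsomorphic (mul (inv α) α) (one G) := by
  have hL := Iso.isCompRel_comp α.iso ((inv α).iso.pullback α.f)
  exact invPullback_comp α.iso (α.f.trans α.f.symm) (Diffeomorph.self_trans_symm α.f)
    ((inv α).iso.pullback α.f).ξ_subm _ _ hL

end Inv

end BundleGerbe.Aut

end GerbeAction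
end

noncomputable section
namespace GerbeAction

/-! ### The action on curvings -/

namespace BundleGerbe

namespace Iso

variable {M : Mfd.{u}} {G₁ G₂ G₃ : BundleGerbe M} {S : Iso G₁ G₂} {T : Mfd.{u}}

/-- The curvature form is unique, so the existential in `Relates` may be replaced by any given one.
-/
lemma relates_iff {F : DForm S.Z 2} (hF : S.IsCurvature F) {b₁ : DForm G₁.Y 2}
    {b₂ : DForm G₂.Y 2} : S.Relates b₁ b₂ ↔ b₁.pullback S.ζ = b₂.pullback S.η - F := by
  refine ⟨fun ⟨F', hF', h⟩ => ?_, fun h => ⟨F, hF, ?_⟩⟩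
  · rw [S.existsUnique_isCurvature.unique hF hF', h, add_sub_cancel_right]
  · rw [h, sub_add_cancel]

lemma Relates.pullback {b₁ : DForm G₁.Y 2} {b₂ : DForm G₂.Y 2} (h : S.Relates b₁ b₂)
    {q : T → S.Q.tot} (hq : Smooth q) : b₁.pullback (fun τ => S.ζ (S.pr (q τ))) =
      b₂.pullback (fun τ => S.η (S.pr (q τ))) - S.Q.A.d.pullback q := by
  obtain ⟨F, hF, -⟩ := S.existsUnique_isCurvature
  exact hF.pullback_curving ((relates_iff hF).1 h) hq

/-- On a cover of `Q` both forms become $\eta^*b_2 - d\Theta$, since related points carry the same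
connection form and the same base points. -/
lemma IsTwoRel.eq_of_relates {S' : Iso G₁ G₂} {K} (hK : IsTwoRel S S' K) {b₁ b₁' : DForm G₁.Y 2}
    {b₂ : DForm G₂.Y 2} (h : S.Relates b₁ b₂) (h' : S'.Relates b₁' b₂) : b₁ = b₁' := by
  obtain ⟨T, c, q, hc, hq, hKq, hA⟩ := hK.exists_lift (Smooth.id S.Q.tot)
  have hs := (S.ζ_subm.comp S.pr_subm).comp hc
  apply hs.pullback_injective
  have e := congrArg DForm.d hA
  rw [S'.Q.smooth_A.d_pullback hq, S.Q.smooth_A.d_pullback hc.smooth] at e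
  rw [h.pullback hc.smooth, ← e]
  have e' := h'.pullback hq
  rw [funext fun τ => (hK.ζ (hKq τ)).symm, funext fun τ => (hK.η (hKq τ)).symm] at e'
  exact e'.symm

/-- On a cover $d\Theta'' = d\Theta + d\Theta'$, so subtracting the curvatures in two steps or in
one gives the same form. -/
lemma IsCompRel.eq_of_relates {S' : Iso G₂ G₃} {S'' : Iso G₁ G₃} {K} (hK : IsCompRel S S' S'' K)
    {b₁ b₁' : DForm G₁.Y 2} {b₂ : DForm G₂.Y 2} {b₃ : DForm G₃.Y 2} (h : S.Relates b₁ b₂)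
    (h' : S'.Relates b₂ b₃) (h'' : S''.Relates b₁' b₃) : b₁ = b₁' := by
  obtain ⟨T₁, c₁, q', hc₁, hq', hζ⟩ := (S'.ζ_subm.comp S'.pr_subm).exists_lift
    (S.η_subm.comp S.pr_subm).smooth
  obtain ⟨T₂, c₂, q'', hc₂, hq'', hKq⟩ := hK.exists_lift hc₁.smooth hq' fun τ => (hζ τ).symm
  have hc := hc₁.comp hc₂
  have hq₂' := hq'.comp hc₂.smooth
  have hs := (S.ζ_subm.comp S.pr_subm).comp hc
  apply hs.pullback_injective
  have hA := congrArg DForm.d (hK.conn hc.smooth hq₂' hq'' hKq)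
  rw [(S.Q.smooth_A.pullback hc.smooth).d_add (S'.Q.smooth_A.pullback hq₂'),
    S''.Q.smooth_A.d_pullback hq'', S.Q.smooth_A.d_pullback hc.smooth,
    S'.Q.smooth_A.d_pullback hq₂'] at hA
  have e := h.pullback hc.smooth
  have e' := h'.pullback hq₂'
  have e'' := h''.pullback hq''
  rw [funext fun τ => hK.mid (hKq τ), e', funext fun τ => hK.η (hKq τ)] at e
  rw [funext fun τ => (hK.ζ (hKq τ)).symm, hA] at e''
  rw [e, e'', sub_sub, add_comm]

/-- On a cover of `P` the curvature is $dA = t^*b - s^*b$ while $\eta = t$, which leaves $s^*b$. -/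
lemma IsIdRel.eq_of_relates {E : Iso G₁ G₁} {K} (hK : IsIdRel E K) {b b' : DForm G₁.Y 2}
    (hb : G₁.IsCurving b) (h : E.Relates b' b) : b' = b := by
  obtain ⟨T, c, k, hc, hk, hKk, hA⟩ := hK.exists_lift (Smooth.id G₁.P.tot)
  have hs := G₁.s_subm.comp hc
  apply hs.pullback_injective
  have e := congrArg DForm.d hA
  rw [E.Q.smooth_A.d_pullback hk, G₁.P.smooth_A.d_pullback hc.smooth, hb.pullback_d hc.smooth] at e
  have e' := h.pullback hk
  rw [e, funext fun τ => (hK.s (hKk τ)).symm, funext fun τ => (hK.t (hKk τ)).symm,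
    sub_sub_cancel] at e'
  exact e'

end Iso

variable {M : Mfd.{u}} {G : BundleGerbe M}

lemma Iso.existsUnique_relates {f : Diff M} (S : Iso G (G.pullback f)) (b : G.Curving) :
    ∃! b' : G.Curving, S.Relates b'.1 b.1 := by
  obtain ⟨F, hF, -⟩ := S.existsUnique_isCurvature
  have hb : (G.pullback f).IsCurving b.1 := b.2.of_pullback
  obtain ⟨b', ⟨hs, h⟩, hu⟩ := hF.existsUnique_descent hb
  exact ⟨⟨b', hF.isCurving hb hs h⟩, (relates_iff hF).2 h,
    fun b'' h'' => Subtype.ext (hu _ ⟨b''.2.smooth, (relates_iff hF).1 h''⟩)⟩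

namespace Aut

/-- The curving induced by an automorphism. -/
def act (b : G.Curving) (α : Aut G) : G.Curving := (α.iso.existsUnique_relates b).choose

lemma relates_act (b : G.Curving) (α : Aut G) : α.iso.Relates (act b α).1 b.1 :=
  (α.iso.existsUnique_relates b).choose_spec.1

lemma relates_iff_eq_act (b b' : G.Curving) (α : Aut G) :
    α.iso.Relates b'.1 b.1 ↔ b' = act b α :=
  ⟨fun h => (α.iso.existsUnique_relates b).unique h (relates_act b α),
    fun h => h ▸ relates_act b α⟩

/-- The curvature does not involve the curving and cancels; the pullback of `ϕ` moves across by
$\pi\eta = f\pi\zeta$. -/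
lemma act_add (b₁ b₂ : G.Curving) (α : Aut G) {ϕ : DForm M 2}
    (h : b₁.1 = b₂.1 + ϕ.pullback G.π) :
    (act b₁ α).1 = (act b₂ α).1 + (ϕ.pullback α.f).pullback G.π := by
  obtain ⟨F, hF, -⟩ := α.iso.existsUnique_isCurvature
  have h₁ := (Iso.relates_iff hF).1 (relates_act b₁ α)
  have h₂ := (Iso.relates_iff hF).1 (relates_act b₂ α)
  apply α.iso.ζ_subm.pullback_injective
  have e : (fun z => G.π (α.iso.η z)) = fun z => α.f (G.π (α.iso.ζ z)) := funext fun z => by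
    have := α.iso.π_η z
    rw [this]
    exact (α.f.apply_symm_apply _).symm
  have e₁ : ((ϕ.pullback α.f).pullback G.π).pullback α.iso.ζ =
      ϕ.pullback (fun z => α.f (G.π (α.iso.ζ z))) := by
    rw [DForm.pullback_comp G.π_subm.smooth α.iso.ζ_subm.smooth,
      DForm.pullback_comp α.f.smooth (G.π_subm.smooth.comp α.iso.ζ_subm.smooth)]
  have e₂ : (ϕ.pullback G.π).pullback α.iso.η = ϕ.pullback fun z => G.π (α.iso.η z) :=
    DForm.pullback_comp G.π_subm.smooth α.iso.η_subm.smooth ϕ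
  have h₃ : b₁.1.pullback α.iso.η =
      b₂.1.pullback α.iso.η + ϕ.pullback fun z => G.π (α.iso.η z) := by
    rw [h, ← e₂]
    rfl
  rw [DForm.pullback_add, e₁, ← e]
  refine h₁.trans ((congrArg (· - F) h₃).trans ?_)
  rw [add_sub_right_comm]
  exact congrArg (· + _) h₂.symm

lemma IsId.act_eq {ε : Aut G} (h : IsId ε) (b : G.Curving) : act b ε = b := by
  have hr := relates_act b ε
  obtain ⟨_, S, K, rfl, hK⟩ := h.exists_rel
  exact Subtype.ext (hK.eq_of_relates b.2 hr)

lemma IsComp.act_eq {α' α γ : Aut G} (h : IsComp α' α γ) (b : G.Curving) :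
    act b γ = act (act b α') α := by
  have hr := relates_act b γ
  have h₁ := relates_act b α'
  have h₂ := relates_act (act b α') α
  obtain ⟨_, S, K, rfl, hK⟩ := h.exists_rel
  have h₁' : (α'.iso.pullback α.f).Relates (act b α').1 b.1 := by
    obtain ⟨F, hF, e⟩ := h₁
    exact ⟨F, ⟨hF.smooth, hF.eq⟩, e⟩
  exact Subtype.ext (hK.eq_of_relates h₂ h₁' hr).symm

lemma IsIsomorphic.act_eq {α β : Aut G} (h : IsIsomorphic α β) (b : G.Curving) :
    act b α = act b β := by
  have h₁ := relates_act b α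
  have h₂ := relates_act b β
  obtain ⟨_, S, K, rfl, hK⟩ := h.exists_rel
  exact Subtype.ext (hK.eq_of_relates h₁ h₂)

end Aut

/-! ### The group of isomorphism classes and its right action -/

namespace Pi0

lemma cls_eq {α β : Aut G} (h : Aut.IsIsomorphic α β) : α.cls = β.cls := Quot.sound h

/-- The multiplication of `π₀ Aut(G)`. -/
def mul : G.Pi0 → G.Pi0 → G.Pi0 :=
  Quot.map₂ Aut.mul
    (fun α' _ _ h => (Aut.isComp_mul α' _).isIsomorphic h (.refl α') (Aut.isComp_mul α' _))
    (fun _ _ α h => (Aut.isComp_mul _ α).isIsomorphic (.refl α) h (Aut.isComp_mul _ α))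

local instance : Mul G.Pi0 := ⟨mul⟩

local instance : One G.Pi0 := ⟨(Aut.one G).cls⟩

-- Inverting a chosen representative suffices: the left inverse law is checked on it, and
-- compatibility of `Aut.inv` with isomorphism is never needed.
local instance : Inv G.Pi0 := ⟨fun x => (Aut.inv x.out).cls⟩

lemma cls_mul_cls (α' α : Aut G) : α'.cls * α.cls = (Aut.mul α' α).cls := rfl

lemma exists_cls (x : G.Pi0) : ∃ α : Aut G, α.cls = x := Quot.exists_rep x

/-- The group structure of `π₀ Aut(G)`. -/
@[reducible] def group : Group G.Pi0 :=
  Group.ofLeftAxioms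
    (fun x y z => by
      obtain ⟨α, rfl⟩ := exists_cls x
      obtain ⟨β, rfl⟩ := exists_cls y
      obtain ⟨γ, rfl⟩ := exists_cls z
      exact (cls_eq (Aut.mul_assoc_isIsomorphic α β γ)).symm)
    (fun x => by
      obtain ⟨α, rfl⟩ := exists_cls x
      exact cls_eq (Aut.one_mul_isIsomorphic α))
    (fun x => by
      have h := cls_eq (Aut.inv_mul_isIsomorphic x.out)
      rw [← cls_mul_cls] at h
      have e : x.out.cls = x := Quot.out_eq x
      rw [e] at h
      exact h)

attribute [local instance] group

lemma cls_of_isComp {α' α γ : Aut G} (h : Aut.IsComp α' α γ) : γ.cls = α'.cls * α.cls :=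
  cls_eq (h.isIsomorphic (.refl α) (.refl α') (Aut.isComp_mul α' α))

lemma cls_of_isId {ε : Aut G} (h : Aut.IsId ε) : ε.cls = 1 := cls_eq (h.isIsomorphic Aut.isId_one)

/-- The right action of `π₀ Aut(G)` on curvings. -/
@[reducible] def mulAction : MulAction G.Pi0ᵐᵒᵖ G.Curving where
  smul x b := Quot.lift (Aut.act b) (fun _ _ h => h.act_eq b) x.unop
  one_smul b := Aut.isId_one.act_eq b
  mul_smul := by
    rintro ⟨x⟩ ⟨y⟩ b
    obtain ⟨α, rfl⟩ := exists_cls x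
    obtain ⟨β, rfl⟩ := exists_cls y
    -- Multiplication in the opposite group reverses the order, so the composite is $\beta \circ
    -- \alpha$ with `β` acting first on `b`.
    exact (Aut.isComp_mul β α).act_eq b

attribute [local instance] mulAction

lemma op_cls_smul (b : G.Curving) (α : Aut G) : MulOpposite.op α.cls • b = Aut.act b α := rfl

end Pi0

end BundleGerbe

end GerbeAction
end

/-! ### The main theorem -/

theorem mainTheorem4 {M : Mfd.{u}} (G : BundleGerbe M) :
    -- every curving has a unique curvature three-form on `M`
    (∀ b : G.Curving, ∃! H : DForm M 3, G.IsCurvature b.1 H) ∧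
    -- the curving induced by an isomorphism `G → f^* G` over a diffeomorphism `f`
    (∀ (f : Diff M) (S : BundleGerbe.Iso G (G.pullback f)) (b : G.Curving),
      (∃! F : DForm S.Z 2, S.IsCurvature F) ∧
      ∀ F : DForm S.Z 2, S.IsCurvature F →
        -- `η^* b - F_Θ` is annihilated by the Čech differential of `ζ : Z → Y`
        (∀ (T : Mfd.{u}) (z₁ z₂ : T → S.Z), Smooth z₁ → Smooth z₂ →
          (∀ τ, S.ζ (z₁ τ) = S.ζ (z₂ τ)) →
          DForm.pullback z₂ (DForm.pullback S.η b.1 - F) -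
            DForm.pullback z₁ (DForm.pullback S.η b.1 - F) = 0) ∧
        -- it descends to a unique form on `Y`, which is a curving, with curvature `f^* H_b`
        (∃! b' : DForm G.Y 2, b'.IsSmooth ∧
          DForm.pullback S.ζ b' = DForm.pullback S.η b.1 - F) ∧
        ∀ b' : DForm G.Y 2, b'.IsSmooth →
          DForm.pullback S.ζ b' = DForm.pullback S.η b.1 - F →
          G.IsCurving b' ∧
            ∀ H : DForm M 3, G.IsCurvature b.1 H → G.IsCurvature b' (DForm.pullback f H)) ∧
    -- the curvings form an affine space modelled on `Ω²(M)`
    (∀ (b : G.Curving) (ϕ : DForm M 2), ϕ.IsSmooth →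
      G.IsCurving (b.1 + DForm.pullback G.π ϕ)) ∧
    (∀ b₁ b₂ : G.Curving, ∃! ϕ : DForm M 2, ϕ.IsSmooth ∧
      b₁.1 = b₂.1 + DForm.pullback G.π ϕ) ∧
    -- sending `b` to the induced curving `b'` is a right action of the 2-group of automorphisms
    ∃ act : G.Curving → G.Aut → G.Curving,
      (∀ (b b' : G.Curving) (α : G.Aut), α.iso.Relates b'.1 b.1 ↔ b' = act b α) ∧
      (∀ (b₁ b₂ : G.Curving) (α : G.Aut) (ϕ : DForm M 2), ϕ.IsSmooth →
        b₁.1 = b₂.1 + DForm.pullback G.π ϕ →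
        (act b₁ α).1 = (act b₂ α).1 + DForm.pullback G.π (DForm.pullback α.f ϕ)) ∧
      (∀ ε : G.Aut, ε.IsId → ∀ b, act b ε = b) ∧
      (∀ α' α γ : G.Aut, BundleGerbe.Aut.IsComp α' α γ →
        ∀ b, act b γ = act (act b α') α) ∧
      (∀ α β : G.Aut, α.IsIsomorphic β → ∀ b, act b α = act b β) ∧
      -- it factors through a right action of the group `π₀ Aut`
      ∃ (_ : Group G.Pi0) (_ : MulAction G.Pi0ᵐᵒᵖ G.Curving),
        (∃ ε : G.Aut, ε.IsId) ∧
        (∀ ε : G.Aut, ε.IsId → ε.cls = 1) ∧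
        (∀ α' α : G.Aut, ∃ γ, BundleGerbe.Aut.IsComp α' α γ) ∧
        (∀ α' α γ : G.Aut, BundleGerbe.Aut.IsComp α' α γ → γ.cls = α'.cls * α.cls) ∧
        ∀ (b : G.Curving) (α : G.Aut), MulOpposite.op α.cls • b = act b α := by
  refine ⟨fun b => b.2.existsUnique_isCurvature, fun f S b => ?_,
    fun b _ hϕ => b.2.add_pullback hϕ, fun b₁ b₂ => b₁.2.existsUnique_sub b₂.2,
    BundleGerbe.Aut.act, BundleGerbe.Aut.relates_iff_eq_act,
    fun b₁ b₂ α _ _ h => BundleGerbe.Aut.act_add b₁ b₂ α h, fun _ h => h.act_eq,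
    fun _ _ _ h => h.act_eq, fun _ _ h => h.act_eq, BundleGerbe.Pi0.group, BundleGerbe.Pi0.mulAction,
    ⟨BundleGerbe.Aut.one G, BundleGerbe.Aut.isId_one⟩,
    fun _ => BundleGerbe.Pi0.cls_of_isId, fun α' α => ⟨_, BundleGerbe.Aut.isComp_mul α' α⟩,
    fun _ _ _ => BundleGerbe.Pi0.cls_of_isComp, BundleGerbe.Pi0.op_cls_smul⟩
  have hb : (G.pullback f).IsCurving b.1 := b.2.of_pullback
  refine ⟨S.existsUnique_isCurvature, fun F hF => ⟨fun T z₁ z₂ hz₁ hz₂ h =>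
    sub_eq_zero.2 (hF.cech hb hz₁ hz₂ h).symm, hF.existsUnique_descent hb,
    fun b' hb' h => ⟨hF.isCurving hb hb' h, fun H hH =>
      hF.isCurvature hb hb' h hH.of_pullback⟩⟩⟩
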